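/- \textbf{Setting.} Let $m,p\ge 1$ and consider the system $\dot x=Ax+Bu$, $y=Cx$ with $x(t)\in\mathbb R^n$, $u(t)\in\mathbb R^m$, $y(t)\in\mathbb R^p$ and $x(0)\sim\mathcal D$, where $\mathcal D$ is a probability distribution with $E[x(0)x(0)^\top]\succ 0$ and $\|x(0)\|\le P$ almost surely for a constant $P>0$. Let $Q\succ0$ ($p\times p$) and $R\succ0$ ($m\times m$). For $K\in\mathbb R^{m\times p}$ consider the feedback $u=-Ky$, let $S=\{K : A-BKC \text{ is Hurwitz}\}$, and $$f(K)=E_{x(0)\sim\mathcal D}\Big[\int_0^\infty \big(y(t)^\top Qy(t)+u(t)^\top Ru(t)\big)\,dt\Big],\qquad S(a)=\{K\in S: f(K)\le a\}.$$ Gains carry the Frobenius norm and inner product; $\operatorname{proj}$ is the orthogonal projection onto a closed convex set $\Omega\subseteq\mathbb R^{m\times p}$. For $\alpha,\eta>0$, $K$ is called an $\eta$-stationary point if $\|G_\alpha(K)\|_F\le\eta$, where $G_\alpha(K)=\frac1\alpha\big(\operatorname{proj}(K-\alpha\nabla f(K))-K\big)$. \textbf{Gradient estimate.} Given $K$, $N$,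 $r$, $\tau$, draw for $i=1,\dots,N$ a matrix $U_i$ uniformly from the sphere $\|U\|_F=\sqrt{mp}$ and, independently, $x_i(0)\sim\mathcal D$; let $c_i$ be the cost $\int_0^\tau (y_i^\top Qy_i+u_i^\top Ru_i)\,dt$ along the trajectory with $u_i=-(K+rU_i)y_i$ started at $x_i(0)$; put $\hat\nabla f(K)=\frac1{rN}\sum_{i=1}^N c_iU_i$. \textbf{Algorithm.} Given $T\ge1$, $\alpha,\varepsilon>0$ and $K_0\in\Omega$, for $i=0,\dots,T-1$ compute $\hat\nabla f(K_i)$ with fresh independent samples and set $K_{i+1}=\operatorname{proj}(K_i-\alpha\hat\nabla f(K_i))$; if $\|K_{i+1}-K_i\|_F\le\varepsilon\alpha$, stop and return $K_i$. If this never happens, return $K_T$. Let $T'$ be the index of the returned gain, so $T'\le T$ and $K_{T'}$ is returned. \textbf{Theorem.} For every $a$ there is $c_2>0$, and for every $c_1\in(0,c_2]$ there are $c_\tau,c_N>0$, with $c_2$ depending only on $A,B,C,Q,R,\mathcal D,P,a$, and $c_\tau,c_N$ only on these and $c_1$, such that the following holds. Let $\Omega$ be closed and convex, $K_0\in\Omega\cap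 S(a)$, and let $L>0$ be a Lipschitz constant of $\nabla f$ on $S(f(K_0))$ (it is enough that $\|\nabla f(K)-\nabla f(K')\|_F\le L\|K-K'\|_F$ whenever the segment from $K$ to $K'$ lies in $S(f(K_0))$). Let $0<\lambda<1$, $\varepsilon>0$, $\delta>0$, $\alpha\in\big(0,\frac{2(1-\lambda)}{L}\big)$, $T\ge1$, and, with $e=\min(1,\lambda\varepsilon)$ and $d=\min(1,\delta)$, let $$c_1e\le r\le c_2e,\qquad \tau\ge c_\tau\big(1+\log\tfrac1e\big),\qquad N\ge c_N\,\frac{1+\log\frac1d}{e^4}.$$ Then there is an event of probability greater than $1-T\delta$ on which both of the following hold: \begin{itemize} \item $K_i\in S$ for all $0\le i\le T'$, and $f(K_{i+1})<f(K_i)$ for all $0\le i\le T'-1$; \item if $T>\dfrac{f(K_0)}{\varepsilon^2\alpha^2\big(\frac{1-\lambda}{\alpha}-\frac L2\big)}$, then $K_{T'}$ is a $(1+\lambda)\varepsilon$-stationary point. \end{itemize} -/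

import Mathlib

open MeasureTheory ProbabilityTheory
open scoped Matrix

/-- The space of feedback gains `K ∈ ℝ^{m×p}` with the Frobenius norm and inner product,
realised as the Euclidean space on the index set `Fin m × Fin p`. -/
abbrev Gain (m p : ℕ) : Type := EuclideanSpace ℝ (Fin m × Fin p)

/-- The matrix with the entries of a gain. -/
def Gain.mat {m p : ℕ} (K : Gain m p) : Matrix (Fin m) (Fin p) ℝ :=
  Matrix.of fun i j => K (i, j)

/-- A real square matrix is Hurwitz if all its complex eigenvalues have negative real part. -/
def IsHurwitz {n : ℕ} (M : Matrix (Fin n) (Fin n) ℝ) : Prop :=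
  ∀ z ∈ spectrum ℂ (M.map ((↑) : ℝ → ℂ)), z.re < 0

/-- The data of a static output feedback LQR problem: the system `x' = A x + B u`, `y = C x`,
the weights `Q` (on outputs) and `R` (on inputs), and the law `𝒟` of the initial state. -/
structure OutputFeedbackLQR (n m p : ℕ) where
  A : Matrix (Fin n) (Fin n) ℝ
  B : Matrix (Fin n) (Fin m) ℝ
  C : Matrix (Fin p) (Fin n) ℝ
  Q : Matrix (Fin p) (Fin p) ℝ
  R : Matrix (Fin m) (Fin m) ℝ
  𝒟 : Measure (EuclideanSpace ℝ (Fin n))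

noncomputable section

namespace OutputFeedbackLQR

variable {n m p : ℕ} (𝒮 : OutputFeedbackLQR n m p)

/-- The second moment matrix `E[x(0) x(0)ᵀ]` of the initial state. -/
def initialSecondMoment : Matrix (Fin n) (Fin n) ℝ :=
  Matrix.of fun i j => ∫ x, x i * x j ∂𝒮.𝒟

/-- The closed loop matrix `A - B K C` under the feedback `u = -K y`. -/
def closedLoop (K : Gain m p) : Matrix (Fin n) (Fin n) ℝ := 𝒮.A - 𝒮.B * K.mat * 𝒮.C

/-- The set of stabilizing gains. -/
def stabilizing : Set (Gain m p) := {K | IsHurwitz (𝒮.closedLoop K)}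

/-- The state `x(t)` of the system under the feedback `u = -K y`, started at `x₀`. -/
def stateAt (K : Gain m p) (x₀ : EuclideanSpace ℝ (Fin n)) (t : ℝ) : Fin n → ℝ :=
  NormedSpace.exp (t • 𝒮.closedLoop K) *ᵥ x₀.ofLp

/-- The output `y(t) = C x(t)`. -/
def outputAt (K : Gain m p) (x₀ : EuclideanSpace ℝ (Fin n)) (t : ℝ) : Fin p → ℝ :=
  𝒮.C *ᵥ 𝒮.stateAt K x₀ t

/-- The input `u(t) = -K y(t)`. -/
def inputAt (K : Gain m p) (x₀ : EuclideanSpace ℝ (Fin n)) (t : ℝ) : Fin m → ℝ :=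
  -(K.mat *ᵥ 𝒮.outputAt K x₀ t)

theorem stateAt_zero (K : Gain m p) (x₀ : EuclideanSpace ℝ (Fin n)) :
    𝒮.stateAt K x₀ 0 = x₀.ofLp := by
  simp [stateAt]

open scoped Matrix.Norms.Operator in
theorem hasDerivAt_stateAt (K : Gain m p) (x₀ : EuclideanSpace ℝ (Fin n)) (t : ℝ) :
    HasDerivAt (𝒮.stateAt K x₀)
      (𝒮.A *ᵥ 𝒮.stateAt K x₀ t + 𝒮.B *ᵥ 𝒮.inputAt K x₀ t) t := by
  have h := hasDerivAt_exp_smul_const' (𝕂 := ℝ) (𝒮.closedLoop K) t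
  have h2 := ((Matrix.mulVecBilin ℝ ℝ).flip x₀.ofLp).toContinuousLinearMap.hasFDerivAt.comp_hasDerivAt
    t h
  have e : 𝒮.A *ᵥ 𝒮.stateAt K x₀ t + 𝒮.B *ᵥ 𝒮.inputAt K x₀ t
      = (𝒮.closedLoop K * NormedSpace.exp (t • 𝒮.closedLoop K)) *ᵥ x₀.ofLp := by
    rw [← Matrix.mulVec_mulVec]
    simp only [inputAt, outputAt, stateAt]
    generalize NormedSpace.exp (t • 𝒮.closedLoop K) *ᵥ x₀.ofLp = v
    simp [closedLoop, Matrix.add_mulVec, Matrix.neg_mulVec, Matrix.mulVec_neg, Matrix.mulVec_mulVec,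
      Matrix.mul_assoc, sub_eq_add_neg]
  rw [e]
  exact h2

/-- The instantaneous cost `y(t)ᵀ Q y(t) + u(t)ᵀ R u(t)`. -/
def stageCost (K : Gain m p) (x₀ : EuclideanSpace ℝ (Fin n)) (t : ℝ) : ℝ :=
  𝒮.outputAt K x₀ t ⬝ᵥ 𝒮.Q *ᵥ 𝒮.outputAt K x₀ t
    + 𝒮.inputAt K x₀ t ⬝ᵥ 𝒮.R *ᵥ 𝒮.inputAt K x₀ t

/-- The cost of the gain `K` from the initial state `x₀` up to time `τ`. -/
def truncatedCost (K : Gain m p) (τ : ℝ) (x₀ : EuclideanSpace ℝ (Fin n)) : ℝ :=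
  ∫ t in (0 : ℝ)..τ, 𝒮.stageCost K x₀ t

/-- The objective `f(K) = E_{x(0) ∼ 𝒟} ∫₀^∞ (yᵀ Q y + uᵀ R u) dt`; only its values and
gradients at stabilizing gains are used. -/
def cost (K : Gain m p) : ℝ :=
  ∫ x₀, (∫ t in Set.Ioi (0 : ℝ), 𝒮.stageCost K x₀ t) ∂𝒮.𝒟

/-- The sublevel set `S(a) = {K stabilizing : f(K) ≤ a}`. -/
def sublevel (a : ℝ) : Set (Gain m p) := {K | K ∈ 𝒮.stabilizing ∧ 𝒮.cost K ≤ a}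

/-- The zeroth-order gradient estimate `(1/(rN)) ∑ᵢ cᵢ Uᵢ`, where `cᵢ` is the empirical cost, up
to time `τ`, of the perturbed gain `K + r Uᵢ` on the trajectory started at `Xᵢ`. -/
def gradEstimate (r τ : ℝ) (N : ℕ) (U : ℕ → Gain m p) (X : ℕ → EuclideanSpace ℝ (Fin n))
    (K : Gain m p) : Gain m p :=
  (1 / (r * (N : ℝ))) • ∑ i ∈ Finset.range N, 𝒮.truncatedCost (K + r • U i) τ (X i) • U i

end OutputFeedbackLQR

/-- The uniform distribution on the matrices `U ∈ ℝ^{m×p}` with `‖U‖_F = √(mp)`: the normalised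
surface measure of the unit sphere, scaled by `√(mp)`. -/
def uniformSphere (m p : ℕ) : Measure (Gain m p) :=
  Measure.map (fun u : Metric.sphere (0 : Gain m p) 1 => Real.sqrt ((m : ℝ) * p) • (u : Gain m p))
    (((volume : Measure (Gain m p)).toSphere Set.univ)⁻¹ •
      (volume : Measure (Gain m p)).toSphere)

instance isProbabilityMeasure_uniformSphere (m p : ℕ) [NeZero m] [NeZero p] :
    IsProbabilityMeasure (uniformSphere m p) := by
  have h0 : (volume : Measure (Gain m p)).toSphere Set.univ ≠ 0 := by
    rw [ne_eq, Measure.measure_univ_eq_zero]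
    exact Measure.toSphere_ne_zero _
  have : IsProbabilityMeasure (((volume : Measure (Gain m p)).toSphere Set.univ)⁻¹ •
      (volume : Measure (Gain m p)).toSphere) := by
    constructor
    rw [Measure.smul_apply, smul_eq_mul]
    exact ENNReal.inv_mul_cancel h0 (measure_ne_top _ _)
  refine Measure.isProbabilityMeasure_map ?_
  fun_prop

open Classical in
/-- The orthogonal projection onto `Ω`: a point of `Ω` nearest to `y` (it exists and is unique when
`Ω` is a nonempty closed convex set; the default value `y` is used if there is none). -/
def projOnto {m p : ℕ} (Ω : Set (Gain m p)) (y : Gain m p) : Gain m p :=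
  if h : ∃ z ∈ Ω, ∀ w ∈ Ω, ‖y - z‖ ≤ ‖y - w‖ then h.choose else y

theorem projOnto_spec {m p : ℕ} {Ω : Set (Gain m p)} (hne : Ω.Nonempty) (hcl : IsClosed Ω)
    (y : Gain m p) : projOnto Ω y ∈ Ω ∧ ∀ w ∈ Ω, ‖y - projOnto Ω y‖ ≤ ‖y - w‖ := by
  have h : ∃ z ∈ Ω, ∀ w ∈ Ω, ‖y - z‖ ≤ ‖y - w‖ := by
    obtain ⟨z, hz, hd⟩ := hcl.exists_infDist_eq_dist hne y
    refine ⟨z, hz, fun w hw => ?_⟩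
    rw [← dist_eq_norm, ← dist_eq_norm, ← hd]
    exact Metric.infDist_le_dist_of_mem hw
  rw [projOnto, dif_pos h]
  exact h.choose_spec

/-- The iterates `K_{k+1} = proj_Ω (K_k - α ∇̂f(K_k))`, where the gradient at step `k` is estimated
from the samples `(U k i, X k i)`, `i < N`. -/
def pgIterate {n m p : ℕ} (𝒮 : OutputFeedbackLQR n m p) (Ω : Set (Gain m p)) (α r τ : ℝ) (N : ℕ)
    (U : ℕ → ℕ → Gain m p) (X : ℕ → ℕ → EuclideanSpace ℝ (Fin n)) (K₀ : Gain m p) :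
    ℕ → Gain m p
  | 0 => K₀
  | k + 1 =>
    projOnto Ω (pgIterate 𝒮 Ω α r τ N U X K₀ k -
      α • 𝒮.gradEstimate r τ N (U k) (X k) (pgIterate 𝒮 Ω α r τ N U X K₀ k))

/-- The index `T'` of the returned gain: the first `k < T` at which the termination condition
`‖K_{k+1} - K_k‖ ≤ ε α` holds, and `T` if there is no such `k`. -/
def stopIndex {m p : ℕ} (T : ℕ) (ε α : ℝ) (K : ℕ → Gain m p) : ℕ :=
  sInf {k | k = T ∨ ‖K (k + 1) - K k‖ ≤ ε * α}

/-- `K` is an `ε`-stationary point: the gradient mapping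
`G_α(K) = (1/α) (proj_Ω (K - α ∇f(K)) - K)` has norm at most `ε`. -/
def IsEpsStationary {m p : ℕ} (f : Gain m p → ℝ) (Ω : Set (Gain m p)) (α ε : ℝ) (K : Gain m p) :
    Prop :=
  ‖(1 / α) • (projOnto Ω (K - α • gradient f K) - K)‖ ≤ ε

end

/-!
The cost of a stabilizing gain `K` is `φ(Y)`, where `Y = ∫₀^∞ exp(tM)⋆ W exp(tM) dt` solves the
Lyapunov equation of the closed loop `M = A - BKC` with the stage weight `W`, and `φ` is the
functional `W ↦ E ⟪x(0), W x(0)⟫`. The proof has a uniform analytic part, a probabilistic part and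
a deterministic part.

*Uniformity on a sublevel set.* Since the second moment of `x(0)` is positive definite, `φ(Y)`
controls the mean square of the operator norm of the semigroup. On `S(a)` the state energy is bounded
by the cost: although `C` need not be injective, the Lyapunov function of one fixed member of `S(a)`
detects the state through the output (`lyap_one_le`). Hence on `S(a)` the induced state feedbacks are
bounded and all closed loops are contractions at one common time
(`exists_bounds_of_lqrValue_le`). Uniform exponential decay persists in a neighbourhood of fixed
radius, and comparing Lyapunov integrals for two generators gives a first order expansion of the
cost with a uniform quadratic remainder (`exists_abs_lqrValue_sub_le`,
`OutputFeedbackLQR.exists_expansion_on_sublevel`). Consequences: the stabilizing set is open, the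
cost is differentiable on it, and `S(a)` is closed.

*One gradient estimate.* The uniform distribution on the sphere of radius `√(mp)` is isotropic with
identity covariance, so smoothing turns the expansion into the gradient: with radius `r` of order `e`
and a horizon of order `1 + log (1/e)`, the bias is at most `e/2`. The terms of the estimator are
bounded uniformly over `S(a)`, so Hoeffding's inequality in each coordinate bounds the failure
probability at a fixed gain (`OutputFeedbackLQR.exists_sample_complexity`).

*All iterations.* The iterate `K_k` depends on the samples of earlier steps only, hence is
independent of the samples of step `k`; integrating the bound for a fixed gain over the law of `K_k`,
and a union bound over `k < T`, give the event of the theorem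
(`OutputFeedbackLQR.exists_event_accurate`).

*Descent.* On this event the variational inequality of the projection makes each step a descent
direction with slope at least `(1-λ)/α > L/2`, as long as the step is longer than `εα`. A continuous
induction along the step, using that the stabilizing set is open and the sublevel set closed, shows
that the whole segment stays in `S(f(K₀))`, where the quadratic upper bound applies
(`OutputFeedbackLQR.cost_add_le_of_inner_le`). As the cost is nonnegative, a large `T` forces the
termination condition to hold before step `T`, and nonexpansiveness of the projection turns a short
estimated step into approximate stationarity
(`OutputFeedbackLQR.projected_gradient_conclusion`).
-/

/-! ### Exponential decay and Lyapunov integrals in a normed star algebra -/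

section Lyapunov

set_option linter.unusedSectionVars false

open NormedSpace Filter Topology Set

variable {𝔸 : Type*} [NormedRing 𝔸] [NormedAlgebra ℝ 𝔸] [CompleteSpace 𝔸]

theorem continuous_exp_smul (M : 𝔸) : Continuous fun t : ℝ => exp (t • M) := by
  let _ : NormedAlgebra ℚ 𝔸 := NormedAlgebra.restrictScalars ℚ ℝ 𝔸
  exact exp_continuous.comp (continuous_id.smul continuous_const)

theorem exp_add_smul' (M : 𝔸) (s t : ℝ) : exp ((s + t) • M) = exp (s • M) * exp (t • M) := by
  let _ : NormedAlgebra ℚ 𝔸 := NormedAlgebra.restrictScalars ℚ ℝ 𝔸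
  rw [add_smul, exp_add_of_commute]
  exact ((Commute.refl M).smul_left s).smul_right t

theorem exp_nat_mul_smul (M : 𝔸) (k : ℕ) (t : ℝ) : exp (((k : ℝ) * t) • M) = exp (t • M) ^ k := by
  let _ : NormedAlgebra ℚ 𝔸 := NormedAlgebra.restrictScalars ℚ ℝ 𝔸
  rw [mul_smul, Nat.cast_smul_eq_nsmul, exp_nsmul]

/-- The hypothesis `‖1‖ ≤ 1` replaces `NormOneClass`, so that operators on the zero space, where
`‖1‖ = 0`, are covered. -/
theorem norm_exp_le_exp_norm (h1 : ‖(1 : 𝔸)‖ ≤ 1) (M : 𝔸) : ‖exp M‖ ≤ Real.exp ‖M‖ := by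
  have hs := norm_expSeries_summable' (𝕂 := ℝ) M
  have hpow : ∀ k : ℕ, ‖M ^ k‖ ≤ ‖M‖ ^ k := by
    intro k
    rcases Nat.eq_zero_or_pos k with rfl | hk
    · simpa using h1
    · exact norm_pow_le' M hk
  have hr := NormedSpace.exp_series_hasSum_exp' (𝕂 := ℝ) (𝔸 := ℝ) ‖M‖
  rw [← Real.exp_eq_exp_ℝ] at hr
  rw [(NormedSpace.exp_series_hasSum_exp' (𝕂 := ℝ) M).tsum_eq.symm]
  refine (norm_tsum_le_tsum_norm hs).trans ?_
  rw [← hr.tsum_eq]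
  refine hs.tsum_le_tsum (fun k => ?_) hr.summable
  rw [norm_smul, smul_eq_mul]
  have : ‖((k.factorial : ℝ))⁻¹‖ = ((k.factorial : ℝ))⁻¹ := by simp
  rw [this]
  exact mul_le_mul_of_nonneg_left (hpow k) (by positivity)

theorem norm_exp_smul_le (h1 : ‖(1 : 𝔸)‖ ≤ 1) {M : 𝔸} {β : ℝ} (hM : ‖M‖ ≤ β) {t : ℝ}
    (ht : 0 ≤ t) : ‖exp (t • M)‖ ≤ Real.exp (t * β) := by
  refine (norm_exp_le_exp_norm h1 _).trans (Real.exp_le_exp.2 ?_)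
  rw [norm_smul, Real.norm_of_nonneg ht]
  gcongr

/-- The semigroup generated by `M` decays exponentially, with explicit constants. -/
def ExpDecay (c κ : ℝ) (M : 𝔸) : Prop :=
  ∀ t : ℝ, 0 ≤ t → ‖exp (t • M)‖ ≤ c * Real.exp (-κ * t)

theorem ExpDecay.nonneg {c κ : ℝ} {M : 𝔸} (h : ExpDecay c κ M) : 0 ≤ c := by
  have := h 0 le_rfl
  simp only [mul_zero, Real.exp_zero, mul_one] at this
  exact (norm_nonneg _).trans this

/-- A semigroup that contracts by the factor `3 / 4` at one positive time decays exponentially; the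
constants depend only on that time and a bound on the generator. -/
theorem exists_expDecay_of_norm_exp_le (h1 : ‖(1 : 𝔸)‖ ≤ 1) (β : ℝ) {t₀ : ℝ}
    (ht₀ : 0 < t₀) :
    ∃ c > (0 : ℝ), ∃ κ > (0 : ℝ), ∀ M : 𝔸, ‖M‖ ≤ β → ‖exp (t₀ • M)‖ ≤ 3 / 4 → ExpDecay c κ M := by
  have hlog : Real.log (3 / 4) < 0 := Real.log_neg (by norm_num) (by norm_num)
  refine ⟨Real.exp (t₀ * max β 0) * (4 / 3), by positivity, -Real.log (3 / 4) / t₀,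
    div_pos (by linarith) ht₀, fun M hM hq t ht => ?_⟩
  -- Write `t = k t₀ + rest`: the first part contracts `k` times, the rest costs a constant factor.
  set k := ⌊t / t₀⌋₊ with hk
  have hk1 : (k : ℝ) ≤ t / t₀ := Nat.floor_le (by positivity)
  have hk2 : t / t₀ < k + 1 := Nat.lt_floor_add_one _
  have hkt : (k : ℝ) * t₀ ≤ t := by rwa [le_div_iff₀ ht₀] at hk1
  have hkt2 : t - k * t₀ ≤ t₀ := by
    rw [div_lt_iff₀ ht₀] at hk2; linarith
  have hsplit : t = k * t₀ + (t - k * t₀) := by ring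
  have hpow : ‖exp (t₀ • M) ^ k‖ ≤ (3 / 4) ^ k := by
    rcases Nat.eq_zero_or_pos k with h0 | h0
    · rw [h0]; simpa using h1
    · exact (norm_pow_le' _ h0).trans (pow_le_pow_left₀ (norm_nonneg _) hq _)
  have hrest : ‖exp ((t - k * t₀) • M)‖ ≤ Real.exp (t₀ * max β 0) := by
    refine (norm_exp_smul_le h1 (hM.trans (le_max_left β 0)) (by linarith)).trans ?_
    gcongr
  have hq2 : ((3 : ℝ) / 4) ^ k ≤ 4 / 3 * Real.exp (-(-Real.log (3 / 4) / t₀) * t) := by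
    have e1 : ((3 : ℝ) / 4) ^ k = Real.exp (k * Real.log (3 / 4)) := by
      rw [mul_comm, Real.exp_mul, Real.exp_log (by norm_num), Real.rpow_natCast]
    have e2 : (4 : ℝ) / 3 = Real.exp (-Real.log (3 / 4)) := by
      rw [Real.exp_neg, Real.exp_log (by norm_num)]; norm_num
    rw [e1, e2, ← Real.exp_add]
    refine Real.exp_le_exp.2 ?_
    have : -(-Real.log (3 / 4) / t₀) * t = (t / t₀) * Real.log (3 / 4) := by ring
    rw [this]
    nlinarith
  calc ‖exp (t • M)‖ = ‖exp (t₀ • M) ^ k * exp ((t - k * t₀) • M)‖ := by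
        rw [← exp_nat_mul_smul, ← exp_add_smul', ← hsplit]
    _ ≤ ‖exp (t₀ • M) ^ k‖ * ‖exp ((t - k * t₀) • M)‖ := norm_mul_le _ _
    _ ≤ (4 / 3 * Real.exp (-(-Real.log (3 / 4) / t₀) * t)) * Real.exp (t₀ * max β 0) :=
        mul_le_mul (hpow.trans hq2) hrest (norm_nonneg _) (by positivity)
    _ = _ := by ring

theorem ExpDecay.tendsto {c κ : ℝ} (hκ : 0 < κ) {M : 𝔸} (h : ExpDecay c κ M) :
    Tendsto (fun t : ℝ => exp (t • M)) atTop (𝓝 0) := by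
  refine squeeze_zero_norm' (a := fun t => c * Real.exp (-κ * t)) ?_ ?_
  · filter_upwards [eventually_ge_atTop 0] with t ht using h t ht
  · have : Tendsto (fun t : ℝ => Real.exp (-κ * t)) atTop (𝓝 0) :=
      Real.tendsto_exp_atBot.comp (tendsto_id.const_mul_atTop_of_neg (by linarith))
    simpa using this.const_mul c

variable [StarRing 𝔸] [NormedStarGroup 𝔸] [StarModule ℝ 𝔸]

/-- The integrand `exp(tM)⋆ W exp(tM)` of the Lyapunov integral. -/
noncomputable def lyapIntegrand (M W : 𝔸) (t : ℝ) : 𝔸 := star (exp (t • M)) * W * exp (t • M)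

/-- The Lyapunov integral `∫₀^∞ exp(tM)⋆ W exp(tM) dt`, which for an exponentially decaying
semigroup is the solution `Y` of the Lyapunov equation `M⋆ Y + Y M = -W`. -/
noncomputable def lyap (M W : 𝔸) : 𝔸 := ∫ t in Ioi (0 : ℝ), lyapIntegrand M W t

theorem continuous_lyapIntegrand (M W : 𝔸) : Continuous (lyapIntegrand M W) :=
  ((continuous_exp_smul M).star.mul continuous_const).mul (continuous_exp_smul M)

theorem norm_lyapIntegrand_le {c κ : ℝ} {M : 𝔸} (h : ExpDecay c κ M) (W : 𝔸) {t : ℝ}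
    (ht : 0 ≤ t) : ‖lyapIntegrand M W t‖ ≤ c ^ 2 * ‖W‖ * Real.exp (-(2 * κ) * t) := by
  have hc := h t ht
  calc ‖lyapIntegrand M W t‖ ≤ ‖exp (t • M)‖ * ‖W‖ * ‖exp (t • M)‖ := by
        refine (norm_mul_le _ _).trans ?_
        gcongr
        refine (norm_mul_le _ _).trans ?_
        rw [norm_star]
    _ ≤ (c * Real.exp (-κ * t)) * ‖W‖ * (c * Real.exp (-κ * t)) := by
        have := h.nonneg
        gcongr
    _ = c ^ 2 * ‖W‖ * (Real.exp (-κ * t) * Real.exp (-κ * t)) := by ring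
    _ = _ := by rw [← Real.exp_add]; ring_nf

theorem integrableOn_lyapIntegrand {c κ : ℝ} (hκ : 0 < κ) {M : 𝔸} (h : ExpDecay c κ M) (W : 𝔸) :
    IntegrableOn (lyapIntegrand M W) (Ioi 0) := by
  have hi := (exp_neg_integrableOn_Ioi 0 (b := 2 * κ) (by linarith)).const_mul (c ^ 2 * ‖W‖)
  refine Integrable.mono' hi (continuous_lyapIntegrand M W).aestronglyMeasurable ?_
  filter_upwards [ae_restrict_mem measurableSet_Ioi] with t ht
  exact norm_lyapIntegrand_le h W (le_of_lt ht)

theorem norm_lyap_le {c κ : ℝ} (hκ : 0 < κ) {M : 𝔸} (h : ExpDecay c κ M) (W : 𝔸) :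
    ‖lyap M W‖ ≤ c ^ 2 / (2 * κ) * ‖W‖ := by
  have hi := (exp_neg_integrableOn_Ioi 0 (b := 2 * κ) (by linarith)).const_mul (c ^ 2 * ‖W‖)
  refine (norm_integral_le_of_norm_le hi ?_).trans ?_
  · filter_upwards [ae_restrict_mem measurableSet_Ioi] with t ht
    exact norm_lyapIntegrand_le h W (le_of_lt ht)
  · rw [integral_const_mul, integral_exp_mul_Ioi (by linarith)]
    refine le_of_eq ?_
    simp only [mul_zero, Real.exp_zero]
    field_simp

theorem lyap_add {c κ : ℝ} (hκ : 0 < κ) {M : 𝔸} (h : ExpDecay c κ M) (W W' : 𝔸) :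
    lyap M (W + W') = lyap M W + lyap M W' := by
  rw [lyap, lyap, lyap, ← integral_add (integrableOn_lyapIntegrand hκ h W)
    (integrableOn_lyapIntegrand hκ h W')]
  simp [lyapIntegrand, mul_add, add_mul]

theorem lyap_smul (M W : 𝔸) (r : ℝ) : lyap M (r • W) = r • lyap M W := by
  rw [lyap, lyap, ← integral_smul]
  simp [lyapIntegrand]

theorem lyap_neg (M W : 𝔸) : lyap M (-W) = -lyap M W := by
  rw [lyap, lyap, ← integral_neg]
  simp [lyapIntegrand]

theorem hasDerivAt_lyapIntegrand (M Y : 𝔸) (t : ℝ) :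
    HasDerivAt (lyapIntegrand M Y) (lyapIntegrand M (star M * Y + Y * M) t) t := by
  have h1 := hasDerivAt_exp_smul_const' (𝕂 := ℝ) M t
  have h2 := (starL' ℝ : 𝔸 ≃L[ℝ] 𝔸).hasFDerivAt.comp_hasDerivAt t h1
  have h3 := (h2.mul_const Y).mul h1
  have e : lyapIntegrand M (star M * Y + Y * M) t = star (M * exp (t • M)) * Y * exp (t • M)
      + star (exp (t • M)) * Y * (M * exp (t • M)) := by
    simp [lyapIntegrand, mul_add, add_mul, mul_assoc]
  rw [e]
  exact h3

/-- The Lyapunov integral inverts `Y ↦ -(M⋆ Y + Y M)`. -/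
theorem lyap_star_mul_add_mul {c κ : ℝ} (hκ : 0 < κ) {M : 𝔸} (h : ExpDecay c κ M) (Y : 𝔸) :
    lyap M (star M * Y + Y * M) = -Y := by
  have ht : Tendsto (lyapIntegrand M Y) atTop (𝓝 0) := by
    have h0 := h.tendsto hκ
    have := ((continuous_star.tendsto _).comp h0).mul_const Y |>.mul h0
    rw [mul_zero] at this
    exact this
  have := integral_Ioi_of_hasDerivAt_of_tendsto (a := 0)
    (continuous_lyapIntegrand M Y).continuousWithinAt
    (fun t _ => hasDerivAt_lyapIntegrand M Y t)
    (integrableOn_lyapIntegrand hκ h _) ht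
  rw [lyap, this]
  simp [lyapIntegrand]

/-- The Lyapunov integral solves the Lyapunov equation. -/
theorem star_mul_lyap_add_lyap_mul {c κ : ℝ} (hκ : 0 < κ) {M : 𝔸} (h : ExpDecay c κ M) (W : 𝔸) :
    star M * lyap M W + lyap M W * M = -W := by
  have hi := integrableOn_lyapIntegrand hκ h W
  rw [← lyap_star_mul_add_mul hκ h W, lyap, lyap]
  have e1 : star M * ∫ t in Ioi (0 : ℝ), lyapIntegrand M W t
      = ∫ t in Ioi (0 : ℝ), star M * lyapIntegrand M W t :=
    (integral_const_mul_of_integrable hi).symm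
  have e2 : (∫ t in Ioi (0 : ℝ), lyapIntegrand M W t) * M
      = ∫ t in Ioi (0 : ℝ), lyapIntegrand M W t * M :=
    (integral_mul_const_of_integrable hi).symm
  rw [e1, e2, ← integral_add (hi.const_mul _) (hi.mul_const _)]
  congr 1
  funext t
  have hc : Commute M (exp (t • M)) := (Commute.refl M).smul_right t |>.exp_right
  have hc' : star M * star (exp (t • M)) = star (exp (t • M)) * star M := by
    rw [← star_mul, ← star_mul, hc.eq]
  simp only [lyapIntegrand, mul_add, add_mul, ← mul_assoc, hc']
  simp only [mul_assoc, hc.eq]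

/-- Comparison of the Lyapunov integrals of two generators for the same weight. -/
theorem lyap_sub_lyap {c κ c' κ' : ℝ} (hκ : 0 < κ) (hκ' : 0 < κ') {M M' : 𝔸}
    (h : ExpDecay c κ M) (h' : ExpDecay c' κ' M') (W : 𝔸) :
    lyap M' W - lyap M W
      = lyap M' (star (M' - M) * lyap M W + lyap M W * (M' - M)) := by
  have h1 := star_mul_lyap_add_lyap_mul hκ h W
  -- Apply the inversion formula of `M'` to `lyap M W`, whose Lyapunov equation involves `M`.
  have h2 := lyap_star_mul_add_mul hκ' h' (lyap M W)
  have e : star M' * lyap M W + lyap M W * M'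
      = (star (M' - M) * lyap M W + lyap M W * (M' - M)) + -W := by
    rw [← h1, star_sub]; noncomm_ring
  rw [e, lyap_add hκ' h', lyap_neg] at h2
  rw [sub_eq_add_neg, ← h2]
  abel

end Lyapunov

/-! ### Positive functionals of operators and Lyapunov integrals -/

section PositiveFunctional

open NormedSpace Filter Topology Set
open ContinuousLinearMap (adjoint)

set_option linter.unusedSectionVars false

variable {E F : Type*} [NormedAddCommGroup E] [InnerProductSpace ℝ E] [CompleteSpace E]
  [NormedAddCommGroup F] [InnerProductSpace ℝ F] [CompleteSpace F]

/-- A functional on operators that is nonnegative on positive quadratic forms and at least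
`σ ‖v‖²` on the form `x ↦ ⟪v, x⟫²`; the model is `W ↦ E ⟪x, W x⟫` for a random vector `x` with
second moment matrix at least `σ`. -/
structure IsCoerciveFunctional (σ : ℝ) (φ : (E →L[ℝ] E) →L[ℝ] ℝ) : Prop where
  nonneg : ∀ W : E →L[ℝ] E, (∀ x, 0 ≤ inner ℝ x (W x)) → 0 ≤ φ W
  rankOne_le : ∀ v : E, σ * ‖v‖ ^ 2 ≤ φ ((innerSL ℝ v).smulRight v)

variable {σ : ℝ} {φ : (E →L[ℝ] E) →L[ℝ] ℝ}

theorem IsCoerciveFunctional.mono (hφ : IsCoerciveFunctional σ φ) {W W' : E →L[ℝ] E}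
    (h : ∀ x, inner ℝ x (W x) ≤ inner ℝ x (W' x)) : φ W ≤ φ W' := by
  have := hφ.nonneg (W' - W) fun x => by
    rw [sub_apply, inner_sub_right]; linarith [h x]
  rw [map_sub] at this
  linarith

/-- Coercivity on rank one forms passes to the operator norm, because `T⋆ T` dominates the rank one
form of `T⋆ u` for every unit vector `u`. -/
theorem IsCoerciveFunctional.mul_norm_sq_le (hφ : IsCoerciveFunctional σ φ) (hσ : 0 < σ)
    (T : E →L[ℝ] F) : σ * ‖T‖ ^ 2 ≤ φ (adjoint T ∘L T) := by
  have h0 : 0 ≤ φ (adjoint T ∘L T) := hφ.nonneg _ fun x => by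
    rw [ContinuousLinearMap.comp_apply, ContinuousLinearMap.adjoint_inner_right]
    exact real_inner_self_nonneg
  have hb : ‖adjoint T‖ ≤ Real.sqrt (φ (adjoint T ∘L T) / σ) := by
    refine ContinuousLinearMap.opNorm_le_bound _ (Real.sqrt_nonneg _) fun u => ?_
    have h1 := hφ.rankOne_le (adjoint T u)
    have h2 : φ ((innerSL ℝ (adjoint T u)).smulRight (adjoint T u))
        ≤ φ (‖u‖ ^ 2 • (adjoint T ∘L T)) := by
      refine hφ.mono fun x => ?_
      rw [ContinuousLinearMap.smulRight_apply, innerSL_apply_apply, real_inner_smul_right,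
        smul_apply, ContinuousLinearMap.comp_apply, real_inner_smul_right,
        ContinuousLinearMap.adjoint_inner_right, ContinuousLinearMap.adjoint_inner_right,
        ContinuousLinearMap.adjoint_inner_left, real_inner_self_eq_norm_sq, real_inner_comm u (T x)]
      have := abs_real_inner_le_norm u (T x)
      rw [← mul_pow, ← sq]
      exact sq_le_sq' (by linarith [(abs_le.1 this).1]) (abs_le.1 this).2
    rw [map_smul, smul_eq_mul] at h2
    rw [← Real.sqrt_sq (norm_nonneg u), ← Real.sqrt_mul (by positivity)]
    refine Real.le_sqrt_of_sq_le ?_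
    rw [div_mul_eq_mul_div, le_div_iff₀ hσ]
    linarith
  rw [LinearIsometryEquiv.norm_map] at hb
  have : ‖T‖ ^ 2 ≤ φ (adjoint T ∘L T) / σ := by
    calc ‖T‖ ^ 2 ≤ Real.sqrt (φ (adjoint T ∘L T) / σ) ^ 2 := by gcongr
      _ = _ := Real.sq_sqrt (by positivity)
  rw [le_div_iff₀ hσ] at this
  linarith

theorem clm_norm_one_le : ‖(1 : E →L[ℝ] E)‖ ≤ 1 := ContinuousLinearMap.norm_id_le

theorem inner_lyapIntegrand (M W : E →L[ℝ] E) (x : E) (t : ℝ) :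
    inner ℝ x (lyapIntegrand M W t x) = inner ℝ (exp (t • M) x) (W (exp (t • M) x)) := by
  simp only [lyapIntegrand, ContinuousLinearMap.star_eq_adjoint, mul_apply_eq_comp,
    ContinuousLinearMap.adjoint_inner_right]

theorem lyapIntegrand_adjoint_comp_self (M : E →L[ℝ] E) (T : E →L[ℝ] F) (t : ℝ) :
    lyapIntegrand M (adjoint T ∘L T) t = adjoint (T ∘L exp (t • M)) ∘L (T ∘L exp (t • M)) := by
  rw [lyapIntegrand, ContinuousLinearMap.star_eq_adjoint, ContinuousLinearMap.adjoint_comp]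
  rfl

/-- Continuous linear functionals pass under the Lyapunov integral. -/
theorem clm_lyap {c κ : ℝ} (hκ : 0 < κ) {M : E →L[ℝ] E} (h : ExpDecay c κ M) (W : E →L[ℝ] E)
    (ψ : (E →L[ℝ] E) →L[ℝ] ℝ) :
    IntegrableOn (fun t => ψ (lyapIntegrand M W t)) (Ioi 0) ∧
      ψ (lyap M W) = ∫ t in Ioi (0 : ℝ), ψ (lyapIntegrand M W t) :=
  ⟨ψ.integrable_comp (integrableOn_lyapIntegrand hκ h W),
    (ψ.integral_comp_comm (integrableOn_lyapIntegrand hκ h W)).symm⟩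

/-- The quadratic form of the Lyapunov integral is the total cost along the trajectory. -/
theorem inner_lyap {c κ : ℝ} (hκ : 0 < κ) {M : E →L[ℝ] E} (h : ExpDecay c κ M) (W : E →L[ℝ] E)
    (x : E) :
    IntegrableOn (fun t : ℝ => inner ℝ (exp (t • M) x) (W (exp (t • M) x))) (Ioi 0) ∧
      inner ℝ x (lyap M W x)
        = ∫ t in Ioi (0 : ℝ), inner ℝ (exp (t • M) x) (W (exp (t • M) x)) := by
  have := clm_lyap hκ h W ((innerSL ℝ x).comp (ContinuousLinearMap.apply ℝ E x))
  simp only [ContinuousLinearMap.comp_apply, ContinuousLinearMap.apply_apply, innerSL_apply_apply,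
    inner_lyapIntegrand] at this
  exact this

theorem IsCoerciveFunctional.lyap_mono (hφ : IsCoerciveFunctional σ φ) {c κ : ℝ} (hκ : 0 < κ)
    {M : E →L[ℝ] E} (h : ExpDecay c κ M) {W W' : E →L[ℝ] E}
    (hW : ∀ x, inner ℝ x (W x) ≤ inner ℝ x (W' x)) : φ (lyap M W) ≤ φ (lyap M W') := by
  refine hφ.mono fun x => ?_
  rw [(inner_lyap hκ h W x).2, (inner_lyap hκ h W' x).2]
  exact integral_mono (inner_lyap hκ h W x).1 (inner_lyap hκ h W' x).1 fun t => hW _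

/-- The functional of a Lyapunov integral controls the mean square of the operator norm along the
semigroup. -/
theorem IsCoerciveFunctional.integral_norm_sq_le (hφ : IsCoerciveFunctional σ φ) (hσ : 0 < σ)
    {c κ : ℝ} (hκ : 0 < κ) {M : E →L[ℝ] E} (h : ExpDecay c κ M) (T : E →L[ℝ] F) {s : ℝ}
    (hs : 0 ≤ s) :
    σ * ∫ t in (0 : ℝ)..s, ‖T ∘L exp (t • M)‖ ^ 2 ≤ φ (lyap M (adjoint T ∘L T)) := by
  obtain ⟨hi, he⟩ := clm_lyap hκ h (adjoint T ∘L T) φ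
  have hle : ∀ t : ℝ, σ * ‖T ∘L exp (t • M)‖ ^ 2 ≤ φ (lyapIntegrand M (adjoint T ∘L T) t) := by
    intro t
    rw [lyapIntegrand_adjoint_comp_self]
    exact hφ.mul_norm_sq_le hσ _
  have hcont : Continuous fun t : ℝ => σ * ‖T ∘L exp (t • M)‖ ^ 2 :=
    continuous_const.mul ((continuous_const.clm_comp (continuous_exp_smul M)).norm.pow 2)
  rw [he, ← intervalIntegral.integral_const_mul, intervalIntegral.integral_of_le hs]
  calc ∫ t in Ioc 0 s, σ * ‖T ∘L exp (t • M)‖ ^ 2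
      ≤ ∫ t in Ioc 0 s, φ (lyapIntegrand M (adjoint T ∘L T) t) :=
        setIntegral_mono (hcont.integrableOn_Ioc) (hi.mono_set Ioc_subset_Ioi_self) hle
    _ ≤ _ := by
        refine setIntegral_mono_set hi ?_ (Ioc_subset_Ioi_self.eventuallyLE)
        exact Eventually.of_forall fun t => (by positivity : (0 : ℝ) ≤ _).trans (hle t)

/-- The semigroup moves an operator by at most a constant factor during the time `1 / (1 + ‖M‖)`. -/
theorem norm_sq_le_integral (M : E →L[ℝ] E) (T : E →L[ℝ] F) {ν : ℝ}
    (h : ∀ s : ℝ, 0 ≤ s → ∫ t in (0 : ℝ)..s, ‖T ∘L exp (t • M)‖ ^ 2 ≤ ν) :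
    ‖T‖ ^ 2 ≤ Real.exp 2 * ν * (1 + ‖M‖) := by
  set s := 1 / (1 + ‖M‖) with hs
  have hs0 : 0 < s := by positivity
  have hpt : ∀ t ∈ Icc (0 : ℝ) s, ‖T‖ ^ 2 * Real.exp (-2) ≤ ‖T ∘L exp (t • M)‖ ^ 2 := by
    intro t ht
    have e1 : T = (T ∘L exp (t • M)) ∘L exp (t • (-M)) := by
      have : exp (t • M) * exp (t • (-M)) = 1 := by
        have := exp_add_smul' M t (-t)
        rw [add_neg_cancel, zero_smul, exp_zero] at this
        rw [smul_neg, ← neg_smul, ← this]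
      rw [ContinuousLinearMap.comp_assoc]
      change T = T ∘L (exp (t • M) * exp (t • (-M)))
      rw [this]; rfl
    have e2 : ‖exp (t • (-M))‖ ≤ Real.exp 1 := by
      refine (norm_exp_smul_le clm_norm_one_le (norm_neg M).le ht.1).trans ?_
      refine Real.exp_le_exp.2 ?_
      calc t * ‖M‖ ≤ s * ‖M‖ := by gcongr; exact ht.2
        _ ≤ 1 := by rw [hs, div_mul_eq_mul_div, div_le_one (by positivity)]; linarith
    have e3 : ‖T‖ ≤ ‖T ∘L exp (t • M)‖ * Real.exp 1 := by
      conv_lhs => rw [e1]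
      exact (ContinuousLinearMap.opNorm_comp_le _ _).trans (by gcongr)
    have e4 : ‖T‖ ^ 2 ≤ ‖T ∘L exp (t • M)‖ ^ 2 * Real.exp 2 := by
      calc ‖T‖ ^ 2 ≤ (‖T ∘L exp (t • M)‖ * Real.exp 1) ^ 2 := by gcongr
        _ = _ := by rw [mul_pow, ← Real.exp_nat_mul]; norm_num
    rw [Real.exp_neg, ← div_eq_mul_inv, div_le_iff₀ (Real.exp_pos _)]
    exact e4
  have hcont : Continuous fun t : ℝ => ‖T ∘L exp (t • M)‖ ^ 2 :=
    ((continuous_const.clm_comp (continuous_exp_smul M)).norm.pow 2)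
  have := intervalIntegral.integral_mono_on (μ := volume) hs0.le
    ((continuous_const (y := ‖T‖ ^ 2 * Real.exp (-2))).intervalIntegrable 0 s)
    (hcont.intervalIntegrable 0 s) hpt
  rw [intervalIntegral.integral_const, sub_zero, smul_eq_mul] at this
  have h2 := this.trans (h s hs0.le)
  rw [hs, Real.exp_neg] at h2
  have h3 : 1 / (1 + ‖M‖) * (‖T‖ ^ 2 * (Real.exp 2)⁻¹) = ‖T‖ ^ 2 / (Real.exp 2 * (1 + ‖M‖)) := by
    field_simp
  rw [h3, div_le_iff₀ (by positivity)] at h2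
  linarith

/-- A bound on the mean square of the semigroup gives a time, depending only on the bound, at which
the semigroup is a contraction. -/
theorem exists_norm_exp_le_half (β ν : ℝ) :
    ∃ t₀ > (0 : ℝ), ∀ M : E →L[ℝ] E, ‖M‖ ≤ β →
      (∀ s : ℝ, 0 ≤ s → ∫ t in (0 : ℝ)..s, ‖exp (t • M)‖ ^ 2 ≤ ν) → ‖exp (t₀ • M)‖ ≤ 1 / 2 := by
  set C : ℝ := Real.exp (2 * max β 0) * (1 + max ν 0) with hC
  have hC0 : 0 < C := by positivity
  have hν0 : 0 ≤ max ν 0 := le_max_right _ _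
  refine ⟨4 * C * (1 + max ν 0), by positivity, fun M hM h => ?_⟩
  have hcont : Continuous fun t : ℝ => ‖exp (t • M)‖ ^ 2 := (continuous_exp_smul M).norm.pow 2
  have hM' : ‖M‖ ≤ max β 0 := hM.trans (le_max_left _ _)
  have hshort : ∀ r : ℝ, 0 ≤ r → r ≤ 1 → ‖exp (r • M)‖ ^ 2 ≤ Real.exp (2 * max β 0) := by
    intro r h0 h1
    calc ‖exp (r • M)‖ ^ 2 ≤ Real.exp (r * max β 0) ^ 2 := by
          gcongr; exact norm_exp_smul_le clm_norm_one_le hM' h0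
      _ = Real.exp (2 * (r * max β 0)) := by rw [← Real.exp_nat_mul]; norm_num
      _ ≤ _ := by
          refine Real.exp_le_exp.2 ?_
          have : r * max β 0 ≤ 1 * max β 0 := by gcongr
          linarith
  -- The semigroup is bounded: compare with its mean over the preceding unit of time.
  have hbdd : ∀ t : ℝ, 0 ≤ t → ‖exp (t • M)‖ ^ 2 ≤ C := by
    intro t ht
    rcases le_total t 1 with h1 | h1
    · refine (hshort t ht h1).trans ?_
      rw [hC]
      nlinarith [Real.exp_pos (2 * max β 0)]
    · have hpt : ∀ s ∈ Icc (t - 1) t,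
          ‖exp (t • M)‖ ^ 2 ≤ Real.exp (2 * max β 0) * ‖exp (s • M)‖ ^ 2 := by
        intro s hs
        have e : exp (t • M) = exp ((t - s) • M) * exp (s • M) := by
          have := exp_add_smul' M (t - s) s
          rwa [sub_add_cancel] at this
        rw [e]
        calc ‖exp ((t - s) • M) * exp (s • M)‖ ^ 2
            ≤ (‖exp ((t - s) • M)‖ * ‖exp (s • M)‖) ^ 2 := by gcongr; exact norm_mul_le _ _
          _ = ‖exp ((t - s) • M)‖ ^ 2 * ‖exp (s • M)‖ ^ 2 := by ring
          _ ≤ _ := by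
            gcongr
            exact hshort _ (by linarith [hs.2]) (by linarith [hs.1])
      have h2 := intervalIntegral.integral_mono_on (μ := volume) (by linarith : t - 1 ≤ t)
        ((continuous_const (y := ‖exp (t • M)‖ ^ 2)).intervalIntegrable _ _)
        ((hcont.const_mul _).intervalIntegrable _ _) hpt
      rw [intervalIntegral.integral_const, intervalIntegral.integral_const_mul] at h2
      have h3 : ∫ s in (t - 1)..t, ‖exp (s • M)‖ ^ 2 ≤ ν := by
        refine le_trans ?_ (h t ht)
        rw [← intervalIntegral.integral_add_adjacent_intervals
          (hcont.intervalIntegrable 0 (t - 1)) (hcont.intervalIntegrable (t - 1) t)]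
        have : 0 ≤ ∫ s in (0 : ℝ)..(t - 1), ‖exp (s • M)‖ ^ 2 :=
          intervalIntegral.integral_nonneg (by linarith) fun _ _ => by positivity
        linarith
      have h4 : ν ≤ max ν 0 := le_max_left _ _
      simp only [sub_sub_cancel, one_smul] at h2
      rw [hC]
      nlinarith [Real.exp_pos (2 * max β 0)]
  -- By boundedness `‖exp (t M)‖² ≤ C ‖exp (s M)‖²` for `s ≤ t`; the mean over `[0, t]` is at most `ν/t`.
  set t := 4 * C * (1 + max ν 0) with ht
  have ht0 : 0 < t := by positivity
  have hpt : ∀ s ∈ Icc (0 : ℝ) t, ‖exp (t • M)‖ ^ 2 ≤ C * ‖exp (s • M)‖ ^ 2 := by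
    intro s hs
    have e : exp (t • M) = exp ((t - s) • M) * exp (s • M) := by
      have := exp_add_smul' M (t - s) s
      rwa [sub_add_cancel] at this
    calc ‖exp (t • M)‖ ^ 2 = ‖exp ((t - s) • M) * exp (s • M)‖ ^ 2 := by rw [← e]
      _ ≤ (‖exp ((t - s) • M)‖ * ‖exp (s • M)‖) ^ 2 := by gcongr; exact norm_mul_le _ _
      _ = ‖exp ((t - s) • M)‖ ^ 2 * ‖exp (s • M)‖ ^ 2 := by ring
      _ ≤ _ := by
        gcongr
        exact hbdd _ (by linarith [hs.2])
  have h2 := intervalIntegral.integral_mono_on (μ := volume) ht0.le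
    ((continuous_const (y := ‖exp (t • M)‖ ^ 2)).intervalIntegrable _ _)
    ((hcont.const_mul _).intervalIntegrable _ _) hpt
  rw [intervalIntegral.integral_const, intervalIntegral.integral_const_mul, sub_zero,
    smul_eq_mul] at h2
  have h3 : t * ‖exp (t • M)‖ ^ 2 ≤ C * (1 + max ν 0) := by
    refine h2.trans ?_
    gcongr
    exact (h t ht0.le).trans (by linarith [le_max_left ν 0])
  have h4 : ‖exp (t • M)‖ ^ 2 ≤ (1 / 2) ^ 2 := by
    have : t * ‖exp (t • M)‖ ^ 2 ≤ t * (1 / 2) ^ 2 := by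
      refine h3.trans (le_of_eq ?_)
      rw [ht]; ring
    exact le_of_mul_le_mul_left this ht0
  exact (pow_le_pow_iff_left₀ (norm_nonneg _) (by norm_num) two_ne_zero).1 h4

end PositiveFunctional

/-! ### The value of a linear feedback -/

section LinearFeedback

open NormedSpace Filter Topology Set
open ContinuousLinearMap (adjoint)

set_option linter.unusedSectionVars false

variable {E F : Type*} [NormedAddCommGroup E] [InnerProductSpace ℝ E] [CompleteSpace E]
  [NormedAddCommGroup F] [InnerProductSpace ℝ F] [CompleteSpace F]

/-- The generator `A - B G` of the system `x' = A x + B u` under the feedback `u = -G x`. -/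
noncomputable def loopOp (A : E →L[ℝ] E) (B : F →L[ℝ] E) (G : E →L[ℝ] F) : E →L[ℝ] E := A - B ∘L G

/-- The weight `S + G⋆ R G` of the stage cost `⟪x, S x⟫ + ⟪u, R u⟫` under the feedback `u = -G x`. -/
noncomputable def stageWeight (S : E →L[ℝ] E) (R : F →L[ℝ] F) (G : E →L[ℝ] F) : E →L[ℝ] E :=
  S + adjoint G ∘L R ∘L G

theorem inner_stageWeight (S : E →L[ℝ] E) (R : F →L[ℝ] F) (G : E →L[ℝ] F) (x : E) :
    inner ℝ x (stageWeight S R G x) = inner ℝ x (S x) + inner ℝ (G x) (R (G x)) := by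
  simp [stageWeight, inner_add_right, ContinuousLinearMap.adjoint_inner_right]

/-- The cost of the feedback `u = -G x`, averaged by the functional `φ` over the initial state. -/
noncomputable def lqrValue (φ : (E →L[ℝ] E) →L[ℝ] ℝ) (A : E →L[ℝ] E) (B : F →L[ℝ] E)
    (S : E →L[ℝ] E) (R : F →L[ℝ] F) (G : E →L[ℝ] F) : ℝ :=
  φ (lyap (loopOp A B G) (stageWeight S R G))

theorem norm_loopOp_le (A : E →L[ℝ] E) (B : F →L[ℝ] E) (G : E →L[ℝ] F) :
    ‖loopOp A B G‖ ≤ ‖A‖ + ‖B‖ * ‖G‖ :=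
  (norm_sub_le _ _).trans (by gcongr; exact ContinuousLinearMap.opNorm_comp_le _ _)

theorem loopOp_sub_loopOp (A : E →L[ℝ] E) (B : F →L[ℝ] E) (G G' : E →L[ℝ] F) :
    loopOp A B G - loopOp A B G' = B ∘L (G' - G) := by
  simp [loopOp, ContinuousLinearMap.comp_sub]

variable {σ : ℝ} {φ : (E →L[ℝ] E) →L[ℝ] ℝ}

/-- A bound on the value bounds the mean square of the state. The state is detected through the
stage cost by the Lyapunov function of a fixed stabilizing feedback `Gs` whose input is controlled
by the output weight. -/
theorem lyap_one_le (hφ : IsCoerciveFunctional σ φ) {A : E →L[ℝ] E} {B : F →L[ℝ] E}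
    {S : E →L[ℝ] E} {R : F →L[ℝ] F} (hS : ∀ x, 0 ≤ inner ℝ x (S x)) {ρ : ℝ} (hρ : 0 < ρ)
    (hR : ∀ u, ρ * ‖u‖ ^ 2 ≤ inner ℝ u (R u)) {Gs : E →L[ℝ] F} {cs κs : ℝ} (hκs : 0 < κs)
    (hs : ExpDecay cs κs (loopOp A B Gs)) {γ : ℝ} (hγ : 0 ≤ γ)
    (hGs : ∀ x, ‖Gs x‖ ^ 2 ≤ γ * inner ℝ x (S x)) {G : E →L[ℝ] F} {c κ : ℝ} (hκ : 0 < κ)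
    (h : ExpDecay c κ (loopOp A B G)) :
    φ (lyap (loopOp A B G) 1) ≤ 2 * φ (lyap (loopOp A B Gs) 1) +
      4 * (‖lyap (loopOp A B Gs) 1‖ * ‖B‖) ^ 2 * (2 * γ + 2 / ρ) * lqrValue φ A B S R G := by
  set Y := lyap (loopOp A B Gs) 1 with hY
  set M := loopOp A B G with hM
  set Δ := M - loopOp A B Gs with hΔ
  set k : ℝ := 2 * (‖Y‖ * ‖B‖) ^ 2 * (2 * γ + 2 / ρ) with hk
  have h1 : lyap M 1 - Y = lyap M (star Δ * Y + Y * Δ) := lyap_sub_lyap hκs hκ hs h 1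
  -- By Young's inequality half of the identity absorbs the state, and the stage weight absorbs the
  -- difference of the inputs. The half of the identity is then moved to the left-hand side.
  have h2 : φ (lyap M (star Δ * Y + Y * Δ))
      ≤ φ (lyap M ((1 / 2 : ℝ) • (1 : E →L[ℝ] E) + k • stageWeight S R G)) := by
    refine hφ.lyap_mono hκ h fun x => ?_
    have hΔx : ‖Δ x‖ ≤ ‖B‖ * ‖(Gs - G) x‖ := by
      rw [hΔ, hM, loopOp_sub_loopOp, ContinuousLinearMap.comp_apply]
      exact ContinuousLinearMap.le_opNorm _ _
    have e1 : inner ℝ x ((star Δ * Y + Y * Δ) x) = inner ℝ (Δ x) (Y x) + inner ℝ x (Y (Δ x)) := by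
      rw [add_apply, inner_add_right, mul_apply_eq_comp, mul_apply_eq_comp,
        ContinuousLinearMap.star_eq_adjoint, ContinuousLinearMap.adjoint_inner_right]
    have e2 : inner ℝ (Δ x) (Y x) ≤ ‖Δ x‖ * (‖Y‖ * ‖x‖) :=
      (real_inner_le_norm _ _).trans (by gcongr; exact Y.le_opNorm x)
    have e3 : inner ℝ x (Y (Δ x)) ≤ ‖x‖ * (‖Y‖ * ‖Δ x‖) :=
      (real_inner_le_norm _ _).trans (by gcongr; exact Y.le_opNorm _)
    have e4 : ‖Δ x‖ * (‖Y‖ * ‖x‖) ≤ (‖Y‖ * ‖B‖) * ‖(Gs - G) x‖ * ‖x‖ := by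
      calc ‖Δ x‖ * (‖Y‖ * ‖x‖) ≤ (‖B‖ * ‖(Gs - G) x‖) * (‖Y‖ * ‖x‖) := by gcongr
        _ = _ := by ring
    have e5 : ‖(Gs - G) x‖ ^ 2 ≤ (2 * γ + 2 / ρ) * inner ℝ x (stageWeight S R G x) := by
      have f1 : ‖(Gs - G) x‖ ^ 2 ≤ 2 * ‖Gs x‖ ^ 2 + 2 * ‖G x‖ ^ 2 := by
        have : ‖(Gs - G) x‖ ≤ ‖Gs x‖ + ‖G x‖ := by
          rw [sub_apply]; exact norm_sub_le _ _
        nlinarith [sq_nonneg (‖Gs x‖ - ‖G x‖), norm_nonneg ((Gs - G) x)]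
      have f2 : ‖G x‖ ^ 2 ≤ 1 / ρ * inner ℝ (G x) (R (G x)) := by
        rw [div_mul_eq_mul_div, one_mul, le_div_iff₀ hρ]
        linarith [hR (G x)]
      have f3 : 0 ≤ inner ℝ (G x) (R (G x)) := le_trans (by positivity) (hR (G x))
      rw [inner_stageWeight]
      have f4 := mul_nonneg hγ f3
      have f5 : 0 ≤ 1 / ρ * inner ℝ x (S x) := mul_nonneg (by positivity) (hS x)
      have f6 : (2 * γ + 2 / ρ) * (inner ℝ x (S x) + inner ℝ (G x) (R (G x)))
          = 2 * (γ * inner ℝ x (S x)) + 2 * (1 / ρ * inner ℝ (G x) (R (G x)))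
            + 2 * (γ * inner ℝ (G x) (R (G x))) + 2 * (1 / ρ * inner ℝ x (S x)) := by ring
      rw [f6]
      linarith [hGs x]
    have e6 : inner ℝ x (((1 / 2 : ℝ) • (1 : E →L[ℝ] E) + k • stageWeight S R G) x)
        = 1 / 2 * ‖x‖ ^ 2 + k * inner ℝ x (stageWeight S R G x) := by
      rw [add_apply, smul_apply, smul_apply, inner_add_right, real_inner_smul_right,
        real_inner_smul_right, one_apply_eq_self, real_inner_self_eq_norm_sq]
    have e7 : 2 * (‖Y‖ * ‖B‖) ^ 2 * ‖(Gs - G) x‖ ^ 2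
        ≤ k * inner ℝ x (stageWeight S R G x) := by
      refine (mul_le_mul_of_nonneg_left e5 (by positivity)).trans (le_of_eq ?_)
      rw [hk]; ring
    rw [e1, e6]
    -- Young's inequality `2 y ‖x‖ ≤ ‖x‖² / 2 + 2 y²` with `y = ‖Y‖ ‖B‖ ‖(Gs - G) x‖`
    nlinarith [sq_nonneg (‖x‖ - 2 * ((‖Y‖ * ‖B‖) * ‖(Gs - G) x‖))]
  rw [← h1, lyap_add hκ h, lyap_smul, lyap_smul, map_add, map_smul, map_smul, map_sub, smul_eq_mul,
    smul_eq_mul] at h2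
  change _ ≤ _ + _ * φ (lyap M (stageWeight S R G))
  have : 4 * (‖Y‖ * ‖B‖) ^ 2 * (2 * γ + 2 / ρ) = 2 * k := by rw [hk]; ring
  rw [this]
  linarith

/-- On a sublevel set of the value, the feedback is bounded and the closed loop is a contraction at
a common time. -/
theorem exists_bounds_of_lqrValue_le (hφ : IsCoerciveFunctional σ φ) (hσ : 0 < σ)
    {A : E →L[ℝ] E} {B : F →L[ℝ] E}
    {S : E →L[ℝ] E} {R : F →L[ℝ] F} (hS : ∀ x, 0 ≤ inner ℝ x (S x)) {ρ : ℝ} (hρ : 0 < ρ)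
    (hR : ∀ u, ρ * ‖u‖ ^ 2 ≤ inner ℝ u (R u)) {Gs : E →L[ℝ] F} {cs κs : ℝ} (hκs : 0 < κs)
    (hs : ExpDecay cs κs (loopOp A B Gs)) {γ : ℝ} (hγ : 0 ≤ γ)
    (hGs : ∀ x, ‖Gs x‖ ^ 2 ≤ γ * inner ℝ x (S x)) (a : ℝ) :
    ∃ β : ℝ, ∃ t₀ > (0 : ℝ), ∀ G : E →L[ℝ] F,
      (∃ c, ∃ κ > (0 : ℝ), ExpDecay c κ (loopOp A B G)) → lqrValue φ A B S R G ≤ a →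
      ‖G‖ ≤ β ∧ ‖exp (t₀ • loopOp A B G)‖ ≤ 1 / 2 := by
  set Y := lyap (loopOp A B Gs) 1 with hY
  set b : ℝ := Real.exp 2 * (max a 0 / (σ * ρ)) with hb
  have hb0 : 0 ≤ b := by positivity
  set β : ℝ := b * (1 + ‖A‖) + b * ‖B‖ + 1 with hβ
  set ν : ℝ := (2 * φ Y + 4 * (‖Y‖ * ‖B‖) ^ 2 * (2 * γ + 2 / ρ) * a) / σ with hν
  obtain ⟨t₀, ht₀, hcontr⟩ := exists_norm_exp_le_half (E := E) (‖A‖ + ‖B‖ * β) ν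
  refine ⟨β, t₀, ht₀, fun G ⟨c, κ, hκ, h⟩ ha => ?_⟩
  set M := loopOp A B G with hM
  have hGle : ∀ x, inner ℝ x ((adjoint G ∘L G) x)
      ≤ inner ℝ x (((1 / ρ) • stageWeight S R G) x) := by
    intro x
    rw [ContinuousLinearMap.comp_apply, ContinuousLinearMap.adjoint_inner_right,
      real_inner_self_eq_norm_sq, smul_apply, real_inner_smul_right, inner_stageWeight,
      div_mul_eq_mul_div, one_mul, le_div_iff₀ hρ]
    linarith [hR (G x), hS x]
  have h1 : ∀ s : ℝ, 0 ≤ s → ∫ t in (0 : ℝ)..s, ‖G ∘L exp (t • M)‖ ^ 2 ≤ max a 0 / (σ * ρ) := by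
    intro s hs
    have e1 := hφ.integral_norm_sq_le hσ hκ h G hs
    have e2 := hφ.lyap_mono hκ h hGle
    rw [lyap_smul, map_smul, smul_eq_mul] at e2
    have e3 : φ (lyap M (stageWeight S R G)) ≤ max a 0 := ha.trans (le_max_left _ _)
    rw [le_div_iff₀ (by positivity)]
    have e4 : 1 / ρ * φ (lyap M (stageWeight S R G)) ≤ 1 / ρ * max a 0 := by gcongr
    have e5 := (e1.trans e2).trans e4
    rw [div_mul_eq_mul_div, one_mul, le_div_iff₀ hρ] at e5
    linarith
  have h2 : ‖G‖ ≤ β := by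
    have e1 := norm_sq_le_integral M G h1
    have e2 : ‖M‖ ≤ ‖A‖ + ‖B‖ * ‖G‖ := norm_loopOp_le A B G
    have e3 : ‖G‖ ^ 2 ≤ b * (1 + ‖A‖) + (b * ‖B‖) * ‖G‖ := by
      refine e1.trans ?_
      calc b * (1 + ‖M‖) ≤ b * (1 + (‖A‖ + ‖B‖ * ‖G‖)) := by gcongr
        _ = _ := by ring
    -- `‖G‖²` is bounded by an affine function of `‖G‖`, which fails once `‖G‖ > β ≥ 1`.
    by_contra hcon
    push Not at hcon
    have p1 : 0 ≤ b * (1 + ‖A‖) := by positivity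
    have p2 : 0 ≤ b * ‖B‖ := by positivity
    have p3 : 1 ≤ ‖G‖ := by linarith
    nlinarith
  refine ⟨h2, hcontr M ((norm_loopOp_le A B G).trans (by gcongr)) fun s hs0 => ?_⟩
  have e1 := hφ.integral_norm_sq_le hσ hκ h (1 : E →L[ℝ] E) hs0
  have e2 : adjoint (1 : E →L[ℝ] E) ∘L (1 : E →L[ℝ] E) = 1 := by
    rw [← ContinuousLinearMap.star_eq_adjoint, star_one]; rfl
  have e3 : ∀ t : ℝ, (1 : E →L[ℝ] E) ∘L exp (t • M) = exp (t • M) := fun t => rfl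
  simp only [e2, e3] at e1
  have e4 := lyap_one_le hφ hS hρ hR hκs hs hγ hGs hκ h
  rw [hν, le_div_iff₀ hσ]
  have e5 : 4 * (‖Y‖ * ‖B‖) ^ 2 * (2 * γ + 2 / ρ) * lqrValue φ A B S R G
      ≤ 4 * (‖Y‖ * ‖B‖) ^ 2 * (2 * γ + 2 / ρ) * a := by gcongr
  linarith

/-- Contraction at a fixed time persists, with uniform decay, under small perturbations of a bounded
generator. -/
theorem exists_expDecay_of_norm_sub_le [FiniteDimensional ℝ E] (β : ℝ) {t₀ : ℝ} (ht₀ : 0 < t₀) :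
    ∃ ρ > (0 : ℝ), ∃ c > (0 : ℝ), ∃ κ > (0 : ℝ), ∀ M : E →L[ℝ] E, ‖M‖ ≤ β →
      ‖exp (t₀ • M)‖ ≤ 1 / 2 → ∀ M' : E →L[ℝ] E, ‖M' - M‖ ≤ ρ → ExpDecay c κ M' := by
  obtain ⟨c, hc, κ, hκ, h⟩ := exists_expDecay_of_norm_exp_le (𝔸 := E →L[ℝ] E) clm_norm_one_le
    (β + 1) ht₀
  have : ProperSpace (E →L[ℝ] E) := FiniteDimensional.proper ℝ _
  have hcont : Continuous fun M : E →L[ℝ] E => exp (t₀ • M) := by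
    let _ : NormedAlgebra ℚ (E →L[ℝ] E) := NormedAlgebra.restrictScalars ℚ ℝ _
    exact exp_continuous.comp (continuous_const_smul t₀)
  have hu := (isCompact_closedBall (0 : E →L[ℝ] E) (β + 1)).uniformContinuousOn_of_continuous
    hcont.continuousOn
  obtain ⟨d, hd, hd'⟩ := Metric.uniformContinuousOn_iff.1 hu (1 / 4) (by norm_num)
  refine ⟨min 1 (d / 2), by positivity, c, hc, κ, hκ, fun M hM hM2 M' hM' => ?_⟩
  have h1 : ‖M'‖ ≤ β + 1 := by
    have := norm_sub_norm_le M' M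
    linarith [hM'.trans (min_le_left _ _)]
  refine h M' h1 ?_
  have h2 := hd' M' (mem_closedBall_zero_iff.2 h1) M (mem_closedBall_zero_iff.2 (by linarith))
    (by rw [dist_eq_norm]; linarith [hM'.trans (min_le_right _ _)])
  rw [dist_eq_norm] at h2
  have := norm_sub_norm_le (exp (t₀ • M')) (exp (t₀ • M))
  linarith

/-- The weight whose Lyapunov integral is the first variation of the value at `G` in direction `V`. -/
noncomputable def variationWeight (A : E →L[ℝ] E) (B : F →L[ℝ] E)
    (S : E →L[ℝ] E) (R : F →L[ℝ] F) (G V : E →L[ℝ] F) : E →L[ℝ] E :=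
  adjoint V ∘L (R ∘L G - adjoint B ∘L lyap (loopOp A B G) (stageWeight S R G)) +
    (adjoint G ∘L R - lyap (loopOp A B G) (stageWeight S R G) ∘L B) ∘L V

/-- The exact difference of the Lyapunov integrals of two feedbacks, as a Lyapunov integral for the
perturbed generator. -/
theorem lyap_add_sub_lyap {A : E →L[ℝ] E} {B : F →L[ℝ] E}
    {S : E →L[ℝ] E} {R : F →L[ℝ] F} {G V : E →L[ℝ] F} {c κ c' κ' : ℝ} (hκ : 0 < κ) (hκ' : 0 < κ')
    (h : ExpDecay c κ (loopOp A B G)) (h' : ExpDecay c' κ' (loopOp A B (G + V))) :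
    lyap (loopOp A B (G + V)) (stageWeight S R (G + V)) - lyap (loopOp A B G) (stageWeight S R G)
      = lyap (loopOp A B (G + V)) (variationWeight A B S R G V + adjoint V ∘L R ∘L V) := by
  have h1 := lyap_sub_lyap hκ hκ' h h' (stageWeight S R G)
  set P := lyap (loopOp A B G) (stageWeight S R G) with hP
  have e1 : loopOp A B (G + V) - loopOp A B G = -(B ∘L V) := by
    rw [loopOp_sub_loopOp]; ext x; simp
  have e2 : stageWeight S R (G + V) = stageWeight S R G +
      (adjoint V ∘L (R ∘L G) + (adjoint G ∘L R) ∘L V + adjoint V ∘L R ∘L V) := by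
    ext x; simp [stageWeight, map_add]; abel
  have e3 : star (-(B ∘L V)) * P + P * (-(B ∘L V))
      = -(adjoint V ∘L (adjoint B ∘L P)) - (P ∘L B) ∘L V := by
    rw [star_neg, ContinuousLinearMap.star_eq_adjoint, ContinuousLinearMap.adjoint_comp]
    ext x
    simp [sub_eq_add_neg]
  rw [e1, e3] at h1
  rw [e2, lyap_add hκ' h', add_sub_right_comm, h1, ← lyap_add hκ' h']
  congr 1
  ext x
  simp [variationWeight, ← hP]
  abel

/-- First order expansion of the value, with a quadratic remainder that is uniform over bounded
feedbacks whose closed loop is a contraction at a common time. -/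
theorem exists_abs_lqrValue_sub_le [FiniteDimensional ℝ E] (φ : (E →L[ℝ] E) →L[ℝ] ℝ)
    (A : E →L[ℝ] E) (B : F →L[ℝ] E) (S : E →L[ℝ] E) (R : F →L[ℝ] F) (β : ℝ) {t₀ : ℝ}
    (ht₀ : 0 < t₀) :
    ∃ ρ > (0 : ℝ), ∃ c > (0 : ℝ), ∃ κ > (0 : ℝ), ∃ H > (0 : ℝ), ∀ G : E →L[ℝ] F, ‖G‖ ≤ β →
      ‖exp (t₀ • loopOp A B G)‖ ≤ 1 / 2 → ∀ V : E →L[ℝ] F, ‖V‖ ≤ ρ →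
      ExpDecay c κ (loopOp A B (G + V)) ∧
      |lqrValue φ A B S R (G + V) - lqrValue φ A B S R G
        - φ (lyap (loopOp A B G) (variationWeight A B S R G V))| ≤ H * ‖V‖ ^ 2 := by
  obtain ⟨ρ, hρ, c, hc, κ, hκ, hdec⟩ :=
    exists_expDecay_of_norm_sub_le (E := E) (‖A‖ + ‖B‖ * β) ht₀
  set C : ℝ := c ^ 2 / (2 * κ) with hC
  have hC0 : 0 < C := by positivity
  set q : ℝ := ‖S‖ + β * ‖R‖ * β with hq
  set D : ℝ := 2 * (‖R‖ * β + ‖B‖ * (C * q)) with hD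
  refine ⟨ρ / (1 + ‖B‖), by positivity, c, hc, κ, hκ,
    ‖φ‖ * (C * (2 * ‖B‖ * (C * |D|) + ‖R‖)) + 1, by positivity, fun G hG hG2 V hV => ?_⟩
  have hβ : 0 ≤ β := (norm_nonneg _).trans hG
  have hM : ‖loopOp A B G‖ ≤ ‖A‖ + ‖B‖ * β := (norm_loopOp_le A B G).trans (by gcongr)
  have hdG : ExpDecay c κ (loopOp A B G) := hdec _ hM hG2 _ (by simpa using hρ.le)
  have hdV : ExpDecay c κ (loopOp A B (G + V)) := by
    refine hdec _ hM hG2 _ ?_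
    rw [loopOp_sub_loopOp]
    calc ‖B ∘L (G - (G + V))‖ ≤ ‖B‖ * ‖G - (G + V)‖ := ContinuousLinearMap.opNorm_comp_le _ _
      _ = ‖B‖ * ‖V‖ := by rw [sub_add_cancel_left, norm_neg]
      _ ≤ ‖B‖ * (ρ / (1 + ‖B‖)) := by gcongr
      _ ≤ (1 + ‖B‖) * (ρ / (1 + ‖B‖)) := by gcongr; linarith
      _ = ρ := by field_simp
  refine ⟨hdV, ?_⟩
  set P := lyap (loopOp A B G) (stageWeight S R G) with hP
  set W := variationWeight A B S R G V with hW
  have hq0 : 0 ≤ q := by positivity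
  have hadj : ∀ T : E →L[ℝ] F, ‖adjoint T‖ = ‖T‖ := fun T => LinearIsometryEquiv.norm_map _ _
  have hadjB : ‖adjoint B‖ = ‖B‖ := LinearIsometryEquiv.norm_map _ _
  have hPn : ‖P‖ ≤ C * q := by
    refine (norm_lyap_le hκ hdG _).trans ?_
    gcongr
    refine (norm_add_le _ _).trans ?_
    rw [hq, mul_assoc]
    gcongr
    calc ‖adjoint G ∘L R ∘L G‖ ≤ ‖adjoint G‖ * (‖R‖ * ‖G‖) :=
          (ContinuousLinearMap.opNorm_comp_le _ _).trans
            (by gcongr; exact ContinuousLinearMap.opNorm_comp_le _ _)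
      _ ≤ _ := by rw [hadj]; gcongr
  have hWn : ‖W‖ ≤ |D| * ‖V‖ := by
    have f1 : ‖adjoint V ∘L (R ∘L G - adjoint B ∘L P)‖ ≤ ‖V‖ * (‖R‖ * β + ‖B‖ * (C * q)) := by
      refine (ContinuousLinearMap.opNorm_comp_le _ _).trans ?_
      rw [hadj]
      gcongr
      refine (norm_sub_le _ _).trans ?_
      gcongr
      · exact (ContinuousLinearMap.opNorm_comp_le _ _).trans (by gcongr)
      · refine (ContinuousLinearMap.opNorm_comp_le _ _).trans ?_
        rw [hadjB]
        gcongr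
    have f2 : ‖(adjoint G ∘L R - P ∘L B) ∘L V‖ ≤ (‖R‖ * β + ‖B‖ * (C * q)) * ‖V‖ := by
      refine (ContinuousLinearMap.opNorm_comp_le _ _).trans ?_
      gcongr
      refine (norm_sub_le _ _).trans ?_
      gcongr
      · refine (ContinuousLinearMap.opNorm_comp_le _ _).trans ?_
        rw [hadj, mul_comm]; gcongr
      · refine (ContinuousLinearMap.opNorm_comp_le _ _).trans ?_
        rw [mul_comm]
        gcongr
    have f3 : ‖W‖ ≤ D * ‖V‖ := by
      rw [hD]
      refine (norm_add_le _ _).trans ?_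
      linarith
    exact f3.trans (by gcongr; exact le_abs_self D)
  have hY : ‖lyap (loopOp A B G) W‖ ≤ C * (|D| * ‖V‖) :=
    (norm_lyap_le hκ hdG _).trans (by gcongr)
  -- Replacing the perturbed generator by the unperturbed one in the first variation costs a second
  -- order term, by a second comparison of Lyapunov integrals.
  have e1 : lqrValue φ A B S R (G + V) - lqrValue φ A B S R G - φ (lyap (loopOp A B G) W)
      = φ (lyap (loopOp A B (G + V))
        (star (loopOp A B (G + V) - loopOp A B G) * lyap (loopOp A B G) W
          + lyap (loopOp A B G) W * (loopOp A B (G + V) - loopOp A B G)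
          + adjoint V ∘L R ∘L V)) := by
    rw [lyap_add hκ hdV, ← lyap_sub_lyap hκ hκ hdG hdV]
    rw [lqrValue, lqrValue, ← map_sub, lyap_add_sub_lyap hκ hκ hdG hdV, lyap_add hκ hdV,
      ← map_sub]
    congr 1
    abel
  have hΔ : ‖loopOp A B (G + V) - loopOp A B G‖ ≤ ‖B‖ * ‖V‖ := by
    rw [loopOp_sub_loopOp]
    refine (ContinuousLinearMap.opNorm_comp_le _ _).trans ?_
    rw [sub_add_cancel_left, norm_neg]
  rw [e1, ← Real.norm_eq_abs]
  refine (φ.le_opNorm _).trans ?_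
  have e2 : ‖star (loopOp A B (G + V) - loopOp A B G) * lyap (loopOp A B G) W
          + lyap (loopOp A B G) W * (loopOp A B (G + V) - loopOp A B G)
          + adjoint V ∘L R ∘L V‖ ≤ (2 * ‖B‖ * (C * |D|) + ‖R‖) * ‖V‖ ^ 2 := by
    have g1 : ‖star (loopOp A B (G + V) - loopOp A B G) * lyap (loopOp A B G) W‖
        ≤ (‖B‖ * ‖V‖) * (C * (|D| * ‖V‖)) := by
      have hst : ‖star (loopOp A B (G + V) - loopOp A B G)‖ ≤ ‖B‖ * ‖V‖ := by
        rw [ContinuousLinearMap.star_eq_adjoint, LinearIsometryEquiv.norm_map]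
        exact hΔ
      exact (norm_mul_le _ _).trans (by gcongr)
    have g2 : ‖lyap (loopOp A B G) W * (loopOp A B (G + V) - loopOp A B G)‖
        ≤ (C * (|D| * ‖V‖)) * (‖B‖ * ‖V‖) :=
      (norm_mul_le _ _).trans (by gcongr)
    have g3 : ‖adjoint V ∘L R ∘L V‖ ≤ ‖V‖ * (‖R‖ * ‖V‖) :=
      (ContinuousLinearMap.opNorm_comp_le _ _).trans
        (by rw [hadj]; gcongr; exact ContinuousLinearMap.opNorm_comp_le _ _)
    refine (norm_add_le _ _).trans ?_
    have := norm_add_le (star (loopOp A B (G + V) - loopOp A B G) * lyap (loopOp A B G) W)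
      (lyap (loopOp A B G) W * (loopOp A B (G + V) - loopOp A B G))
    linarith
  have e3 := (norm_lyap_le hκ hdV (star (loopOp A B (G + V) - loopOp A B G) * lyap (loopOp A B G) W
          + lyap (loopOp A B G) W * (loopOp A B (G + V) - loopOp A B G)
          + adjoint V ∘L R ∘L V)).trans (mul_le_mul_of_nonneg_left e2 hC0.le)
  calc _ ≤ ‖φ‖ * (C * ((2 * ‖B‖ * (C * |D|) + ‖R‖) * ‖V‖ ^ 2)) := by gcongr
    _ ≤ _ := by nlinarith [sq_nonneg ‖V‖]

end LinearFeedback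

/-! ### Hurwitz matrices -/

section Hurwitz

open NormedSpace Filter Topology

variable {n : ℕ}

/-- The complexification of a real square matrix. -/
def complexify (M : Matrix (Fin n) (Fin n) ℝ) : Matrix (Fin n) (Fin n) ℂ :=
  M.map ((↑) : ℝ → ℂ)

theorem continuous_complexify :
    Continuous (complexify : Matrix (Fin n) (Fin n) ℝ → Matrix (Fin n) (Fin n) ℂ) := by
  unfold complexify
  fun_prop

open Matrix.Norms.Operator in
theorem complexify_exp (M : Matrix (Fin n) (Fin n) ℝ) :
    complexify (exp M) = exp (complexify M) := by
  let _ : NormedAlgebra ℚ (Matrix (Fin n) (Fin n) ℝ) := NormedAlgebra.restrictScalars ℚ ℝ _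
  exact NormedSpace.map_exp (Complex.ofRealHom.mapMatrix) continuous_complexify M

theorem complexify_smul (t : ℝ) (M : Matrix (Fin n) (Fin n) ℝ) :
    complexify (t • M) = (t : ℂ) • complexify M := by
  ext i j
  simp [complexify]

theorem complexify_pow (M : Matrix (Fin n) (Fin n) ℝ) (k : ℕ) :
    complexify (M ^ k) = complexify M ^ k :=
  map_pow (Complex.ofRealHom.mapMatrix (m := Fin n)) M k

open Matrix.Norms.Operator in
theorem continuous_toEuclideanCLM :
    Continuous (Matrix.toEuclideanCLM (𝕜 := ℝ) (n := Fin n)) :=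
  LinearMap.continuous_of_finiteDimensional
    (Matrix.toEuclideanCLM (𝕜 := ℝ) (n := Fin n)).toAlgEquiv.toLinearMap

theorem continuous_toEuclideanCLM_symm :
    Continuous (Matrix.toEuclideanCLM (𝕜 := ℝ) (n := Fin n)).symm :=
  LinearMap.continuous_of_finiteDimensional
    (Matrix.toEuclideanCLM (𝕜 := ℝ) (n := Fin n)).symm.toAlgEquiv.toLinearMap

open Matrix.Norms.Operator in
theorem toEuclideanCLM_exp (M : Matrix (Fin n) (Fin n) ℝ) :
    Matrix.toEuclideanCLM (𝕜 := ℝ) (exp M) = exp (Matrix.toEuclideanCLM (𝕜 := ℝ) M) := by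
  let _ : NormedAlgebra ℚ (Matrix (Fin n) (Fin n) ℝ) := NormedAlgebra.restrictScalars ℚ ℝ _
  exact NormedSpace.map_exp (Matrix.toEuclideanCLM (𝕜 := ℝ) (n := Fin n))
    continuous_toEuclideanCLM M

theorem tendsto_cexp_mul_mul_pow {μ : ℂ} (hμ : μ.re < 0) (j : ℕ) :
    Tendsto (fun t : ℝ => Complex.exp (t * μ) * (t : ℂ) ^ j) atTop (𝓝 0) := by
  have h1 := (Real.tendsto_pow_mul_exp_neg_atTop_nhds_zero j).comp
    (tendsto_id.const_mul_atTop (by linarith : 0 < -μ.re))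
  have h2 := h1.const_mul ((-μ.re) ^ j)⁻¹
  rw [mul_zero] at h2
  refine squeeze_zero_norm' ?_ h2
  filter_upwards [eventually_ge_atTop 0] with t ht
  refine le_of_eq ?_
  have hne : (-μ.re) ^ j ≠ 0 := pow_ne_zero _ (by linarith)
  rw [norm_mul, Complex.norm_exp, norm_pow, Complex.norm_real, Real.norm_of_nonneg ht]
  simp only [Function.comp_apply, id_eq, mul_pow]
  have : (t * μ : ℂ).re = -(-μ.re * t) := by simp [mul_comm]
  rw [this]
  field_simp

open Matrix.Norms.Operator in
/-- On a generalized eigenvector the matrix exponential is a polynomial times a scalar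
exponential. -/
theorem exp_smul_mulVec_of_pow_mulVec_eq_zero (M : Matrix (Fin n) (Fin n) ℂ) (μ t : ℂ) (k : ℕ)
    (v : Fin n → ℂ) (hv : (M - μ • (1 : Matrix (Fin n) (Fin n) ℂ)) ^ k *ᵥ v = 0) :
    exp (t • M) *ᵥ v = ∑ j ∈ Finset.range k, (Complex.exp (t * μ) * t ^ j) •
      ((j.factorial : ℂ)⁻¹ • ((M - μ • (1 : Matrix (Fin n) (Fin n) ℂ)) ^ j *ᵥ v)) := by
  set N := M - μ • (1 : Matrix (Fin n) (Fin n) ℂ) with hN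
  have e1 : t • M = (t * μ) • (1 : Matrix (Fin n) (Fin n) ℂ) + t • N := by
    rw [hN, smul_sub, smul_smul]; abel
  have e2 : exp (t • M) = Complex.exp (t * μ) • exp (t • N) := by
    rw [e1, Matrix.exp_add_of_commute _ _ ((Commute.one_left _).smul_left _)]
    have := algebraMap_exp_comm (𝕂 := ℂ) (𝔸 := Matrix (Fin n) (Fin n) ℂ) (t * μ)
    rw [Algebra.algebraMap_eq_smul_one, Algebra.algebraMap_eq_smul_one] at this
    have h0 : exp ((t * μ) • (1 : Matrix (Fin n) (Fin n) ℂ))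
        = Complex.exp (t * μ) • (1 : Matrix (Fin n) (Fin n) ℂ) := by
      rw [Complex.exp_eq_exp_ℂ]; exact this.symm
    rw [h0, smul_mul_assoc, one_mul]
  have h1 := NormedSpace.exp_series_hasSum_exp' (𝕂 := ℂ) (t • N)
  let Λ : Matrix (Fin n) (Fin n) ℂ →L[ℂ] (Fin n → ℂ) :=
    LinearMap.toContinuousLinearMap ((Matrix.mulVecBilin ℂ ℂ).flip v)
  have h2 := Λ.hasSum h1
  have h3 : ∀ j ∉ Finset.range k, Λ ((j.factorial : ℂ)⁻¹ • (t • N) ^ j) = 0 := by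
    intro j hj
    have hj' : k ≤ j := by simpa using hj
    change ((j.factorial : ℂ)⁻¹ • (t • N) ^ j) *ᵥ v = 0
    have hN0 : N ^ j *ᵥ v = 0 := by
      rw [← Nat.sub_add_cancel hj', pow_add, ← Matrix.mulVec_mulVec, hv, Matrix.mulVec_zero]
    rw [smul_pow, Matrix.smul_mulVec, Matrix.smul_mulVec, hN0, smul_zero, smul_zero]
  have h4 := h2.unique (hasSum_sum_of_ne_finset_zero h3)
  change exp (t • N) *ᵥ v = ∑ j ∈ Finset.range k, ((j.factorial : ℂ)⁻¹ • (t • N) ^ j) *ᵥ v at h4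
  rw [e2, Matrix.smul_mulVec, h4, Finset.smul_sum]
  refine Finset.sum_congr rfl fun j _ => ?_
  rw [smul_pow, Matrix.smul_mulVec, Matrix.smul_mulVec, smul_smul, smul_smul, smul_smul]
  congr 1
  ring

/-- The space is spanned by generalized eigenvectors, on each of which the exponential tends to
zero. -/
theorem IsHurwitz.tendsto_exp_mulVec {M : Matrix (Fin n) (Fin n) ℝ} (hM : IsHurwitz M)
    (v : Fin n → ℂ) :
    Tendsto (fun t : ℝ => exp ((t : ℂ) • complexify M) *ᵥ v) atTop (𝓝 0) := by
  have htop := Module.End.iSup_maxGenEigenspace_eq_top (Matrix.toLin' (complexify M))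
  have hv : v ∈ ⨆ μ, Module.End.maxGenEigenspace (Matrix.toLin' (complexify M)) μ := by
    rw [htop]; trivial
  refine Submodule.iSup_induction (fun μ => Module.End.maxGenEigenspace
    (Matrix.toLin' (complexify M)) μ) (motive := fun v => Tendsto
      (fun t : ℝ => exp ((t : ℂ) • complexify M) *ᵥ v) atTop (𝓝 0)) hv ?_ ?_ ?_
  · intro μ v hv
    rw [Module.End.mem_maxGenEigenspace] at hv
    obtain ⟨k, hk⟩ := hv
    have hk' : (complexify M - μ • (1 : Matrix (Fin n) (Fin n) ℂ)) ^ k *ᵥ v = 0 := by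
      rw [← Matrix.toLin'_apply, Matrix.toLin'_pow, map_sub, map_smul, Matrix.toLin'_one]
      exact hk
    by_cases hv0 : v = 0
    · simp [hv0]
    have hμ : μ.re < 0 := by
      refine hM μ ?_
      change μ ∈ spectrum ℂ (complexify M)
      rw [← Matrix.spectrum_toLin', ← Module.End.hasEigenvalue_iff_mem_spectrum]
      refine Module.End.hasEigenvalue_of_hasGenEigenvalue (k := k) ?_
      rw [Module.End.hasGenEigenvalue_iff, Submodule.ne_bot_iff]
      refine ⟨v, ?_, hv0⟩
      rw [Module.End.mem_genEigenspace_nat, LinearMap.mem_ker]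
      exact hk
    simp_rw [exp_smul_mulVec_of_pow_mulVec_eq_zero _ μ _ k v hk']
    rw [show (0 : Fin n → ℂ) = ∑ j ∈ Finset.range k, (0 : ℂ) •
      ((j.factorial : ℂ)⁻¹ • ((complexify M - μ • (1 : Matrix (Fin n) (Fin n) ℂ)) ^ j *ᵥ v)) by
        simp]
    exact tendsto_finsetSum _ fun j _ => (tendsto_cexp_mul_mul_pow hμ j).smul_const _
  · simp
  · intro x y hx hy
    simp_rw [Matrix.mulVec_add]
    simpa using hx.add hy

theorem IsHurwitz.tendsto_exp {M : Matrix (Fin n) (Fin n) ℝ} (hM : IsHurwitz M) :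
    Tendsto (fun t : ℝ => exp (t • M)) atTop (𝓝 0) := by
  refine tendsto_pi_nhds.2 fun i => tendsto_pi_nhds.2 fun j => ?_
  have h1 := tendsto_pi_nhds.1 (hM.tendsto_exp_mulVec (Pi.single j 1)) i
  have h2 := (Complex.continuous_re.tendsto _).comp h1
  refine h2.congr fun t => ?_
  simp only [Function.comp_apply, Matrix.mulVec_single_one, Matrix.col_apply]
  rw [← complexify_smul, ← complexify_exp]
  simp [complexify]

/-- A matrix is Hurwitz exactly when its semigroup is a strict contraction at some positive time. -/
theorem isHurwitz_iff_exists_norm_exp_le {M : Matrix (Fin n) (Fin n) ℝ} :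
    IsHurwitz M ↔ ∃ t₀ > (0 : ℝ), ‖exp (t₀ • Matrix.toEuclideanCLM (𝕜 := ℝ) M)‖ ≤ 1 / 2 := by
  constructor
  · intro h
    have h1 := ((continuous_toEuclideanCLM (n := n)).tendsto 0).comp h.tendsto_exp
    rw [map_zero] at h1
    have h2 := h1.norm
    rw [norm_zero] at h2
    obtain ⟨t, ht, ht'⟩ := ((eventually_gt_atTop 0).and
      (h2.eventually (ge_mem_nhds (by norm_num : (0 : ℝ) < 1 / 2)))).exists
    refine ⟨t, ht, ?_⟩
    rwa [Function.comp_apply, toEuclideanCLM_exp, map_smul] at ht'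
  · rintro ⟨t₀, ht₀, h⟩ z hz
    by_contra hre
    push Not at hre
    -- An eigenvalue `z` of nonnegative real part gives the eigenvalues `exp (t₀ z) ^ k`, of modulus at
    -- least one, of matrices that tend to zero.
    have h0 : Tendsto (fun k : ℕ => exp (t₀ • Matrix.toEuclideanCLM (𝕜 := ℝ) M) ^ k)
        atTop (𝓝 0) :=
      tendsto_pow_atTop_nhds_zero_of_norm_lt_one (by linarith)
    have h1 := (continuous_complexify.tendsto _).comp
      (((continuous_toEuclideanCLM_symm (n := n)).tendsto 0).comp h0)
    have e1 : complexify ((Matrix.toEuclideanCLM (𝕜 := ℝ) (n := Fin n)).symm 0) = 0 := by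
      rw [map_zero]; ext i j; simp [complexify]
    rw [e1] at h1
    have e2 : ∀ k : ℕ, complexify ((Matrix.toEuclideanCLM (𝕜 := ℝ) (n := Fin n)).symm
        (exp (t₀ • Matrix.toEuclideanCLM (𝕜 := ℝ) M) ^ k)) = exp ((t₀ : ℂ) • complexify M) ^ k := by
      intro k
      rw [map_pow, complexify_pow, ← map_smul, ← toEuclideanCLM_exp, StarAlgEquiv.symm_apply_apply,
        complexify_exp, complexify_smul]
    have h2 : Tendsto (fun k : ℕ => exp ((t₀ : ℂ) • complexify M) ^ k) atTop (𝓝 0) :=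
      h1.congr e2
    have hz1 : (t₀ : ℂ) • z ∈ spectrum ℂ ((t₀ : ℂ) • complexify M) := by
      have hne : (t₀ : ℂ) ≠ 0 := by exact_mod_cast ht₀.ne'
      exact (spectrum.smul_mem_smul_iff (r := Units.mk0 (t₀ : ℂ) hne)).2 hz
    open Matrix.Norms.Operator in
    have hz2 : ∀ k : ℕ, (1 : ℝ) ≤ ‖exp ((t₀ : ℂ) • complexify M) ^ k‖ *
        ‖(1 : Matrix (Fin n) (Fin n) ℂ)‖ := by
      intro k
      have := spectrum.norm_le_norm_mul_of_mem
        (spectrum.pow_mem_pow _ k (spectrum.exp_mem_exp _ hz1))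
      refine le_trans ?_ this
      rw [norm_pow, ← Complex.exp_eq_exp_ℂ, Complex.norm_exp]
      refine one_le_pow₀ (Real.one_le_exp ?_)
      simp only [smul_eq_mul, Complex.re_ofReal_mul]
      positivity
    open Matrix.Norms.Operator in
    have h3 : Tendsto (fun k : ℕ => ‖exp ((t₀ : ℂ) • complexify M) ^ k‖ *
        ‖(1 : Matrix (Fin n) (Fin n) ℂ)‖) atTop (𝓝 0) := by
      have := (tendsto_norm_zero.comp h2).mul_const ‖(1 : Matrix (Fin n) (Fin n) ℂ)‖
      simpa using this
    have := ge_of_tendsto' h3 hz2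
    linarith

end Hurwitz

/-! ### The output feedback problem in terms of operators -/

section Operators

open NormedSpace Filter Topology Set
open ContinuousLinearMap (adjoint)

/-- A positive definite matrix dominates a positive multiple of the identity. -/
theorem Matrix.PosDef.exists_mul_norm_sq_le {ι : Type*} [Fintype ι] [DecidableEq ι]
    {M : Matrix ι ι ℝ} (hM : M.PosDef) :
    ∃ ρ > (0 : ℝ), ∀ u : EuclideanSpace ℝ ι,
      ρ * ‖u‖ ^ 2 ≤ inner ℝ u (Matrix.toEuclideanCLM (𝕜 := ℝ) M u) := by
  set q : EuclideanSpace ℝ ι → ℝ := fun u => inner ℝ u (Matrix.toEuclideanCLM (𝕜 := ℝ) M u) with hq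
  have hpos : ∀ u, u ≠ 0 → 0 < q u := by
    intro u hu
    rw [hq]
    simp only
    rw [show Matrix.toEuclideanCLM (𝕜 := ℝ) M u
      = WithLp.toLp 2 (M *ᵥ u.ofLp) from rfl, EuclideanSpace.inner_eq_star_dotProduct,
      dotProduct_comm]
    refine hM.dotProduct_mulVec_pos fun h => hu ?_
    ext i
    simpa using congrFun h i
  have hcont : Continuous q := continuous_id.inner (Matrix.toEuclideanCLM (𝕜 := ℝ) M).continuous
  -- The unit sphere is empty exactly when the space is zero.
  rcases (Metric.sphere (0 : EuclideanSpace ℝ ι) 1).eq_empty_or_nonempty with he | hne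
  · refine ⟨1, one_pos, fun u => ?_⟩
    have hu : u = 0 := by
      by_contra hu
      have : ‖u‖⁻¹ • u ∈ Metric.sphere (0 : EuclideanSpace ℝ ι) 1 := by
        simp [norm_smul, hu]
      rw [he] at this
      exact this
    simp [hu]
  · obtain ⟨u₀, hu₀, hmin⟩ := (isCompact_sphere (0 : EuclideanSpace ℝ ι) 1).exists_isMinOn hne
      hcont.continuousOn
    have hu₀' : u₀ ≠ 0 := by
      rintro rfl
      simp at hu₀
    refine ⟨q u₀, hpos u₀ hu₀', fun u => ?_⟩
    by_cases hu : u = 0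
    · simp [hu]
    have hmem : ‖u‖⁻¹ • u ∈ Metric.sphere (0 : EuclideanSpace ℝ ι) 1 := by
      simp [norm_smul, hu]
    have h1 : q u₀ ≤ q (‖u‖⁻¹ • u) := hmin hmem
    have h2 : q (‖u‖⁻¹ • u) = (‖u‖ ^ 2)⁻¹ * q u := by
      simp only [hq, map_smul, real_inner_smul_left, real_inner_smul_right]
      rw [sq, mul_inv]; ring
    have hn : 0 < ‖u‖ ^ 2 := by have := norm_pos_iff.2 hu; positivity
    rw [h2, inv_mul_eq_div, le_div_iff₀ hn] at h1
    exact h1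

/-- The operator between Euclidean spaces given by a rectangular matrix. -/
noncomputable def matrixCLM {a b : ℕ} (M : Matrix (Fin a) (Fin b) ℝ) :
    EuclideanSpace ℝ (Fin b) →L[ℝ] EuclideanSpace ℝ (Fin a) :=
  LinearMap.toContinuousLinearMap (Matrix.toLpLin 2 2 M)

@[simp]
theorem ofLp_matrixCLM {a b : ℕ} (M : Matrix (Fin a) (Fin b) ℝ) (x : EuclideanSpace ℝ (Fin b)) :
    (matrixCLM M x).ofLp = M *ᵥ x.ofLp := rfl

/-- The functional `W ↦ E ⟪x, W x⟫` of an almost surely bounded random vector with law `D`. -/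
noncomputable def meanForm {n : ℕ} (D : Measure (EuclideanSpace ℝ (Fin n)))
    [IsProbabilityMeasure D] {P : ℝ} (hbdd : ∀ᵐ x ∂D, ‖x‖ ≤ P) :
    (EuclideanSpace ℝ (Fin n) →L[ℝ] EuclideanSpace ℝ (Fin n)) →L[ℝ] ℝ :=
  have hb : ∀ W : EuclideanSpace ℝ (Fin n) →L[ℝ] EuclideanSpace ℝ (Fin n),
      ∀ᵐ x ∂D, ‖inner ℝ x (W x)‖ ≤ P ^ 2 * ‖W‖ := fun W => by
    filter_upwards [hbdd] with x hx
    calc ‖inner ℝ x (W x)‖ ≤ ‖x‖ * ‖W x‖ := norm_inner_le_norm _ _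
      _ ≤ ‖x‖ * (‖W‖ * ‖x‖) := by gcongr; exact W.le_opNorm x
      _ = ‖x‖ ^ 2 * ‖W‖ := by ring
      _ ≤ _ := by gcongr
  have hi : ∀ W : EuclideanSpace ℝ (Fin n) →L[ℝ] EuclideanSpace ℝ (Fin n),
      Integrable (fun x => inner ℝ x (W x)) D := fun W =>
    Integrable.of_bound (continuous_id.inner W.continuous).aestronglyMeasurable _ (hb W)
  LinearMap.mkContinuous
    { toFun := fun W => ∫ x, inner ℝ x (W x) ∂D
      map_add' := fun W W' => by
        simp only [add_apply, inner_add_right]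
        exact integral_add (hi W) (hi W')
      map_smul' := fun r W => by
        simp only [smul_apply, real_inner_smul_right, RingHom.id_apply, smul_eq_mul]
        exact integral_const_mul _ _ }
    (P ^ 2) (fun W => by
      have := norm_integral_le_of_norm_le_const (hb W)
      simpa using this)

theorem meanForm_apply {n : ℕ} (D : Measure (EuclideanSpace ℝ (Fin n)))
    [IsProbabilityMeasure D] {P : ℝ} (hbdd : ∀ᵐ x ∂D, ‖x‖ ≤ P)
    (W : EuclideanSpace ℝ (Fin n) →L[ℝ] EuclideanSpace ℝ (Fin n)) :
    meanForm D hbdd W = ∫ x, inner ℝ x (W x) ∂D := rfl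

theorem Gain.mat_add {m p : ℕ} (K K' : Gain m p) : (K + K').mat = K.mat + K'.mat := rfl

theorem Gain.mat_smul {m p : ℕ} (r : ℝ) (K : Gain m p) : (r • K).mat = r • K.mat := rfl

namespace OutputFeedbackLQR

variable {n m p : ℕ} (𝒮 : OutputFeedbackLQR n m p)

/-- The state feedback `x ↦ K C x` that a gain induces, as a linear function of the gain. -/
noncomputable def feedback :
    Gain m p →L[ℝ] EuclideanSpace ℝ (Fin n) →L[ℝ] EuclideanSpace ℝ (Fin m) :=
  LinearMap.toContinuousLinearMap
    { toFun := fun K => matrixCLM (K.mat * 𝒮.C)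
      map_add' := fun K K' => by
        rw [Gain.mat_add, Matrix.add_mul]
        ext x i
        simp [Matrix.add_mulVec]
      map_smul' := fun r K => by
        rw [Gain.mat_smul, Matrix.smul_mul]
        ext x i
        simp [Matrix.smul_mulVec] }

theorem feedback_apply (K : Gain m p) : 𝒮.feedback K = matrixCLM (K.mat * 𝒮.C) := rfl

theorem ofLp_feedback (K : Gain m p) (x : EuclideanSpace ℝ (Fin n)) :
    (𝒮.feedback K x).ofLp = K.mat *ᵥ (𝒮.C *ᵥ x.ofLp) := by
  rw [feedback_apply, ofLp_matrixCLM, Matrix.mulVec_mulVec]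

/-- The weight `C⋆ Q C` of the output cost. -/
noncomputable def outputWeight : EuclideanSpace ℝ (Fin n) →L[ℝ] EuclideanSpace ℝ (Fin n) :=
  adjoint (matrixCLM 𝒮.C) ∘L Matrix.toEuclideanCLM (𝕜 := ℝ) 𝒮.Q ∘L matrixCLM 𝒮.C

theorem inner_outputWeight (x : EuclideanSpace ℝ (Fin n)) : inner ℝ x (𝒮.outputWeight x)
    = inner ℝ (matrixCLM 𝒮.C x) (Matrix.toEuclideanCLM (𝕜 := ℝ) 𝒮.Q (matrixCLM 𝒮.C x)) := by
  simp [outputWeight, ContinuousLinearMap.adjoint_inner_right]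

/-- The closed loop generator of a gain. -/
noncomputable def loop (K : Gain m p) : EuclideanSpace ℝ (Fin n) →L[ℝ] EuclideanSpace ℝ (Fin n) :=
  loopOp (Matrix.toEuclideanCLM (𝕜 := ℝ) 𝒮.A) (matrixCLM 𝒮.B) (𝒮.feedback K)

/-- The weight of the stage cost under a gain. -/
noncomputable def weight (K : Gain m p) :
    EuclideanSpace ℝ (Fin n) →L[ℝ] EuclideanSpace ℝ (Fin n) :=
  stageWeight 𝒮.outputWeight (Matrix.toEuclideanCLM (𝕜 := ℝ) 𝒮.R) (𝒮.feedback K)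

theorem loop_eq (K : Gain m p) : 𝒮.loop K = Matrix.toEuclideanCLM (𝕜 := ℝ) (𝒮.closedLoop K) := by
  ext x i
  simp [loop, loopOp, closedLoop, ofLp_feedback, ← Matrix.mulVec_mulVec]

theorem continuous_loop : Continuous 𝒮.loop := by
  unfold loop loopOp
  exact continuous_const.sub (continuous_const.clm_comp 𝒮.feedback.continuous)

theorem continuous_weight : Continuous 𝒮.weight := by
  unfold weight stageWeight
  have h := 𝒮.feedback.continuous
  have h' : Continuous fun K : Gain m p => adjoint (𝒮.feedback K) :=
    (LinearIsometryEquiv.continuous _).comp h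
  exact continuous_const.add (h'.clm_comp (continuous_const.clm_comp h))

theorem mem_stabilizing_iff_exists_norm_exp_le {K : Gain m p} :
    K ∈ 𝒮.stabilizing ↔ ∃ t₀ > (0 : ℝ), ‖exp (t₀ • 𝒮.loop K)‖ ≤ 1 / 2 := by
  rw [loop_eq]
  exact isHurwitz_iff_exists_norm_exp_le

theorem mem_stabilizing_iff_exists_expDecay {K : Gain m p} :
    K ∈ 𝒮.stabilizing ↔ ∃ c, ∃ κ > (0 : ℝ), ExpDecay c κ (𝒮.loop K) := by
  rw [mem_stabilizing_iff_exists_norm_exp_le]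
  constructor
  · rintro ⟨t₀, ht₀, h⟩
    obtain ⟨c, -, κ, hκ, hd⟩ := exists_expDecay_of_norm_exp_le
      (𝔸 := EuclideanSpace ℝ (Fin n) →L[ℝ] EuclideanSpace ℝ (Fin n)) clm_norm_one_le
      ‖𝒮.loop K‖ ht₀
    exact ⟨c, κ, hκ, hd _ le_rfl (h.trans (by norm_num))⟩
  · rintro ⟨c, κ, hκ, h⟩
    have h1 := (h.tendsto hκ).norm
    rw [norm_zero] at h1
    obtain ⟨t, ht, ht'⟩ := ((eventually_gt_atTop 0).and
      (h1.eventually (ge_mem_nhds (by norm_num : (0 : ℝ) < 1 / 2)))).exists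
    exact ⟨t, ht, ht'⟩

theorem stateAt_eq (K : Gain m p) (x₀ : EuclideanSpace ℝ (Fin n)) (t : ℝ) :
    𝒮.stateAt K x₀ t = (exp (t • 𝒮.loop K) x₀).ofLp := by
  rw [stateAt, loop_eq, ← map_smul, ← toEuclideanCLM_exp, Matrix.ofLp_toEuclideanCLM]

theorem stageCost_eq (K : Gain m p) (x₀ : EuclideanSpace ℝ (Fin n)) (t : ℝ) :
    𝒮.stageCost K x₀ t
      = inner ℝ (exp (t • 𝒮.loop K) x₀) (𝒮.weight K (exp (t • 𝒮.loop K) x₀)) := by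
  rw [weight, inner_stageWeight, inner_outputWeight, Matrix.inner_toEuclideanCLM,
    Matrix.inner_toEuclideanCLM, ofLp_matrixCLM, ofLp_feedback, ← stateAt_eq, stageCost, inputAt,
    outputAt, Matrix.mulVec_neg, neg_dotProduct_neg]

/-- The total cost from an initial state is the quadratic form of the Lyapunov integral. -/
theorem integral_stageCost {K : Gain m p} {c κ : ℝ} (hκ : 0 < κ)
    (h : ExpDecay c κ (𝒮.loop K)) (x₀ : EuclideanSpace ℝ (Fin n)) :
    IntegrableOn (𝒮.stageCost K x₀) (Ioi 0) ∧
      ∫ t in Ioi (0 : ℝ), 𝒮.stageCost K x₀ t = inner ℝ x₀ (lyap (𝒮.loop K) (𝒮.weight K) x₀) := by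
  have := inner_lyap hκ h (𝒮.weight K) x₀
  simp only [← stageCost_eq] at this
  exact ⟨this.1, this.2.symm⟩

theorem abs_stageCost_le {K : Gain m p} {c κ : ℝ} (h : ExpDecay c κ (𝒮.loop K))
    (x₀ : EuclideanSpace ℝ (Fin n)) {t : ℝ} (ht : 0 ≤ t) :
    |𝒮.stageCost K x₀ t| ≤ c ^ 2 * ‖𝒮.weight K‖ * ‖x₀‖ ^ 2 * Real.exp (-(2 * κ) * t) := by
  rw [stageCost_eq, ← inner_lyapIntegrand]
  calc |inner ℝ x₀ (lyapIntegrand (𝒮.loop K) (𝒮.weight K) t x₀)|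
      ≤ ‖x₀‖ * (‖lyapIntegrand (𝒮.loop K) (𝒮.weight K) t‖ * ‖x₀‖) :=
        (abs_real_inner_le_norm _ _).trans (by gcongr; exact ContinuousLinearMap.le_opNorm _ _)
    _ ≤ ‖x₀‖ * ((c ^ 2 * ‖𝒮.weight K‖ * Real.exp (-(2 * κ) * t)) * ‖x₀‖) := by
        gcongr; exact norm_lyapIntegrand_le h _ ht
    _ = _ := by ring

/-- The truncation error of the cost decays exponentially in the horizon. -/
theorem abs_truncatedCost_sub_le {K : Gain m p} {c κ : ℝ} (hκ : 0 < κ)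
    (h : ExpDecay c κ (𝒮.loop K)) (x₀ : EuclideanSpace ℝ (Fin n)) {τ : ℝ} (hτ : 0 ≤ τ) :
    |𝒮.truncatedCost K τ x₀ - inner ℝ x₀ (lyap (𝒮.loop K) (𝒮.weight K) x₀)|
      ≤ c ^ 2 * ‖𝒮.weight K‖ * ‖x₀‖ ^ 2 / (2 * κ) * Real.exp (-(2 * κ) * τ) := by
  obtain ⟨hi, he⟩ := 𝒮.integral_stageCost hκ h x₀
  rw [← he, truncatedCost, ← intervalIntegral.integral_Ioi_sub_Ioi hi hτ, sub_sub_cancel_left,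
    abs_neg, ← Real.norm_eq_abs]
  have hi' := (integrableOn_exp_mul_Ioi (a := -(2 * κ)) (by linarith) τ).const_mul
    (c ^ 2 * ‖𝒮.weight K‖ * ‖x₀‖ ^ 2)
  refine (norm_integral_le_of_norm_le hi' ?_).trans (le_of_eq ?_)
  · filter_upwards [ae_restrict_mem measurableSet_Ioi] with t ht
    exact 𝒮.abs_stageCost_le h x₀ (hτ.trans (le_of_lt ht))
  · rw [integral_const_mul, integral_exp_mul_Ioi (by linarith)]
    field_simp

theorem abs_truncatedCost_le {K : Gain m p} {c κ : ℝ} (hκ : 0 < κ)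
    (h : ExpDecay c κ (𝒮.loop K)) (x₀ : EuclideanSpace ℝ (Fin n)) {τ : ℝ} (hτ : 0 ≤ τ) :
    |𝒮.truncatedCost K τ x₀| ≤ c ^ 2 * ‖𝒮.weight K‖ * ‖x₀‖ ^ 2 / κ := by
  have h1 := 𝒮.abs_truncatedCost_sub_le hκ h x₀ hτ
  have h2 : |inner ℝ x₀ (lyap (𝒮.loop K) (𝒮.weight K) x₀)|
      ≤ c ^ 2 * ‖𝒮.weight K‖ * ‖x₀‖ ^ 2 / (2 * κ) := by
    calc _ ≤ ‖x₀‖ * ((c ^ 2 / (2 * κ) * ‖𝒮.weight K‖) * ‖x₀‖) := by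
          refine (abs_real_inner_le_norm _ _).trans ?_
          gcongr
          refine (ContinuousLinearMap.le_opNorm _ _).trans ?_
          gcongr
          exact norm_lyap_le hκ h _
      _ = _ := by ring
  have h3 : Real.exp (-(2 * κ) * τ) ≤ 1 := Real.exp_le_one_iff.2 (by nlinarith)
  have h4 : c ^ 2 * ‖𝒮.weight K‖ * ‖x₀‖ ^ 2 / (2 * κ) * Real.exp (-(2 * κ) * τ)
      ≤ c ^ 2 * ‖𝒮.weight K‖ * ‖x₀‖ ^ 2 / (2 * κ) * 1 := by gcongr
  have h5 : c ^ 2 * ‖𝒮.weight K‖ * ‖x₀‖ ^ 2 / κ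
      = c ^ 2 * ‖𝒮.weight K‖ * ‖x₀‖ ^ 2 / (2 * κ) + c ^ 2 * ‖𝒮.weight K‖ * ‖x₀‖ ^ 2 / (2 * κ) := by
    field_simp; ring
  rw [h5]
  have := abs_sub_abs_le_abs_sub (𝒮.truncatedCost K τ x₀)
    (inner ℝ x₀ (lyap (𝒮.loop K) (𝒮.weight K) x₀))
  linarith

/-- The truncated cost is jointly continuous in the gain and the initial state. -/
theorem continuous_truncatedCost (τ : ℝ) :
    Continuous fun q : Gain m p × EuclideanSpace ℝ (Fin n) => 𝒮.truncatedCost q.1 τ q.2 := by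
  unfold truncatedCost
  refine intervalIntegral.continuous_parametric_intervalIntegral_of_continuous
    (f := fun q : Gain m p × EuclideanSpace ℝ (Fin n) => 𝒮.stageCost q.1 q.2) ?_ continuous_const
  have hexp : Continuous
      fun M : EuclideanSpace ℝ (Fin n) →L[ℝ] EuclideanSpace ℝ (Fin n) => exp M := by
    let _ : NormedAlgebra ℚ (EuclideanSpace ℝ (Fin n) →L[ℝ] EuclideanSpace ℝ (Fin n)) :=
      NormedAlgebra.restrictScalars ℚ ℝ _
    exact exp_continuous
  have h1 : Continuous fun q : (Gain m p × EuclideanSpace ℝ (Fin n)) × ℝ =>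
      exp (q.2 • 𝒮.loop q.1.1) q.1.2 := by
    refine Continuous.clm_apply (hexp.comp ?_) (continuous_snd.comp continuous_fst)
    exact continuous_snd.smul (𝒮.continuous_loop.comp (continuous_fst.comp continuous_fst))
  have h2 : Continuous fun q : (Gain m p × EuclideanSpace ℝ (Fin n)) × ℝ => 𝒮.weight q.1.1 :=
    𝒮.continuous_weight.comp (continuous_fst.comp continuous_fst)
  have h3 := h1.inner (h2.clm_apply h1) (𝕜 := ℝ)
  refine h3.congr fun q => ?_
  rw [Function.uncurry, stageCost_eq]

theorem exists_isCoerciveFunctional [IsProbabilityMeasure 𝒮.𝒟] {P : ℝ}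
    (hbdd : ∀ᵐ x ∂𝒮.𝒟, ‖x‖ ≤ P) (hSigma : 𝒮.initialSecondMoment.PosDef) :
    ∃ σ > (0 : ℝ), IsCoerciveFunctional σ (meanForm 𝒮.𝒟 hbdd) := by
  obtain ⟨σ, hσ, h⟩ := hSigma.exists_mul_norm_sq_le
  refine ⟨σ, hσ, ⟨fun W hW => ?_, fun v => (h v).trans (le_of_eq ?_)⟩⟩
  · rw [meanForm_apply]
    exact integral_nonneg hW
  · have hi : ∀ i j, Integrable (fun x : EuclideanSpace ℝ (Fin n) => x i * x j) 𝒮.𝒟 := by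
      intro i j
      refine Integrable.of_bound (C := P ^ 2) (by fun_prop) ?_
      filter_upwards [hbdd] with x hx
      have h1 := PiLp.norm_apply_le x i
      have h2 := PiLp.norm_apply_le x j
      rw [norm_mul, sq]
      have := norm_nonneg (x i)
      have := norm_nonneg (x j)
      gcongr <;> linarith
    rw [meanForm_apply, Matrix.inner_toEuclideanCLM]
    have e : ∀ x : EuclideanSpace ℝ (Fin n), inner ℝ x ((innerSL ℝ v).smulRight v x)
        = ∑ i, ∑ j, v i * v j * (x i * x j) := by
      intro x
      rw [ContinuousLinearMap.smulRight_apply, innerSL_apply_apply, real_inner_smul_right,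
        real_inner_comm v x, PiLp.inner_apply, Finset.sum_mul_sum]
      refine Finset.sum_congr rfl fun i _ => Finset.sum_congr rfl fun j _ => ?_
      simp only [RCLike.inner_apply, conj_trivial]
      ring
    simp_rw [e]
    rw [integral_finsetSum _ fun i _ => integrable_finsetSum _ fun j _ => (hi i j).const_mul _]
    simp_rw [dotProduct, Matrix.mulVec, dotProduct, Finset.mul_sum]
    refine Finset.sum_congr rfl fun i _ => ?_
    rw [integral_finsetSum _ fun j _ => (hi i j).const_mul _]
    refine Finset.sum_congr rfl fun j _ => ?_
    rw [integral_const_mul, initialSecondMoment, Matrix.of_apply]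
    ring

theorem cost_eq_lqrValue [IsProbabilityMeasure 𝒮.𝒟] {P : ℝ} (hbdd : ∀ᵐ x ∂𝒮.𝒟, ‖x‖ ≤ P)
    {K : Gain m p} (hK : K ∈ 𝒮.stabilizing) :
    𝒮.cost K = lqrValue (meanForm 𝒮.𝒟 hbdd) (Matrix.toEuclideanCLM (𝕜 := ℝ) 𝒮.A) (matrixCLM 𝒮.B)
      𝒮.outputWeight (Matrix.toEuclideanCLM (𝕜 := ℝ) 𝒮.R) (𝒮.feedback K) := by
  obtain ⟨c, κ, hκ, h⟩ := 𝒮.mem_stabilizing_iff_exists_expDecay.1 hK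
  rw [cost, lqrValue, meanForm_apply]
  exact integral_congr_ae (Eventually.of_forall fun x => (𝒮.integral_stageCost hκ h x).2)

end OutputFeedbackLQR

end Operators

/-! ### The cost on a sublevel set -/

section Sublevel

open NormedSpace Filter Topology Set
open ContinuousLinearMap (adjoint)

theorem hasFDerivAt_of_abs_sub_le_mul_sq {E : Type*} [NormedAddCommGroup E] [NormedSpace ℝ E]
    {f : E → ℝ} {L : E →L[ℝ] ℝ} {x : E} {ρ H : ℝ} (hρ : 0 < ρ) (hH : 0 ≤ H)
    (h : ∀ V : E, ‖V‖ ≤ ρ → |f (x + V) - f x - L V| ≤ H * ‖V‖ ^ 2) : HasFDerivAt f L x := by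
  rw [hasFDerivAt_iff_isLittleO_nhds_zero, Asymptotics.isLittleO_iff]
  intro c hc
  filter_upwards [Metric.closedBall_mem_nhds (0 : E)
    (lt_min hρ (div_pos hc (by linarith : 0 < H + 1)))] with V hV
  rw [mem_closedBall_zero_iff] at hV
  have h1 := hV.trans (min_le_right _ _)
  rw [le_div_iff₀ (by linarith)] at h1
  refine (h V (hV.trans (min_le_left _ _))).trans ?_
  have h2 := mul_le_mul_of_nonneg_right h1 (norm_nonneg V)
  nlinarith [norm_nonneg V, sq_nonneg ‖V‖]

namespace OutputFeedbackLQR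

variable {n m p : ℕ} (𝒮 : OutputFeedbackLQR n m p)

theorem inner_outputWeight_nonneg (hQ : 𝒮.Q.PosDef) (x : EuclideanSpace ℝ (Fin n)) :
    0 ≤ inner ℝ x (𝒮.outputWeight x) := by
  obtain ⟨q, hq, h⟩ := hQ.exists_mul_norm_sq_le
  rw [inner_outputWeight]
  exact le_trans (by positivity) (h _)

theorem inner_weight_nonneg (hQ : 𝒮.Q.PosDef) (hR : 𝒮.R.PosDef) (K : Gain m p)
    (x : EuclideanSpace ℝ (Fin n)) : 0 ≤ inner ℝ x (𝒮.weight K x) := by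
  obtain ⟨q, hq, h⟩ := hR.exists_mul_norm_sq_le
  rw [weight, inner_stageWeight]
  exact add_nonneg (𝒮.inner_outputWeight_nonneg hQ x) (le_trans (by positivity) (h _))

theorem cost_nonneg (hQ : 𝒮.Q.PosDef) (hR : 𝒮.R.PosDef) (K : Gain m p) : 0 ≤ 𝒮.cost K := by
  refine integral_nonneg fun x => integral_nonneg fun t => ?_
  rw [stageCost_eq]
  exact 𝒮.inner_weight_nonneg hQ hR K _

theorem mem_sublevel_cost {K : Gain m p} (hK : K ∈ 𝒮.stabilizing) :
    K ∈ 𝒮.sublevel (𝒮.cost K) := ⟨hK, le_rfl⟩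

variable [IsProbabilityMeasure 𝒮.𝒟]

/-- On a sublevel set the induced state feedback is bounded and the closed loop is a contraction at
a common time. A member of the sublevel set serves as the reference feedback. -/
theorem exists_bounds_on_sublevel (hQ : 𝒮.Q.PosDef) (hR : 𝒮.R.PosDef)
    (hSigma : 𝒮.initialSecondMoment.PosDef) {P : ℝ} (hbdd : ∀ᵐ x ∂𝒮.𝒟, ‖x‖ ≤ P) (a : ℝ) :
    ∃ β : ℝ, ∃ t₀ > (0 : ℝ), ∀ K ∈ 𝒮.sublevel a,
      ‖𝒮.feedback K‖ ≤ β ∧ ‖exp (t₀ • 𝒮.loop K)‖ ≤ 1 / 2 := by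
  by_cases hne : ∃ K, K ∈ 𝒮.sublevel a
  swap
  · exact ⟨0, 1, one_pos, fun K hK => (hne ⟨K, hK⟩).elim⟩
  obtain ⟨Ks, hKs, -⟩ := hne
  obtain ⟨cs, κs, hκs, hs⟩ := 𝒮.mem_stabilizing_iff_exists_expDecay.1 hKs
  obtain ⟨q, hq, hQ'⟩ := hQ.exists_mul_norm_sq_le
  obtain ⟨ρ, hρ, hR'⟩ := hR.exists_mul_norm_sq_le
  obtain ⟨σ, hσ, hφ⟩ := 𝒮.exists_isCoerciveFunctional hbdd hSigma
  -- An output feedback is controlled by the output, whose weight `Q` is positive definite.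
  have hGs : ∀ x, ‖𝒮.feedback Ks x‖ ^ 2
      ≤ ‖matrixCLM Ks.mat‖ ^ 2 / q * inner ℝ x (𝒮.outputWeight x) := by
    intro x
    have e : 𝒮.feedback Ks x = matrixCLM Ks.mat (matrixCLM 𝒮.C x) := by
      ext i
      rw [ofLp_feedback, ofLp_matrixCLM, ofLp_matrixCLM]
    have h1 := hQ' (matrixCLM 𝒮.C x)
    rw [← inner_outputWeight] at h1
    calc ‖𝒮.feedback Ks x‖ ^ 2 ≤ (‖matrixCLM Ks.mat‖ * ‖matrixCLM 𝒮.C x‖) ^ 2 := by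
          rw [e]; gcongr; exact ContinuousLinearMap.le_opNorm _ _
      _ = ‖matrixCLM Ks.mat‖ ^ 2 / q * (q * ‖matrixCLM 𝒮.C x‖ ^ 2) := by field_simp
      _ ≤ _ := by gcongr
  obtain ⟨β, t₀, ht₀, h⟩ := exists_bounds_of_lqrValue_le hφ hσ (𝒮.inner_outputWeight_nonneg hQ) hρ hR'
    hκs hs (by positivity) hGs a
  refine ⟨β, t₀, ht₀, fun K hK => h _ (𝒮.mem_stabilizing_iff_exists_expDecay.1 hK.1) ?_⟩
  rw [← 𝒮.cost_eq_lqrValue hbdd hK.1]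
  exact hK.2

/-- First order expansion of the cost with a remainder that is uniform over a sublevel set, together
with uniform decay of the perturbed closed loops. -/
theorem exists_expansion_on_sublevel (hQ : 𝒮.Q.PosDef) (hR : 𝒮.R.PosDef)
    (hSigma : 𝒮.initialSecondMoment.PosDef) {P : ℝ} (hbdd : ∀ᵐ x ∂𝒮.𝒟, ‖x‖ ≤ P) (a : ℝ) :
    ∃ ρ > (0 : ℝ), ∃ c > (0 : ℝ), ∃ κ > (0 : ℝ), ∃ H > (0 : ℝ), ∃ ω > (0 : ℝ),
      ∀ K ∈ 𝒮.sublevel a, HasGradientAt 𝒮.cost (gradient 𝒮.cost K) K ∧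
        ∀ V : Gain m p, ‖V‖ ≤ ρ →
          ExpDecay c κ (𝒮.loop (K + V)) ∧ ‖𝒮.weight (K + V)‖ ≤ ω ∧
          |𝒮.cost (K + V) - 𝒮.cost K - inner ℝ (gradient 𝒮.cost K) V| ≤ H * ‖V‖ ^ 2 := by
  obtain ⟨β, t₀, ht₀, hb⟩ := 𝒮.exists_bounds_on_sublevel hQ hR hSigma hbdd a
  set φ := meanForm 𝒮.𝒟 hbdd with hφ
  set A := Matrix.toEuclideanCLM (𝕜 := ℝ) 𝒮.A with hA
  set R := Matrix.toEuclideanCLM (𝕜 := ℝ) 𝒮.R with hRop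
  obtain ⟨ρ, hρ, c, hc, κ, hκ, H, hH, h⟩ := exists_abs_lqrValue_sub_le φ A
    (matrixCLM 𝒮.B) 𝒮.outputWeight R β ht₀
  set k : ℝ := 1 + ‖𝒮.feedback‖ with hk
  have hk0 : 0 < k := by positivity
  refine ⟨ρ / k, by positivity, c, hc, κ, hκ, H * k ^ 2, by positivity,
    ‖𝒮.outputWeight‖ + (|β| + ρ) ^ 2 * ‖R‖ + 1, by positivity, fun K hK => ?_⟩
  obtain ⟨hb1, hb2⟩ := hb K hK
  have hfb : ∀ V : Gain m p, ‖𝒮.feedback V‖ ≤ k * ‖V‖ := fun V =>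
    (𝒮.feedback.le_opNorm V).trans (by gcongr; rw [hk]; linarith)
  have hfρ : ∀ V : Gain m p, ‖V‖ ≤ ρ / k → ‖𝒮.feedback V‖ ≤ ρ := fun V hV => by
    refine (hfb V).trans ?_
    rw [le_div_iff₀ hk0] at hV
    linarith
  have hdK : ExpDecay c κ (𝒮.loop K) := by
    have := (h _ hb1 hb2 0 (by simpa using hρ.le)).1
    rwa [add_zero] at this
  -- The first variation is linear in the direction.
  let ℓ : Gain m p →ₗ[ℝ] ℝ :=
    { toFun := fun V => φ (lyap (𝒮.loop K)
        (variationWeight A (matrixCLM 𝒮.B) 𝒮.outputWeight R (𝒮.feedback K) (𝒮.feedback V)))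
      map_add' := fun V V' => by
        rw [← map_add, ← lyap_add hκ hdK]
        congr 2
        ext x i
        simp [variationWeight]
        ring
      map_smul' := fun r V => by
        rw [RingHom.id_apply, ← map_smul, ← lyap_smul]
        congr 2
        ext x i
        simp [variationWeight]
        ring }
  have hdec : ∀ V : Gain m p, ‖V‖ ≤ ρ / k → ExpDecay c κ (𝒮.loop (K + V)) := fun V hV => by
    have := (h _ hb1 hb2 _ (hfρ V hV)).1
    rwa [← map_add] at this
  have hexp : ∀ V : Gain m p, ‖V‖ ≤ ρ / k →
      |𝒮.cost (K + V) - 𝒮.cost K - ℓ V| ≤ H * k ^ 2 * ‖V‖ ^ 2 := by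
    intro V hV
    have h1 := (h _ hb1 hb2 _ (hfρ V hV)).2
    have hst : K + V ∈ 𝒮.stabilizing :=
      𝒮.mem_stabilizing_iff_exists_expDecay.2 ⟨c, κ, hκ, hdec V hV⟩
    rw [← map_add, ← 𝒮.cost_eq_lqrValue hbdd hst, ← 𝒮.cost_eq_lqrValue hbdd hK.1] at h1
    refine h1.trans ?_
    calc H * ‖𝒮.feedback V‖ ^ 2 ≤ H * (k * ‖V‖) ^ 2 := by gcongr; exact hfb V
      _ = _ := by ring
  have hfd : HasFDerivAt 𝒮.cost (LinearMap.toContinuousLinearMap ℓ) K :=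
    hasFDerivAt_of_abs_sub_le_mul_sq (div_pos hρ hk0) (by positivity) hexp
  have hgrad := hasFDerivAt_iff_hasGradientAt.1 hfd
  have hin : ∀ V, inner ℝ (gradient 𝒮.cost K) V = ℓ V := fun V => by
    rw [hgrad.gradient, InnerProductSpace.toDual_symm_apply]
    rfl
  refine ⟨by rw [hgrad.gradient]; exact hgrad, fun V hV => ⟨hdec V hV, ?_, ?_⟩⟩
  · have h1 : ‖𝒮.feedback (K + V)‖ ≤ |β| + ρ := by
      rw [map_add]
      exact (norm_add_le _ _).trans (add_le_add (hb1.trans (le_abs_self β)) (hfρ V hV))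
    have h2 : ‖adjoint (𝒮.feedback (K + V)) ∘L R ∘L 𝒮.feedback (K + V)‖
        ≤ ‖𝒮.feedback (K + V)‖ * (‖R‖ * ‖𝒮.feedback (K + V)‖) := by
      refine (ContinuousLinearMap.opNorm_comp_le _ _).trans ?_
      rw [LinearIsometryEquiv.norm_map]
      gcongr
      exact ContinuousLinearMap.opNorm_comp_le _ _
    have h3 : ‖𝒮.feedback (K + V)‖ * (‖R‖ * ‖𝒮.feedback (K + V)‖) ≤ (|β| + ρ) ^ 2 * ‖R‖ := by
      calc _ = ‖𝒮.feedback (K + V)‖ ^ 2 * ‖R‖ := by ring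
        _ ≤ _ := by gcongr
    refine (norm_add_le _ _).trans ?_
    linarith
  · rw [hin]
    exact hexp V hV

theorem isOpen_stabilizing (hQ : 𝒮.Q.PosDef) (hR : 𝒮.R.PosDef)
    (hSigma : 𝒮.initialSecondMoment.PosDef) {P : ℝ} (hbdd : ∀ᵐ x ∂𝒮.𝒟, ‖x‖ ≤ P) :
    IsOpen 𝒮.stabilizing := by
  rw [Metric.isOpen_iff]
  intro K hK
  obtain ⟨ρ, hρ, c, hc, κ, hκ, H, hH, ω, hω, h⟩ :=
    𝒮.exists_expansion_on_sublevel hQ hR hSigma hbdd (𝒮.cost K)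
  refine ⟨ρ, hρ, fun K' hK' => ?_⟩
  rw [Metric.mem_ball, dist_eq_norm] at hK'
  have := ((h K (𝒮.mem_sublevel_cost hK)).2 (K' - K) hK'.le).1
  rw [add_sub_cancel] at this
  exact 𝒮.mem_stabilizing_iff_exists_expDecay.2 ⟨c, κ, hκ, this⟩

theorem hasGradientAt_cost (hQ : 𝒮.Q.PosDef) (hR : 𝒮.R.PosDef)
    (hSigma : 𝒮.initialSecondMoment.PosDef) {P : ℝ} (hbdd : ∀ᵐ x ∂𝒮.𝒟, ‖x‖ ≤ P)
    {K : Gain m p} (hK : K ∈ 𝒮.stabilizing) :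
    HasGradientAt 𝒮.cost (gradient 𝒮.cost K) K := by
  obtain ⟨ρ, hρ, c, hc, κ, hκ, H, hH, ω, hω, h⟩ :=
    𝒮.exists_expansion_on_sublevel hQ hR hSigma hbdd (𝒮.cost K)
  exact (h K (𝒮.mem_sublevel_cost hK)).1

/-- The sublevel sets are closed: the common contraction time passes to limits. -/
theorem isClosed_sublevel (hQ : 𝒮.Q.PosDef) (hR : 𝒮.R.PosDef)
    (hSigma : 𝒮.initialSecondMoment.PosDef) {P : ℝ} (hbdd : ∀ᵐ x ∂𝒮.𝒟, ‖x‖ ≤ P) (a : ℝ) :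
    IsClosed (𝒮.sublevel a) := by
  obtain ⟨β, t₀, ht₀, hb⟩ := 𝒮.exists_bounds_on_sublevel hQ hR hSigma hbdd a
  set Z : Set (Gain m p) := {K | ‖exp (t₀ • 𝒮.loop K)‖ ≤ 1 / 2} with hZ
  have hexp : Continuous
      fun M : EuclideanSpace ℝ (Fin n) →L[ℝ] EuclideanSpace ℝ (Fin n) => exp M := by
    let _ : NormedAlgebra ℚ (EuclideanSpace ℝ (Fin n) →L[ℝ] EuclideanSpace ℝ (Fin n)) :=
      NormedAlgebra.restrictScalars ℚ ℝ _
    exact exp_continuous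
  have hZc : IsClosed Z :=
    isClosed_le (hexp.comp (𝒮.continuous_loop.const_smul t₀)).norm continuous_const
  have hZs : Z ⊆ 𝒮.stabilizing := fun K hK =>
    𝒮.mem_stabilizing_iff_exists_norm_exp_le.2 ⟨t₀, ht₀, hK⟩
  have hcont : ContinuousOn 𝒮.cost Z := fun K hK =>
    (𝒮.hasGradientAt_cost hQ hR hSigma hbdd (hZs hK)).continuousAt.continuousWithinAt
  have := hcont.preimage_isClosed_of_isClosed hZc (isClosed_Iic (a := a))
  convert this using 1
  ext K
  exact ⟨fun hK => ⟨(hb K hK).2, hK.2⟩, fun hK => ⟨hZs hK.1, hK.2⟩⟩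

end OutputFeedbackLQR

end Sublevel

/-! ### Moments of the uniform distribution on a sphere -/

section UniformSphere

set_option linter.unusedSectionVars false

open Set
open scoped Pointwise

/-- The surface measure of the unit sphere is invariant under linear isometries. -/
theorem measurePreserving_toSphere {E : Type*} [NormedAddCommGroup E] [InnerProductSpace ℝ E]
    [FiniteDimensional ℝ E] [MeasurableSpace E] [BorelSpace E] (g : E ≃ₗᵢ[ℝ] E)
    (gs : Metric.sphere (0 : E) 1 → Metric.sphere (0 : E) 1) (hgs : ∀ u, (gs u : E) = g u) :
    MeasurePreserving gs (volume : Measure E).toSphere (volume : Measure E).toSphere := by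
  have hm : Measurable gs := by
    refine (continuous_induced_rng.2 ?_).measurable
    rw [show Subtype.val ∘ gs = fun u : Metric.sphere (0 : E) 1 => g u from funext hgs]
    exact g.continuous.comp continuous_subtype_val
  refine ⟨hm, Measure.ext fun s hs => ?_⟩
  rw [Measure.map_apply hm hs, Measure.toSphere_apply' _ (hm hs), Measure.toSphere_apply' _ hs]
  congr 1
  have e : Ioo (0 : ℝ) 1 • ((↑) '' (gs ⁻¹' s) : Set E) = g ⁻¹' (Ioo (0 : ℝ) 1 • ((↑) '' s)) := by
    ext x
    simp only [Set.mem_smul, Set.mem_image, Set.mem_preimage]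
    constructor
    · rintro ⟨r, hr, _, ⟨u, hu, rfl⟩, rfl⟩
      exact ⟨r, hr, _, ⟨gs u, hu, rfl⟩, by rw [map_smul, hgs]⟩
    · rintro ⟨r, hr, _, ⟨v, hv, rfl⟩, hx⟩
      have hv' : ‖g.symm v‖ = 1 := by
        rw [LinearIsometryEquiv.norm_map]; exact mem_sphere_zero_iff_norm.1 v.2
      refine ⟨r, hr, _, ⟨⟨g.symm v, mem_sphere_zero_iff_norm.2 hv'⟩, ?_, rfl⟩, ?_⟩
      · have : gs ⟨g.symm v, mem_sphere_zero_iff_norm.2 hv'⟩ = v := by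
          apply Subtype.ext
          rw [hgs]
          exact g.apply_symm_apply _
        rwa [this]
      · apply g.injective
        rw [map_smul, g.apply_symm_apply, hx]
  rw [e]
  exact g.measurePreserving.measure_preimage_emb g.toHomeomorph.measurableEmbedding _

variable {m p : ℕ}

theorem map_uniformSphere (g : Gain m p ≃ₗᵢ[ℝ] Gain m p) :
    (uniformSphere m p).map g = uniformSphere m p := by
  let gs : Metric.sphere (0 : Gain m p) 1 → Metric.sphere (0 : Gain m p) 1 := fun u =>
    ⟨g u, mem_sphere_zero_iff_norm.2 (by
      rw [LinearIsometryEquiv.norm_map]; exact mem_sphere_zero_iff_norm.1 u.2)⟩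
  have hp := measurePreserving_toSphere g gs fun u => rfl
  have hf : Measurable fun u : Metric.sphere (0 : Gain m p) 1 =>
      Real.sqrt ((m : ℝ) * p) • (u : Gain m p) := by fun_prop
  rw [uniformSphere, Measure.map_map g.continuous.measurable hf]
  have h : (((volume : Measure (Gain m p)).toSphere univ)⁻¹ •
      (volume : Measure (Gain m p)).toSphere).map gs
      = ((volume : Measure (Gain m p)).toSphere univ)⁻¹ •
        (volume : Measure (Gain m p)).toSphere := by
    rw [Measure.map_smul, hp.map_eq]
  conv_rhs => rw [← h, Measure.map_map hf hp.measurable]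
  congr 1
  funext u
  simp [gs]

theorem integral_comp_uniformSphere (g : Gain m p ≃ₗᵢ[ℝ] Gain m p) (F : Gain m p → ℝ) :
    ∫ u, F (g u) ∂uniformSphere m p = ∫ u, F u ∂uniformSphere m p := by
  conv_rhs => rw [← map_uniformSphere g]
  exact (g.toHomeomorph.measurableEmbedding.integral_map F).symm

theorem ae_norm_uniformSphere :
    ∀ᵐ u ∂uniformSphere m p, ‖u‖ = Real.sqrt ((m : ℝ) * p) := by
  have hf : Measurable fun u : Metric.sphere (0 : Gain m p) 1 =>
      Real.sqrt ((m : ℝ) * p) • (u : Gain m p) := by fun_prop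
  rw [uniformSphere, ae_map_iff hf.aemeasurable (measurableSet_eq_fun (by fun_prop) (by fun_prop))]
  refine Filter.Eventually.of_forall fun u => ?_
  rw [norm_smul, mem_sphere_zero_iff_norm.1 u.2, mul_one, Real.norm_of_nonneg (Real.sqrt_nonneg _)]

variable [NeZero m] [NeZero p]

theorem integrable_apply_uniformSphere (s : Fin m × Fin p) :
    Integrable (fun u : Gain m p => u s) (uniformSphere m p) := by
  refine Integrable.of_bound (C := Real.sqrt ((m : ℝ) * p)) (by fun_prop) ?_
  filter_upwards [ae_norm_uniformSphere] with u hu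
  rw [← hu]
  exact PiLp.norm_apply_le u s

theorem integrable_mul_uniformSphere (s s' : Fin m × Fin p) :
    Integrable (fun u : Gain m p => u s * u s') (uniformSphere m p) := by
  refine Integrable.of_bound (C := (Real.sqrt ((m : ℝ) * p)) ^ 2) (by fun_prop) ?_
  filter_upwards [ae_norm_uniformSphere] with u hu
  rw [← hu, norm_mul, sq]
  gcongr
  · exact PiLp.norm_apply_le u s
  · exact PiLp.norm_apply_le u s'

theorem integral_apply_uniformSphere (s : Fin m × Fin p) :
    ∫ u : Gain m p, u s ∂uniformSphere m p = 0 := by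
  have h := integral_comp_uniformSphere (LinearIsometryEquiv.neg ℝ) fun u : Gain m p => u s
  simp only [LinearIsometryEquiv.coe_neg, PiLp.neg_apply, integral_neg] at h
  linarith

/-- Reflection in one coordinate shows that distinct coordinates are uncorrelated. -/
theorem integral_mul_uniformSphere_of_ne {s s' : Fin m × Fin p} (hne : s ≠ s') :
    ∫ u : Gain m p, u s * u s' ∂uniformSphere m p = 0 := by
  have h := integral_comp_uniformSphere (LinearIsometryEquiv.piLpCongrRight 2
    fun i : Fin m × Fin p => if i = s then LinearIsometryEquiv.neg ℝ
      else LinearIsometryEquiv.refl ℝ ℝ) fun u : Gain m p => u s * u s'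
  simp only [LinearIsometryEquiv.piLpCongrRight_apply, if_neg hne.symm, if_true,
    LinearIsometryEquiv.coe_neg, LinearIsometryEquiv.coe_refl, id_eq, neg_mul, integral_neg] at h
  linarith

/-- The coordinates are exchangeable and their squares add up to `mp`. -/
theorem integral_sq_uniformSphere (s : Fin m × Fin p) :
    ∫ u : Gain m p, u s * u s ∂uniformSphere m p = 1 := by
  have heq : ∀ s' : Fin m × Fin p, ∫ u : Gain m p, u s' * u s' ∂uniformSphere m p
      = ∫ u : Gain m p, u s * u s ∂uniformSphere m p := by
    intro s'
    have h := integral_comp_uniformSphere (LinearIsometryEquiv.piLpCongrLeft 2 ℝ ℝ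
      (Equiv.swap s s')) fun u : Gain m p => u s * u s
    rw [← h]
    simp [LinearIsometryEquiv.piLpCongrLeft_apply, Equiv.piCongrLeft'_apply]
  have hsum : ∫ u : Gain m p, ∑ s', u s' * u s' ∂uniformSphere m p = (m : ℝ) * p := by
    have : ∀ᵐ u : Gain m p ∂uniformSphere m p, ∑ s', u s' * u s' = (m : ℝ) * p := by
      filter_upwards [ae_norm_uniformSphere] with u hu
      have h1 := EuclideanSpace.real_norm_sq_eq u
      rw [hu, Real.sq_sqrt (by positivity)] at h1
      rw [h1]
      exact Finset.sum_congr rfl fun i _ => (sq _).symm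
    rw [integral_congr_ae this]
    simp
  rw [integral_finsetSum _ fun i _ => integrable_mul_uniformSphere i i] at hsum
  simp only [heq, Finset.sum_const, Finset.card_univ, Fintype.card_prod, Fintype.card_fin,
    nsmul_eq_mul, Nat.cast_mul] at hsum
  have hpos : (0 : ℝ) < m * p := by
    have := NeZero.pos m
    have := NeZero.pos p
    positivity
  exact mul_left_cancel₀ hpos.ne' (by rw [hsum, mul_one])

/-- The uniform distribution on the sphere of radius `√(mp)` is isotropic. -/
theorem integral_inner_mul_uniformSphere (g : Gain m p) (s : Fin m × Fin p) :
    ∫ u : Gain m p, inner ℝ g u * u s ∂uniformSphere m p = g s := by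
  have e : ∀ u : Gain m p, inner ℝ g u * u s = ∑ i, g i * (u i * u s) := by
    intro u
    rw [PiLp.inner_apply, Finset.sum_mul]
    refine Finset.sum_congr rfl fun i _ => ?_
    simp only [RCLike.inner_apply, conj_trivial]
    ring
  simp_rw [e]
  rw [integral_finsetSum _ fun i _ => (integrable_mul_uniformSphere i s).const_mul _]
  simp_rw [integral_const_mul]
  rw [Finset.sum_eq_single s]
  · rw [integral_sq_uniformSphere, mul_one]
  · intro i _ hi
    rw [integral_mul_uniformSphere_of_ne hi, mul_zero]
  · simp

end UniformSphere

/-! ### Concentration of the gradient estimate at a fixed gain -/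

section Concentration

set_option linter.unusedSectionVars false

open Filter Topology Set

/-- Two-sided Hoeffding inequality for independent, almost surely bounded variables with common
mean. -/
theorem measureReal_le_abs_sum_sub_le {W ι : Type*} [MeasurableSpace W] [Fintype ι] {μ : Measure W}
    [IsProbabilityMeasure μ] {Z : ι → W → ℝ} (hm : ∀ i, AEMeasurable (Z i) μ)
    (hind : iIndepFun Z μ) {b z : ℝ} (hb0 : 0 ≤ b) (hb : ∀ i, ∀ᵐ w ∂μ, |Z i w| ≤ b)
    (hz : ∀ i, ∫ w, Z i w ∂μ = z) {ε : ℝ} (hε : 0 ≤ ε) :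
    μ.real {w | ε ≤ |∑ i, (Z i w - z)|}
      ≤ 2 * Real.exp (-ε ^ 2 / (2 * (Fintype.card ι * b ^ 2))) := by
  have hsg : ∀ i, HasSubgaussianMGF (fun w => Z i w - z) ((‖b - -b‖₊ / 2) ^ 2) μ := by
    intro i
    have := hasSubgaussianMGF_of_mem_Icc (hm i) (a := -b) (b := b)
      (by filter_upwards [hb i] with w hw; exact abs_le.1 hw)
    rwa [hz i] at this
  have hsum : ((∑ _i : ι, (‖b - -b‖₊ / 2) ^ 2 : NNReal) : ℝ) = Fintype.card ι * b ^ 2 := by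
    have : ((‖b - -b‖₊ : NNReal) : ℝ) = 2 * b := by
      rw [coe_nnnorm, Real.norm_of_nonneg (by linarith)]; ring
    simp only [Finset.sum_const, Finset.card_univ, nsmul_eq_mul, NNReal.coe_mul,
      NNReal.coe_natCast, NNReal.coe_pow, NNReal.coe_div, this]
    norm_num
  have hind1 : iIndepFun (fun i w => Z i w - z) μ :=
    hind.comp (fun _ y => y - z) fun _ => measurable_id.sub_const z
  have hind2 : iIndepFun (fun i w => -(Z i w - z)) μ :=
    hind.comp (fun _ y => -(y - z)) fun _ => (measurable_id.sub_const z).neg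
  have h1 := HasSubgaussianMGF.measure_sum_ge_le_of_iIndepFun hind1 (s := Finset.univ)
    (fun i _ => hsg i) hε
  have h2 := HasSubgaussianMGF.measure_sum_ge_le_of_iIndepFun hind2 (s := Finset.univ)
    (fun i _ => (hsg i).neg) hε
  rw [hsum] at h1 h2
  have hsub : {w | ε ≤ |∑ i, (Z i w - z)|}
      ⊆ {w | ε ≤ ∑ i, (Z i w - z)} ∪ {w | ε ≤ ∑ i, -(Z i w - z)} := by
    intro w hw
    rcases le_abs.1 (show ε ≤ |∑ i, (Z i w - z)| from hw) with h | h
    · exact Or.inl h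
    · refine Or.inr ?_
      rw [Set.mem_ofPred_eq, Finset.sum_neg_distrib]
      exact h
  refine (measureReal_mono hsub).trans ((measureReal_union_le _ _).trans ?_)
  linarith

theorem norm_le_sum_abs {ι : Type*} [Fintype ι] (v : EuclideanSpace ℝ ι) : ‖v‖ ≤ ∑ s, |v s| := by
  rw [EuclideanSpace.norm_eq]
  refine Real.sqrt_le_iff.2 ⟨Finset.sum_nonneg fun _ _ => abs_nonneg _, ?_⟩
  simp only [Real.norm_eq_abs]
  exact Finset.sum_sq_le_sq_sum_of_nonneg fun _ _ => abs_nonneg _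

namespace OutputFeedbackLQR

variable {n m p : ℕ} (𝒮 : OutputFeedbackLQR n m p)

/-- Around the gain `K`, within radius `ρ`, the closed loops decay with constants `c` and `κ`, the
weights of the stage cost are at most `ω`, and the cost has a first order expansion with remainder
`H ‖V‖²`. -/
structure ExpansionAt (ρ c κ H ω : ℝ) (K : Gain m p) : Prop where
  decay : ∀ V : Gain m p, ‖V‖ ≤ ρ → ExpDecay c κ (𝒮.loop (K + V))
  weight_le : ∀ V : Gain m p, ‖V‖ ≤ ρ → ‖𝒮.weight (K + V)‖ ≤ ω
  expansion : ∀ V : Gain m p, ‖V‖ ≤ ρ →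
    |𝒮.cost (K + V) - 𝒮.cost K - inner ℝ (gradient 𝒮.cost K) V| ≤ H * ‖V‖ ^ 2

variable {𝒮} {ρ c κ H ω : ℝ} {K : Gain m p}

theorem ExpansionAt.abs_truncatedCost_le (h : 𝒮.ExpansionAt ρ c κ H ω K) (hκ : 0 < κ) {P : ℝ}
    {V : Gain m p} (hV : ‖V‖ ≤ ρ) {τ : ℝ} (hτ : 0 ≤ τ) {x : EuclideanSpace ℝ (Fin n)}
    (hx : ‖x‖ ≤ P) : |𝒮.truncatedCost (K + V) τ x| ≤ c ^ 2 * ω * P ^ 2 / κ := by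
  refine (𝒮.abs_truncatedCost_le hκ (h.decay V hV) x hτ).trans ?_
  have := h.weight_le V hV
  have := (norm_nonneg _).trans this
  gcongr

theorem ExpansionAt.abs_integral_truncatedCost_sub_le [IsProbabilityMeasure 𝒮.𝒟]
    (h : 𝒮.ExpansionAt ρ c κ H ω K) (hκ : 0 < κ) {P : ℝ} (hbdd : ∀ᵐ x ∂𝒮.𝒟, ‖x‖ ≤ P)
    {V : Gain m p} (hV : ‖V‖ ≤ ρ) {τ : ℝ} (hτ : 0 ≤ τ) :
    |∫ x, 𝒮.truncatedCost (K + V) τ x ∂𝒮.𝒟 - 𝒮.cost (K + V)|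
      ≤ c ^ 2 * ω * P ^ 2 / (2 * κ) * Real.exp (-(2 * κ) * τ) := by
  have hi : Integrable (fun x => 𝒮.truncatedCost (K + V) τ x) 𝒮.𝒟 := by
    refine Integrable.of_bound (C := c ^ 2 * ω * P ^ 2 / κ) ?_ ?_
    · exact ((𝒮.continuous_truncatedCost τ).comp
        (continuous_const.prodMk continuous_id)).aestronglyMeasurable
    · filter_upwards [hbdd] with x hx
      exact h.abs_truncatedCost_le hκ hV hτ hx
  have hb : ∀ᵐ x ∂𝒮.𝒟, ‖inner ℝ x (lyap (𝒮.loop (K + V)) (𝒮.weight (K + V)) x)‖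
      ≤ P ^ 2 * ‖lyap (𝒮.loop (K + V)) (𝒮.weight (K + V))‖ := by
    filter_upwards [hbdd] with x hx
    calc _ ≤ ‖x‖ * (‖lyap (𝒮.loop (K + V)) (𝒮.weight (K + V))‖ * ‖x‖) :=
          (norm_inner_le_norm _ _).trans (by gcongr; exact ContinuousLinearMap.le_opNorm _ _)
      _ = ‖x‖ ^ 2 * ‖lyap (𝒮.loop (K + V)) (𝒮.weight (K + V))‖ := by ring
      _ ≤ _ := by gcongr
  have hi' : Integrable
      (fun x => inner ℝ x (lyap (𝒮.loop (K + V)) (𝒮.weight (K + V)) x)) 𝒮.𝒟 :=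
    Integrable.of_bound (continuous_id.inner
      (ContinuousLinearMap.continuous _)).aestronglyMeasurable _ hb
  have hc : 𝒮.cost (K + V)
      = ∫ x, inner ℝ x (lyap (𝒮.loop (K + V)) (𝒮.weight (K + V)) x) ∂𝒮.𝒟 :=
    integral_congr_ae (Eventually.of_forall fun x =>
      (𝒮.integral_stageCost hκ (h.decay V hV) x).2)
  rw [hc, ← integral_sub hi hi', ← Real.norm_eq_abs]
  have hle : ∀ᵐ x ∂𝒮.𝒟, ‖𝒮.truncatedCost (K + V) τ x
      - inner ℝ x (lyap (𝒮.loop (K + V)) (𝒮.weight (K + V)) x)‖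
      ≤ c ^ 2 * ω * P ^ 2 / (2 * κ) * Real.exp (-(2 * κ) * τ) := by
    filter_upwards [hbdd] with x hx
    refine (𝒮.abs_truncatedCost_sub_le hκ (h.decay V hV) x hτ).trans ?_
    have := h.weight_le V hV
    have := (norm_nonneg _).trans this
    gcongr
  simpa using norm_integral_le_of_norm_le_const hle

/-- The summand `c U_s` of a coordinate of the (unnormalised) gradient estimate. -/
noncomputable def estimatorTerm (𝒮 : OutputFeedbackLQR n m p) (r τ : ℝ) (K : Gain m p)
    (s : Fin m × Fin p) (q : Gain m p × EuclideanSpace ℝ (Fin n)) : ℝ :=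
  𝒮.truncatedCost (K + r • q.1) τ q.2 * q.1 s

theorem continuous_estimatorTerm (𝒮 : OutputFeedbackLQR n m p) (r τ : ℝ) (K : Gain m p)
    (s : Fin m × Fin p) : Continuous (𝒮.estimatorTerm r τ K s) := by
  refine Continuous.mul ?_ (by fun_prop)
  exact (𝒮.continuous_truncatedCost τ).comp (f := fun q : Gain m p × EuclideanSpace ℝ (Fin n) =>
    (K + r • q.1, q.2)) (by fun_prop)

variable [NeZero m] [NeZero p] [IsProbabilityMeasure 𝒮.𝒟]

theorem norm_smul_le_of_uniformSphere {r : ℝ} (hr : 0 ≤ r) {u : Gain m p}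
    (hu : ‖u‖ = Real.sqrt ((m : ℝ) * p)) (hrρ : r * Real.sqrt ((m : ℝ) * p) ≤ ρ) :
    ‖r • u‖ ≤ ρ := by
  rwa [norm_smul, hu, Real.norm_of_nonneg hr]

theorem ExpansionAt.ae_abs_estimatorTerm_le (h : 𝒮.ExpansionAt ρ c κ H ω K) (hκ : 0 < κ) {P : ℝ}
    (hbdd : ∀ᵐ x ∂𝒮.𝒟, ‖x‖ ≤ P) {r τ : ℝ} (hr : 0 ≤ r)
    (hrρ : r * Real.sqrt ((m : ℝ) * p) ≤ ρ) (hτ : 0 ≤ τ) (s : Fin m × Fin p) :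
    ∀ᵐ q ∂(uniformSphere m p).prod 𝒮.𝒟, |𝒮.estimatorTerm r τ K s q|
      ≤ c ^ 2 * ω * P ^ 2 / κ * Real.sqrt ((m : ℝ) * p) := by
  have h1 := (Measure.quasiMeasurePreserving_fst (μ := uniformSphere m p) (ν := 𝒮.𝒟)).ae
    ae_norm_uniformSphere
  have h2 := (Measure.quasiMeasurePreserving_snd (μ := uniformSphere m p) (ν := 𝒮.𝒟)).ae hbdd
  filter_upwards [h1, h2] with q hq1 hq2
  rw [estimatorTerm, abs_mul]
  have h3 := h.abs_truncatedCost_le hκ (norm_smul_le_of_uniformSphere hr hq1 hrρ) hτ hq2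
  have h4 : |q.1 s| ≤ Real.sqrt ((m : ℝ) * p) := by
    rw [← hq1]; exact PiLp.norm_apply_le q.1 s
  have := (abs_nonneg _).trans h3
  gcongr

/-- The bias of the gradient estimate: isotropy of the perturbations turns the first order expansion
of the cost into its gradient. -/
theorem ExpansionAt.abs_integral_estimatorTerm_sub_le (h : 𝒮.ExpansionAt ρ c κ H ω K) (hκ : 0 < κ)
    {P : ℝ} (hbdd : ∀ᵐ x ∂𝒮.𝒟, ‖x‖ ≤ P) {r τ : ℝ} (hr : 0 ≤ r)
    (hrρ : r * Real.sqrt ((m : ℝ) * p) ≤ ρ) (hτ : 0 ≤ τ) (s : Fin m × Fin p) :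
    |∫ q, 𝒮.estimatorTerm r τ K s q ∂(uniformSphere m p).prod 𝒮.𝒟 - r * gradient 𝒮.cost K s|
      ≤ (c ^ 2 * ω * P ^ 2 / (2 * κ) * Real.exp (-(2 * κ) * τ) + H * (r ^ 2 * (m * p)))
        * Real.sqrt ((m : ℝ) * p) := by
  set g := gradient 𝒮.cost K with hg
  set ν := uniformSphere m p with hν
  have hint : Integrable (𝒮.estimatorTerm r τ K s) (ν.prod 𝒮.𝒟) :=
    Integrable.of_bound (𝒮.continuous_estimatorTerm r τ K s).aestronglyMeasurable _
      (h.ae_abs_estimatorTerm_le hκ hbdd hr hrρ hτ s)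
  have hint1 := hint.integral_prod_left
  have e0 : ∀ u : Gain m p, ∫ x, 𝒮.estimatorTerm r τ K s (u, x) ∂𝒮.𝒟
      = (∫ x, 𝒮.truncatedCost (K + r • u) τ x ∂𝒮.𝒟) * u s := fun u => by
    simp only [estimatorTerm]
    rw [integral_mul_const]
  have hg1 : Integrable (fun u : Gain m p => inner ℝ g u * u s) ν := by
    refine Integrable.of_bound (C := ‖g‖ * Real.sqrt ((m : ℝ) * p) * Real.sqrt ((m : ℝ) * p))
      (by fun_prop) ?_
    filter_upwards [ae_norm_uniformSphere] with u hu
    rw [norm_mul]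
    gcongr
    · rw [← hu]; exact norm_inner_le_norm _ _
    · rw [← hu]; exact PiLp.norm_apply_le u s
  have hg2 := integrable_apply_uniformSphere (m := m) (p := p) s
  have e1 : ∫ q, 𝒮.estimatorTerm r τ K s q ∂ν.prod 𝒮.𝒟 - r * g s
      = ∫ u, (∫ x, 𝒮.truncatedCost (K + r • u) τ x ∂𝒮.𝒟 - 𝒮.cost K - inner ℝ g (r • u)) * u s ∂ν := by
    rw [integral_prod _ hint]
    simp only [e0] at hint1 ⊢
    have e2 : ∀ u : Gain m p,
        (∫ x, 𝒮.truncatedCost (K + r • u) τ x ∂𝒮.𝒟 - 𝒮.cost K - inner ℝ g (r • u)) * u s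
        = (∫ x, 𝒮.truncatedCost (K + r • u) τ x ∂𝒮.𝒟) * u s - 𝒮.cost K * u s
          - r * (inner ℝ g u * u s) := by
      intro u; rw [real_inner_smul_right]; ring
    have hint2 : Integrable (fun u : Gain m p =>
        (∫ x, 𝒮.truncatedCost (K + r • u) τ x ∂𝒮.𝒟) * u s - 𝒮.cost K * u s) ν :=
      hint1.sub (hg2.const_mul _)
    simp_rw [e2]
    rw [integral_sub hint2 (hg1.const_mul _),
      integral_sub hint1 (hg2.const_mul _), integral_const_mul, integral_const_mul,
      integral_apply_uniformSphere, integral_inner_mul_uniformSphere, mul_zero, sub_zero]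
  rw [e1, ← Real.norm_eq_abs]
  have hle : ∀ᵐ u ∂ν,
      ‖(∫ x, 𝒮.truncatedCost (K + r • u) τ x ∂𝒮.𝒟 - 𝒮.cost K - inner ℝ g (r • u)) * u s‖
      ≤ (c ^ 2 * ω * P ^ 2 / (2 * κ) * Real.exp (-(2 * κ) * τ) + H * (r ^ 2 * (m * p)))
        * Real.sqrt ((m : ℝ) * p) := by
    filter_upwards [ae_norm_uniformSphere] with u hu
    have hV := norm_smul_le_of_uniformSphere hr hu hrρ
    have f1 := h.abs_integral_truncatedCost_sub_le hκ hbdd hV hτ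
    have f2 := h.expansion _ hV
    have f3 : ‖r • u‖ ^ 2 = r ^ 2 * (m * p) := by
      rw [norm_smul, mul_pow, hu, Real.sq_sqrt (by positivity), Real.norm_eq_abs, sq_abs]
    rw [f3] at f2
    rw [norm_mul]
    have f4 : ‖u s‖ ≤ Real.sqrt ((m : ℝ) * p) := by rw [← hu]; exact PiLp.norm_apply_le u s
    have f5 : ‖∫ x, 𝒮.truncatedCost (K + r • u) τ x ∂𝒮.𝒟 - 𝒮.cost K - inner ℝ g (r • u)‖
        ≤ c ^ 2 * ω * P ^ 2 / (2 * κ) * Real.exp (-(2 * κ) * τ) + H * (r ^ 2 * (m * p)) := by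
      have : ∫ x, 𝒮.truncatedCost (K + r • u) τ x ∂𝒮.𝒟 - 𝒮.cost K - inner ℝ g (r • u)
          = (∫ x, 𝒮.truncatedCost (K + r • u) τ x ∂𝒮.𝒟 - 𝒮.cost (K + r • u))
            + (𝒮.cost (K + r • u) - 𝒮.cost K - inner ℝ g (r • u)) := by ring
      rw [this]
      exact (norm_add_le _ _).trans (add_le_add f1 f2)
    have := (norm_nonneg _).trans f5
    gcongr
  simpa using norm_integral_le_of_norm_le_const hle

/-- Tail bound for the gradient estimate at a fixed gain, when the bias is at most half the
accuracy. -/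
theorem ExpansionAt.measureReal_gradEstimate_le (h : 𝒮.ExpansionAt ρ c κ H ω K) (hκ : 0 < κ)
    {P : ℝ} (hbdd : ∀ᵐ x ∂𝒮.𝒟, ‖x‖ ≤ P) {r τ e : ℝ} (hr : 0 < r)
    (hrρ : r * Real.sqrt ((m : ℝ) * p) ≤ ρ) (hτ : 0 ≤ τ) (he : 0 < e)
    (hbias : (c ^ 2 * ω * P ^ 2 / (2 * κ) * Real.exp (-(2 * κ) * τ) + H * (r ^ 2 * (m * p)))
        * Real.sqrt ((m : ℝ) * p) ≤ r * (e / (2 * (m * p))))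
    {N : ℕ} (hN : 0 < N) {W : Type*} [MeasurableSpace W] {μ : Measure W} [IsProbabilityMeasure μ]
    {U : ℕ → W → Gain m p} {X : ℕ → W → EuclideanSpace ℝ (Fin n)}
    (hUX : ∀ i < N, Measurable (U i) ∧ Measurable (X i) ∧
      μ.map (fun w => (U i w, X i w)) = (uniformSphere m p).prod 𝒮.𝒟)
    (hind : iIndepFun (fun (i : Fin N) w => (U i w, X i w)) μ) :
    μ.real {w | e < ‖𝒮.gradEstimate r τ N (fun i => U i w) (fun i => X i w) K
        - gradient 𝒮.cost K‖}
      ≤ 2 * (m * p) * Real.exp (-(N * (r * e / (2 * (m * p))) ^ 2) /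
        (2 * (c ^ 2 * ω * P ^ 2 / κ * Real.sqrt ((m : ℝ) * p)) ^ 2)) := by
  set d : ℝ := (m : ℝ) * p with hd
  have hd0 : 0 < d := by
    have := NeZero.pos m
    have := NeZero.pos p
    positivity
  set b : ℝ := c ^ 2 * ω * P ^ 2 / κ * Real.sqrt d with hb
  have hb0 : 0 ≤ b := by
    have h1 := (norm_nonneg _).trans (h.weight_le 0 (by
      rw [norm_zero]; exact le_trans (by positivity) hrρ))
    positivity
  set θ : ℝ := r * e / (2 * d) with hθ
  have hθ0 : 0 ≤ θ := by positivity
  have hN' : (0 : ℝ) < N := by exact_mod_cast hN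
  set Z : Fin m × Fin p → Fin N → W → ℝ :=
    fun s i w => 𝒮.estimatorTerm r τ K s (U i w, X i w) with hZ
  set z : Fin m × Fin p → ℝ :=
    fun s => ∫ q, 𝒮.estimatorTerm r τ K s q ∂(uniformSphere m p).prod 𝒮.𝒟 with hz
  have hpair : ∀ i : Fin N, Measurable fun w => (U i w, X i w) := fun i =>
    (hUX i i.2).1.prodMk (hUX i i.2).2.1
  have hhoeff : ∀ s, μ.real {w | N * θ ≤ |∑ i, (Z s i w - z s)|}
      ≤ 2 * Real.exp (-(N * θ ^ 2) / (2 * b ^ 2)) := by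
    intro s
    have hc := 𝒮.continuous_estimatorTerm r τ K s
    have := measureReal_le_abs_sum_sub_le (μ := μ) (Z := Z s) (b := b) (z := z s)
      (fun i => (hc.measurable.comp (hpair i)).aemeasurable)
      (hind.comp (fun _ => 𝒮.estimatorTerm r τ K s) fun _ => hc.measurable) hb0
      (fun i => by
        have h1 := h.ae_abs_estimatorTerm_le hκ hbdd hr.le hrρ hτ s
        rw [← (hUX i i.2).2.2] at h1
        exact ae_of_ae_map (hpair i).aemeasurable h1)
      (fun i => by
        rw [hz]
        simp only
        rw [← (hUX i i.2).2.2, integral_map (hpair i).aemeasurable hc.aestronglyMeasurable])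
      (ε := N * θ) (by positivity)
    refine this.trans (le_of_eq ?_)
    rw [Fintype.card_fin]
    congr 2
    rw [mul_pow, sq (N : ℝ)]
    -- If `b = 0` both exponents are divisions by zero, hence equal.
    rcases hb0.eq_or_lt with hb0 | hb0
    · simp [← hb0]
    · field_simp
  -- Off the union of the coordinate events each coordinate of the error is at most `e / d`: half of
  -- it is fluctuation and half is bias.
  have hsub : {w | e < ‖𝒮.gradEstimate r τ N (fun i => U i w) (fun i => X i w) K
        - gradient 𝒮.cost K‖} ⊆ ⋃ s, {w | N * θ ≤ |∑ i, (Z s i w - z s)|} := by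
    intro w hw
    by_contra hcon
    simp only [Set.mem_iUnion, Set.mem_ofPred_eq, not_exists, not_le] at hcon
    rw [Set.mem_ofPred_eq] at hw
    refine absurd hw (not_lt.2 ((norm_le_sum_abs _).trans ?_))
    have hcoord : ∀ s, |(𝒮.gradEstimate r τ N (fun i => U i w) (fun i => X i w) K
        - gradient 𝒮.cost K) s| ≤ e / d := by
      intro s
      have e1 : (𝒮.gradEstimate r τ N (fun i => U i w) (fun i => X i w) K) s
          = 1 / (r * N) * ∑ i, Z s i w := by
        rw [gradEstimate, PiLp.smul_apply, smul_eq_mul, ← Fin.sum_univ_eq_sum_range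
          (fun i => 𝒮.truncatedCost (K + r • U i w) τ (X i w) • U i w) N]
        congr 1
        rw [WithLp.ofLp_sum, Finset.sum_apply]
        exact Finset.sum_congr rfl fun i _ => by simp [hZ, estimatorTerm]
      have e2 : (𝒮.gradEstimate r τ N (fun i => U i w) (fun i => X i w) K
          - gradient 𝒮.cost K) s = 1 / (r * N) * (∑ i, (Z s i w - z s))
            + 1 / r * (z s - r * gradient 𝒮.cost K s) := by
        rw [PiLp.sub_apply, e1, Finset.sum_sub_distrib]
        simp only [Finset.sum_const, Finset.card_univ, Fintype.card_fin, nsmul_eq_mul]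
        field_simp
        ring
      have e3 := h.abs_integral_estimatorTerm_sub_le hκ hbdd hr.le hrρ hτ s
      have e4 := e3.trans hbias
      rw [e2]
      refine (abs_add_le _ _).trans ?_
      rw [abs_mul, abs_mul, abs_of_nonneg (by positivity : (0 : ℝ) ≤ 1 / (r * N)),
        abs_of_nonneg (by positivity : (0 : ℝ) ≤ 1 / r)]
      calc 1 / (r * N) * |∑ i, (Z s i w - z s)| + 1 / r * |z s - r * gradient 𝒮.cost K s|
          ≤ 1 / (r * N) * (N * θ) + 1 / r * (r * (e / (2 * d))) := by
            gcongr
            exact (hcon s).le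
        _ = e / d := by rw [hθ]; field_simp; ring
    calc ∑ s, |(𝒮.gradEstimate r τ N (fun i => U i w) (fun i => X i w) K
        - gradient 𝒮.cost K) s| ≤ ∑ _s : Fin m × Fin p, e / d :=
          Finset.sum_le_sum fun s _ => hcoord s
      _ = e := by
        simp only [Finset.sum_const, Finset.card_univ, Fintype.card_prod, Fintype.card_fin,
          nsmul_eq_mul, Nat.cast_mul]
        rw [← hd]; field_simp
  refine (measureReal_mono hsub).trans ((measureReal_iUnion_fintype_le _).trans ?_)
  refine (Finset.sum_le_sum fun s _ => hhoeff s).trans (le_of_eq ?_)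
  simp only [Finset.sum_const, Finset.card_univ, Fintype.card_prod, Fintype.card_fin,
    nsmul_eq_mul, Nat.cast_mul]
  ring

end OutputFeedbackLQR

end Concentration

/-! ### Sample complexity of the gradient estimate -/

section SampleComplexity

namespace OutputFeedbackLQR

variable {n m p : ℕ} (𝒮 : OutputFeedbackLQR n m p)

set_option maxHeartbeats 1000000 in
/-- On a sublevel set the gradient estimate has accuracy `e` with failure probability at most
`δ / 2`, for a smoothing radius of order `e`, a horizon of order `1 + log (1 / e)` and a number of
samples of order `(1 + log (1 / δ)) / e ^ 4`. -/
theorem exists_sample_complexity [NeZero m] [NeZero p] [IsProbabilityMeasure 𝒮.𝒟]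
    (hQ : 𝒮.Q.PosDef) (hR : 𝒮.R.PosDef) (hSigma : 𝒮.initialSecondMoment.PosDef) {P : ℝ}
    (hP : 0 < P) (hbdd : ∀ᵐ x ∂𝒮.𝒟, ‖x‖ ≤ P) (a : ℝ) :
    ∃ c₂ > (0 : ℝ), ∀ c₁ : ℝ, 0 < c₁ → c₁ ≤ c₂ → ∃ cτ > (0 : ℝ), ∃ cN > (0 : ℝ),
      ∀ K ∈ 𝒮.sublevel a, ∀ e δ r τ : ℝ, ∀ N : ℕ, 0 < e → e ≤ 1 → 0 < δ → δ ≤ 1 →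
        c₁ * e ≤ r → r ≤ c₂ * e → cτ * (1 + Real.log (1 / e)) ≤ τ →
        cN * (1 + Real.log (1 / δ)) / e ^ 4 ≤ (N : ℝ) →
      ∀ {W : Type*} [MeasurableSpace W] (μ : Measure W) [IsProbabilityMeasure μ]
        (U : ℕ → W → Gain m p) (X : ℕ → W → EuclideanSpace ℝ (Fin n)),
        (∀ i < N, Measurable (U i) ∧ Measurable (X i) ∧
          μ.map (fun w => (U i w, X i w)) = (uniformSphere m p).prod 𝒮.𝒟) →
        iIndepFun (fun (i : Fin N) w => (U i w, X i w)) μ →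
        μ.real {w | e < ‖𝒮.gradEstimate r τ N (fun i => U i w) (fun i => X i w) K
          - gradient 𝒮.cost K‖} ≤ δ / 2 := by
  obtain ⟨ρ, hρ, c, hc, κ, hκ, H, hH, ω, hω, hexp⟩ :=
    𝒮.exists_expansion_on_sublevel hQ hR hSigma hbdd a
  set d : ℝ := (m : ℝ) * p with hd
  have hd0 : 0 < d := by
    have := NeZero.pos m
    have := NeZero.pos p
    positivity
  set q : ℝ := Real.sqrt d with hq
  have hq0 : 0 < q := Real.sqrt_pos.2 hd0
  set t : ℝ := c ^ 2 * ω * P ^ 2 / (2 * κ) with ht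
  have ht0 : 0 < t := by positivity
  set b : ℝ := c ^ 2 * ω * P ^ 2 / κ * q with hb
  have hb0 : 0 < b := by positivity
  -- The first bound on the radius keeps the perturbed gains in the region of the expansion, the second
  -- makes the contribution of the quadratic remainder to the bias at most half of what is allowed.
  refine ⟨min (ρ / q) (1 / (4 * H * d ^ 2 * q)), by positivity, fun c₁ hc₁ _ => ?_⟩
  -- The summand `2` of `k` yields a factor `e²` in the truncation error and the other summand the
  -- constant, so that the truncation error is at most `c₁ e² / (4 d q)`.
  set k : ℝ := 2 + 4 * d * t * q / c₁ with hk
  have hk2 : 2 ≤ k := by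
    have : 0 < 4 * d * t * q / c₁ := by positivity
    rw [hk]
    linarith
  have hkexp : Real.exp (-k) ≤ c₁ / (4 * d * t * q) := by
    rw [Real.exp_neg, ← inv_div]
    refine inv_anti₀ (by positivity) ?_
    have := Real.add_one_le_exp k
    rw [hk] at this ⊢
    linarith
  -- The number of samples makes the exponential in Hoeffding's bound at most `δ / (4 d)`.
  set l : ℝ := 1 + max 0 (Real.log (4 * d)) with hl
  have hl1 : 1 ≤ l := by rw [hl]; linarith [le_max_left 0 (Real.log (4 * d))]
  refine ⟨k / (2 * κ), by positivity, 8 * d ^ 2 * b ^ 2 / c₁ ^ 2 * l, by positivity, ?_⟩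
  intro K hK e δ r τ N he he1 hδ hδ1 hr1 hr2 hτ hN W _ μ _ U X hUX hind
  have hA : 𝒮.ExpansionAt ρ c κ H ω K := ⟨fun V hV => ((hexp K hK).2 V hV).1,
    fun V hV => ((hexp K hK).2 V hV).2.1, fun V hV => ((hexp K hK).2 V hV).2.2⟩
  have hr : 0 < r := lt_of_lt_of_le (by positivity) hr1
  have hloge : 0 ≤ Real.log (1 / e) := Real.log_nonneg (by rw [le_div_iff₀ he]; linarith)
  have hlogδ : 0 ≤ Real.log (1 / δ) := Real.log_nonneg (by rw [le_div_iff₀ hδ]; linarith)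
  have hτ0 : 0 ≤ τ := le_trans (by positivity) hτ
  have hN0 : 0 < N := by
    have : (0 : ℝ) < N := lt_of_lt_of_le (by positivity) hN
    exact_mod_cast this
  have hrρ : r * q ≤ ρ := by
    have h1 : r ≤ ρ / q * e := hr2.trans (by gcongr; exact min_le_left _ _)
    calc r * q ≤ ρ / q * e * q := by gcongr
      _ = ρ * e := by field_simp
      _ ≤ ρ * 1 := by gcongr
      _ = ρ := mul_one _
  have htail : t * Real.exp (-(2 * κ) * τ) * q ≤ r * (e / (4 * d)) := by
    have h1 : Real.exp (-(2 * κ) * τ) ≤ Real.exp (-k) * e ^ 2 := by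
      have e1 : e ^ 2 = Real.exp (2 * Real.log e) := by
        rw [mul_comm, Real.exp_mul, Real.exp_log he]; norm_cast
      rw [e1, ← Real.exp_add]
      refine Real.exp_le_exp.2 ?_
      rw [div_mul_eq_mul_div, div_le_iff₀ (by positivity)] at hτ
      have e2 : Real.log (1 / e) = -Real.log e := by rw [one_div, Real.log_inv]
      rw [e2] at hτ hloge
      nlinarith
    calc t * Real.exp (-(2 * κ) * τ) * q ≤ t * (c₁ / (4 * d * t * q) * e ^ 2) * q := by
          gcongr
          exact h1.trans (by gcongr)
      _ = c₁ * e * (e / (4 * d)) := by field_simp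
      _ ≤ _ := by gcongr
  have hquad : H * (r ^ 2 * d) * q ≤ r * (e / (4 * d)) := by
    have h1 : r ≤ 1 / (4 * H * d ^ 2 * q) * e := hr2.trans (by gcongr; exact min_le_right _ _)
    calc H * (r ^ 2 * d) * q = r * (H * d * q * r) := by ring
      _ ≤ r * (H * d * q * (1 / (4 * H * d ^ 2 * q) * e)) := by gcongr
      _ = _ := by field_simp
  have hbias : (t * Real.exp (-(2 * κ) * τ) + H * (r ^ 2 * d)) * q ≤ r * (e / (2 * d)) := by
    have : r * (e / (2 * d)) = r * (e / (4 * d)) + r * (e / (4 * d)) := by field_simp; ring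
    rw [this, add_mul]
    exact add_le_add htail hquad
  refine (hA.measureReal_gradEstimate_le hκ hbdd hr hrρ hτ0 he hbias hN0 hUX hind).trans ?_
  have hexpo : l * (1 + Real.log (1 / δ)) ≤ N * (r * e / (2 * d)) ^ 2 / (2 * b ^ 2) := by
    rw [div_le_iff₀ (by positivity)] at hN
    have e1 : N * (c₁ * e * e / (2 * d)) ^ 2 / (2 * b ^ 2)
        ≤ N * (r * e / (2 * d)) ^ 2 / (2 * b ^ 2) := by gcongr
    refine le_trans ?_ e1
    have e2 : N * (c₁ * e * e / (2 * d)) ^ 2 / (2 * b ^ 2)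
        = (N * e ^ 4) * (c₁ ^ 2 / (8 * d ^ 2 * b ^ 2)) := by field_simp; ring
    rw [e2]
    calc l * (1 + Real.log (1 / δ)) = (8 * d ^ 2 * b ^ 2 / c₁ ^ 2 * l * (1 + Real.log (1 / δ)))
          * (c₁ ^ 2 / (8 * d ^ 2 * b ^ 2)) := by field_simp
      _ ≤ _ := by gcongr
  calc 2 * d * Real.exp (-(N * (r * e / (2 * d)) ^ 2) / (2 * b ^ 2))
      ≤ 2 * d * Real.exp (-Real.log (4 * d) + Real.log δ) := by
        gcongr
        rw [neg_div]
        have e2 : Real.log (1 / δ) = -Real.log δ := by rw [one_div, Real.log_inv]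
        have e3 : Real.log (4 * d) ≤ l := by rw [hl]; linarith [le_max_right 0 (Real.log (4 * d))]
        rw [e2] at hexpo hlogδ
        nlinarith
    _ = δ / 2 := by
        rw [Real.exp_add, Real.exp_neg, Real.exp_log (by positivity), Real.exp_log hδ]
        field_simp
        norm_num

end OutputFeedbackLQR

end SampleComplexity

/-! ### Descent of the projected gradient step -/

section Descent

open Filter Topology Set

variable {m p : ℕ}

theorem inner_sub_projOnto_le_zero {Ω : Set (Gain m p)} (hcl : IsClosed Ω) (hcv : Convex ℝ Ω)
    (y : Gain m p) {w : Gain m p} (hw : w ∈ Ω) :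
    inner ℝ (y - projOnto Ω y) (w - projOnto Ω y) ≤ 0 := by
  obtain ⟨hz, hmin⟩ := projOnto_spec ⟨w, hw⟩ hcl y
  refine (norm_eq_iInf_iff_real_inner_le_zero hcv hz).1 ?_ w hw
  have : Nonempty Ω := ⟨⟨w, hw⟩⟩
  refine le_antisymm (le_ciInf fun v => hmin v v.2) ?_
  exact ciInf_le ⟨0, by rintro _ ⟨v, rfl⟩; exact norm_nonneg _⟩ (⟨projOnto Ω y, hz⟩ : Ω)

theorem norm_projOnto_sub_le {Ω : Set (Gain m p)} (hne : Ω.Nonempty) (hcl : IsClosed Ω)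
    (hcv : Convex ℝ Ω) (y y' : Gain m p) : ‖projOnto Ω y - projOnto Ω y'‖ ≤ ‖y - y'‖ := by
  have h1 := inner_sub_projOnto_le_zero hcl hcv y (projOnto_spec hne hcl y').1
  have h2 := inner_sub_projOnto_le_zero hcl hcv y' (projOnto_spec hne hcl y).1
  set z := projOnto Ω y
  set z' := projOnto Ω y'
  have h3 : ‖z - z'‖ ^ 2 ≤ inner ℝ (y - y') (z - z') := by
    have e : inner ℝ (y - y') (z - z') - ‖z - z'‖ ^ 2
        = -inner ℝ (y - z) (z' - z) - inner ℝ (y' - z') (z - z') := by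
      rw [← real_inner_self_eq_norm_sq, ← inner_sub_left,
        show z' - z = -(z - z') by abel, inner_neg_right, neg_neg, ← inner_sub_left]
      congr 1
      abel
    linarith
  have h4 := h3.trans (real_inner_le_norm _ _)
  by_contra hcon
  push Not at hcon
  nlinarith [norm_nonneg (y - y'), norm_nonneg (z - z')]

namespace OutputFeedbackLQR

variable {n : ℕ} {𝒮 : OutputFeedbackLQR n m p}

/-- The quadratic upper bound along a segment inside the sublevel set. -/
theorem cost_add_smul_le {f₀ L : ℝ}
    (hgrad : ∀ K ∈ 𝒮.stabilizing, HasGradientAt 𝒮.cost (gradient 𝒮.cost K) K)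
    (hL : ∀ K K' : Gain m p, segment ℝ K K' ⊆ 𝒮.sublevel f₀ →
      ‖gradient 𝒮.cost K - gradient 𝒮.cost K'‖ ≤ L * ‖K - K'‖)
    {K D : Gain m p} {x : ℝ} (hx : 0 ≤ x)
    (hseg : ∀ u ∈ Icc 0 x, K + u • D ∈ 𝒮.sublevel f₀) :
    𝒮.cost (K + x • D)
      ≤ 𝒮.cost K + x * inner ℝ (gradient 𝒮.cost K) D + L / 2 * x ^ 2 * ‖D‖ ^ 2 := by
  set h : ℝ → ℝ := fun t => 𝒮.cost (K + t • D) - t * inner ℝ (gradient 𝒮.cost K) D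
    - L / 2 * t ^ 2 * ‖D‖ ^ 2 with hh
  have hder : ∀ t ∈ Icc 0 x, HasDerivAt h (inner ℝ (gradient 𝒮.cost (K + t • D)) D
      - inner ℝ (gradient 𝒮.cost K) D - L * t * ‖D‖ ^ 2) t := by
    intro t ht
    have h1 : HasDerivAt (fun t : ℝ => K + t • D) D t := by
      simpa using ((hasDerivAt_id t).smul_const D).const_add K
    have h2 := (hgrad _ (hseg t ht).1).hasFDerivAt.comp_hasDerivAt t h1
    have h3 : HasDerivAt (fun t : ℝ => t * inner ℝ (gradient 𝒮.cost K) D)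
        (inner ℝ (gradient 𝒮.cost K) D) t := by
      simpa using (hasDerivAt_id t).mul_const (inner ℝ (gradient 𝒮.cost K) D)
    have h4 : HasDerivAt (fun t : ℝ => L / 2 * t ^ 2 * ‖D‖ ^ 2) (L * t * ‖D‖ ^ 2) t := by
      have := ((hasDerivAt_pow 2 t).const_mul (L / 2)).mul_const (‖D‖ ^ 2)
      refine this.congr_deriv ?_
      push_cast
      ring
    exact (h2.sub h3).sub h4
  have hneg : ∀ t ∈ Icc 0 x, inner ℝ (gradient 𝒮.cost (K + t • D)) D
      - inner ℝ (gradient 𝒮.cost K) D - L * t * ‖D‖ ^ 2 ≤ 0 := by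
    intro t ht
    have hs : segment ℝ (K + t • D) K ⊆ 𝒮.sublevel f₀ := by
      rw [segment_symm, segment_eq_image']
      rintro _ ⟨θ, hθ, rfl⟩
      simp only [add_sub_cancel_left, smul_smul]
      refine hseg _ ⟨mul_nonneg hθ.1 ht.1, ?_⟩
      calc θ * t ≤ 1 * t := mul_le_mul_of_nonneg_right hθ.2 ht.1
        _ ≤ x := by rw [one_mul]; exact ht.2
    have h1 := hL _ _ hs
    rw [add_sub_cancel_left, norm_smul, Real.norm_of_nonneg ht.1] at h1
    rw [← inner_sub_left]
    have h2 := real_inner_le_norm (gradient 𝒮.cost (K + t • D) - gradient 𝒮.cost K) D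
    have h3 := mul_le_mul_of_nonneg_right h1 (norm_nonneg D)
    nlinarith
  have hanti : AntitoneOn h (Icc 0 x) := by
    refine antitoneOn_of_deriv_nonpos (convex_Icc 0 x)
      (fun t ht => (hder t ht).continuousAt.continuousWithinAt)
      (fun t ht => (hder t (interior_subset ht)).differentiableAt.differentiableWithinAt)
      fun t ht => ?_
    rw [(hder t (interior_subset ht)).deriv]
    exact hneg t (interior_subset ht)
  have := hanti ⟨le_rfl, hx⟩ ⟨hx, le_rfl⟩ hx
  simp only [hh, zero_smul, add_zero] at this
  linarith

/-- A step along a sufficiently good descent direction stays in the sublevel set and decreases the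
cost. By continuous induction, the quadratic upper bound keeps the segment inside the sublevel set,
which is closed, while the stabilizing set is open. -/
theorem cost_add_le_of_inner_le {f₀ L η : ℝ}
    (hopen : IsOpen 𝒮.stabilizing) (hclosed : IsClosed (𝒮.sublevel f₀))
    (hgrad : ∀ K ∈ 𝒮.stabilizing, HasGradientAt 𝒮.cost (gradient 𝒮.cost K) K)
    (hL0 : 0 < L) (hL : ∀ K K' : Gain m p, segment ℝ K K' ⊆ 𝒮.sublevel f₀ →
      ‖gradient 𝒮.cost K - gradient 𝒮.cost K'‖ ≤ L * ‖K - K'‖)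
    {K D : Gain m p} (hK : K ∈ 𝒮.sublevel f₀) (hD : D ≠ 0) (hη : L / 2 < η)
    (hdir : inner ℝ (gradient 𝒮.cost K) D ≤ -η * ‖D‖ ^ 2) :
    K + D ∈ 𝒮.sublevel f₀ ∧ 𝒮.cost (K + D) ≤ 𝒮.cost K - (η - L / 2) * ‖D‖ ^ 2 := by
  have hDn : 0 < ‖D‖ ^ 2 := by have := norm_pos_iff.2 hD; positivity
  have hφ : Continuous fun t : ℝ => K + t • D := by fun_prop
  -- The set of `t` with `K + u D` in the sublevel set for all `u ∈ [0, t]`; clamping `u` exhibits it as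
  -- an intersection of preimages of a closed set.
  set s : Set ℝ := {t | ∀ u : ℝ, 0 ≤ u → K + (max 0 (min u t)) • D ∈ 𝒮.sublevel f₀} with hs
  have hs_closed : IsClosed s := by
    have : s = ⋂ u : ℝ, ⋂ _ : 0 ≤ u,
        (fun t : ℝ => K + (max 0 (min u t)) • D) ⁻¹' 𝒮.sublevel f₀ := by
      ext t; simp [hs]
    rw [this]
    refine isClosed_iInter fun u => isClosed_iInter fun _ => hclosed.preimage ?_
    exact hφ.comp (continuous_const.max (continuous_const.min continuous_id))
  have hmem : ∀ x ∈ s, ∀ u ∈ Icc 0 x, K + u • D ∈ 𝒮.sublevel f₀ := by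
    intro x hx u hu
    have := hx u hu.1
    rwa [min_eq_left hu.2, max_eq_right hu.1] at this
  have hstep : ∀ x ∈ s ∩ Ico 0 1, s ∈ 𝓝[>] x := by
    rintro x ⟨hxs, hx0, hx1⟩
    have hxm := hmem x hxs x ⟨hx0, le_rfl⟩
    have hev1 : ∀ᶠ u in 𝓝[>] x, K + u • D ∈ 𝒮.stabilizing :=
      (hφ.continuousAt.eventually (hopen.mem_nhds hxm.1)).filter_mono nhdsWithin_le_nhds
    have hev2 : ∀ᶠ u in 𝓝[>] x, 𝒮.cost (K + u • D) ≤ f₀ := by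
      rcases hx0.eq_or_lt with rfl | hx0
      · -- At the start of the segment the directional derivative is negative.
        have h1 : HasDerivAt (fun t : ℝ => K + t • D) D 0 := by
          simpa using ((hasDerivAt_id (0 : ℝ)).smul_const D).const_add K
        have h2 := (hgrad _ hxm.1).hasFDerivAt.comp_hasDerivAt 0 h1
        have h3 : inner ℝ (gradient 𝒮.cost K) D < 0 := by nlinarith
        have h4 := h2.tendsto_slope_zero_right
        simp only [Function.comp_apply, zero_add, zero_smul, add_zero,
          InnerProductSpace.toDual_apply_apply] at h4
        filter_upwards [h4.eventually (gt_mem_nhds h3), self_mem_nhdsWithin] with u hu hu0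
        have hu0' : (0 : ℝ) < u := hu0
        rw [smul_eq_mul, inv_mul_eq_div, div_lt_iff₀ hu0', zero_mul] at hu
        linarith [hK.2]
      · -- Past the start the quadratic upper bound gives strict decrease at `x`, hence near `x`.
        have h1 := cost_add_smul_le hgrad hL hx0.le (hmem x hxs)
        have h2 : 𝒮.cost (K + x • D) < f₀ := by
          have h3 := mul_le_mul_of_nonneg_left hdir hx0.le
          have h4 : 0 < x * ‖D‖ ^ 2 * (η - L / 2 * x) := by
            have : L / 2 * x < η := by nlinarith
            have : 0 < η - L / 2 * x := by linarith
            positivity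
          nlinarith [hK.2]
        have h3 : ContinuousAt (fun u : ℝ => 𝒮.cost (K + u • D)) x :=
          ContinuousAt.comp (g := 𝒮.cost) (hgrad _ hxm.1).continuousAt hφ.continuousAt
        exact ((h3.eventually (gt_mem_nhds h2)).mono fun u hu => le_of_lt hu).filter_mono
          nhdsWithin_le_nhds
    obtain ⟨y, hy, hsub⟩ := mem_nhdsGT_iff_exists_Ioo_subset.1 (hev1.and hev2)
    refine mem_nhdsGT_iff_exists_Ioo_subset.2 ⟨y, hy, fun t ht u hu => ?_⟩
    rcases le_or_gt (min u t) x with hle | hgt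
    · have : max 0 (min u t) ∈ Icc 0 x := ⟨le_max_left _ _, max_le hx0 hle⟩
      exact hmem x hxs _ this
    · rw [max_eq_right (hx0.trans hgt.le)]
      exact hsub ⟨hgt, (min_le_right _ _).trans_lt ht.2⟩
  have h0 : (0 : ℝ) ∈ s := fun u hu => by simpa [hu] using hK
  have hall : Icc (0 : ℝ) 1 ⊆ s :=
    IsClosed.Icc_subset_of_forall_mem_nhdsWithin (hs_closed.inter isClosed_Icc) h0 hstep
  have h1s := hmem 1 (hall ⟨zero_le_one, le_rfl⟩)
  have h1 := h1s 1 ⟨zero_le_one, le_rfl⟩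
  have h2 := cost_add_smul_le hgrad hL zero_le_one h1s
  rw [one_smul] at h1 h2
  exact ⟨h1, by linarith⟩

/-- The projected step with an estimate `g` of the gradient of accuracy `lam * ε` decreases the cost
as long as it moves the gain by more than `ε * α`. -/
theorem cost_projOnto_le {f₀ L lam ε α : ℝ} {Ω : Set (Gain m p)} (hΩ : IsClosed Ω)
    (hΩc : Convex ℝ Ω) (hopen : IsOpen 𝒮.stabilizing) (hclosed : IsClosed (𝒮.sublevel f₀))
    (hgrad : ∀ K ∈ 𝒮.stabilizing, HasGradientAt 𝒮.cost (gradient 𝒮.cost K) K)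
    (hL0 : 0 < L) (hL : ∀ K K' : Gain m p, segment ℝ K K' ⊆ 𝒮.sublevel f₀ →
      ‖gradient 𝒮.cost K - gradient 𝒮.cost K'‖ ≤ L * ‖K - K'‖)
    (hlam : 0 < lam) (hε : 0 < ε) (hα : 0 < α) (hαL : L / 2 < (1 - lam) / α)
    {K g : Gain m p} (hK : K ∈ 𝒮.sublevel f₀) (hKΩ : K ∈ Ω)
    (hg : ‖g - gradient 𝒮.cost K‖ ≤ lam * ε)
    (hmove : ε * α < ‖projOnto Ω (K - α • g) - K‖) :
    projOnto Ω (K - α • g) ∈ 𝒮.sublevel f₀ ∧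
      𝒮.cost (projOnto Ω (K - α • g))
        ≤ 𝒮.cost K - ((1 - lam) / α - L / 2) * ‖projOnto Ω (K - α • g) - K‖ ^ 2 := by
  have hproj := inner_sub_projOnto_le_zero hΩ hΩc (K - α • g) hKΩ
  set K' := projOnto Ω (K - α • g) with hK'
  set D := K' - K with hD
  have hDpos : 0 < ‖D‖ := lt_trans (by positivity) hmove
  have hD0 : D ≠ 0 := norm_pos_iff.1 hDpos
  have h1 : α * inner ℝ g D ≤ -‖D‖ ^ 2 := by
    have e : inner ℝ (K - α • g - K') (K - K') = ‖D‖ ^ 2 + α * inner ℝ g D := by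
      rw [show K - α • g - K' = -(D + α • g) by rw [hD]; abel,
        show K - K' = -D by rw [hD]; abel, inner_neg_neg, inner_add_left,
        real_inner_self_eq_norm_sq, real_inner_smul_left]
    linarith
  have h2 : inner ℝ (gradient 𝒮.cost K) D ≤ inner ℝ g D + lam * ε * ‖D‖ := by
    have h3 : inner ℝ (gradient 𝒮.cost K) D - inner ℝ g D
        = inner ℝ (gradient 𝒮.cost K - g) D := (inner_sub_left _ _ _).symm
    have h4 := real_inner_le_norm (gradient 𝒮.cost K - g) D
    rw [norm_sub_rev] at h4
    have h5 := mul_le_mul_of_nonneg_right hg (norm_nonneg D)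
    linarith
  have h3 : inner ℝ (gradient 𝒮.cost K) D ≤ -((1 - lam) / α) * ‖D‖ ^ 2 := by
    have h4 : α * inner ℝ (gradient 𝒮.cost K) D ≤ -(1 - lam) * ‖D‖ ^ 2 := by
      have h5 := mul_le_mul_of_nonneg_left h2 hα.le
      have h6 : lam * (ε * α * ‖D‖) ≤ lam * (‖D‖ * ‖D‖) := by gcongr
      nlinarith
    have e : -((1 - lam) / α) * ‖D‖ ^ 2 = (-(1 - lam) * ‖D‖ ^ 2) / α := by ring
    rw [e, le_div_iff₀ hα]
    linarith
  have h4 := cost_add_le_of_inner_le hopen hclosed hgrad hL0 hL hK hD0 hαL h3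
  rwa [hD, add_sub_cancel] at h4

/-- Deterministic analysis of projected gradient descent with gradient estimates that are accurate
whenever the iterate lies in the initial sublevel set. -/
theorem projected_gradient_conclusion {L lam ε α : ℝ} {Ω : Set (Gain m p)} {K₀ : Gain m p}
    (hnonneg : ∀ K, 0 ≤ 𝒮.cost K) (hΩ : IsClosed Ω) (hΩc : Convex ℝ Ω)
    (hopen : IsOpen 𝒮.stabilizing) (hclosed : IsClosed (𝒮.sublevel (𝒮.cost K₀)))
    (hgrad : ∀ K ∈ 𝒮.stabilizing, HasGradientAt 𝒮.cost (gradient 𝒮.cost K) K)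
    (hL0 : 0 < L) (hL : ∀ K K' : Gain m p, segment ℝ K K' ⊆ 𝒮.sublevel (𝒮.cost K₀) →
      ‖gradient 𝒮.cost K - gradient 𝒮.cost K'‖ ≤ L * ‖K - K'‖)
    (hlam : 0 < lam) (hε : 0 < ε) (hα : 0 < α) (hαL : L / 2 < (1 - lam) / α)
    (hK₀Ω : K₀ ∈ Ω) (hK₀ : K₀ ∈ 𝒮.stabilizing) {T : ℕ} {K g : ℕ → Gain m p} (hK0 : K 0 = K₀)
    (hKs : ∀ k, K (k + 1) = projOnto Ω (K k - α • g k))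
    (hg : ∀ k < T, K k ∈ 𝒮.sublevel (𝒮.cost K₀) → ‖g k - gradient 𝒮.cost (K k)‖ ≤ lam * ε) :
    (∀ i ≤ stopIndex T ε α K, K i ∈ 𝒮.stabilizing) ∧
    (∀ i < stopIndex T ε α K, 𝒮.cost (K (i + 1)) < 𝒮.cost (K i)) ∧
    (𝒮.cost K₀ / (ε ^ 2 * α ^ 2 * ((1 - lam) / α - L / 2)) < (T : ℝ) →
      IsEpsStationary 𝒮.cost Ω α ((1 + lam) * ε) (K (stopIndex T ε α K))) := by
  set T' := stopIndex T ε α K with hT'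
  set η : ℝ := (1 - lam) / α - L / 2 with hη
  have hη0 : 0 < η := by linarith
  have hne : {k | k = T ∨ ‖K (k + 1) - K k‖ ≤ ε * α}.Nonempty := ⟨T, Or.inl rfl⟩
  have hT'mem : T' = T ∨ ‖K (T' + 1) - K T'‖ ≤ ε * α := Nat.sInf_mem hne
  have hT'T : T' ≤ T := Nat.sInf_le (Or.inl rfl)
  have hcont : ∀ i < T', ε * α < ‖K (i + 1) - K i‖ := by
    intro i hi
    by_contra hcon
    exact Nat.notMem_of_lt_sInf hi (Or.inr (not_lt.1 hcon))
  have hKΩ : ∀ i, K i ∈ Ω := by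
    intro i
    rcases i with _ | i
    · rwa [hK0]
    · rw [hKs]; exact (projOnto_spec ⟨K₀, hK₀Ω⟩ hΩ _).1
  have hstep : ∀ i < T', K i ∈ 𝒮.sublevel (𝒮.cost K₀) → K (i + 1) ∈ 𝒮.sublevel (𝒮.cost K₀) ∧
      𝒮.cost (K (i + 1)) ≤ 𝒮.cost (K i) - η * ‖K (i + 1) - K i‖ ^ 2 := by
    intro i hi hKi
    have hm := hcont i hi
    rw [hKs] at hm ⊢
    exact cost_projOnto_le hΩ hΩc hopen hclosed hgrad hL0 hL hlam hε hα hαL hKi (hKΩ i)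
      (hg i (hi.trans_le hT'T) hKi) hm
  have hind : ∀ i ≤ T', K i ∈ 𝒮.sublevel (𝒮.cost K₀) ∧
      𝒮.cost (K i) ≤ 𝒮.cost K₀ - i * (η * (ε * α) ^ 2) := by
    intro i
    induction i with
    | zero => intro _; rw [hK0]; exact ⟨⟨hK₀, le_rfl⟩, by simp⟩
    | succ i ih =>
      intro hi
      obtain ⟨h1, h2⟩ := ih (by omega)
      obtain ⟨h3, h4⟩ := hstep i (by omega) h1
      refine ⟨h3, ?_⟩
      have h5 : (ε * α) ^ 2 ≤ ‖K (i + 1) - K i‖ ^ 2 := by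
        have := hcont i (by omega)
        gcongr
      have h6 := mul_le_mul_of_nonneg_left h5 hη0.le
      push_cast
      linarith
  refine ⟨fun i hi => (hind i hi).1.1, fun i hi => ?_, fun hTlarge => ?_⟩
  · have h1 := (hstep i hi (hind i hi.le).1).2
    have h2 : 0 < ‖K (i + 1) - K i‖ := lt_trans (by positivity) (hcont i hi)
    have h3 : 0 < η * ‖K (i + 1) - K i‖ ^ 2 := by positivity
    linarith
  · rw [div_lt_iff₀ (by positivity)] at hTlarge
    -- If the algorithm ran to step `T`, the cost would have dropped below zero.
    have hneT : T' ≠ T := by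
      intro heq
      have h1 := (hind T' le_rfl).2
      rw [heq] at h1
      have h2 := hnonneg (K T)
      nlinarith
    have hsmall := hT'mem.resolve_left hneT
    have hacc := hg T' (lt_of_le_of_ne hT'T hneT) (hind T' le_rfl).1
    have h1 := norm_projOnto_sub_le ⟨K₀, hK₀Ω⟩ hΩ hΩc (K T' - α • gradient 𝒮.cost (K T'))
      (K T' - α • g T')
    rw [← hKs, sub_sub_sub_cancel_left, ← smul_sub, norm_smul, Real.norm_of_nonneg hα.le] at h1
    have h2 := h1.trans (mul_le_mul_of_nonneg_left hacc hα.le)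
    have h3 : ‖projOnto Ω (K T' - α • gradient 𝒮.cost (K T')) - K T'‖
        ≤ α * (lam * ε) + ε * α := by
      have := norm_sub_le_norm_sub_add_norm_sub
        (projOnto Ω (K T' - α • gradient 𝒮.cost (K T'))) (K (T' + 1)) (K T')
      linarith
    rw [IsEpsStationary, norm_smul, Real.norm_of_nonneg (by positivity), div_mul_eq_mul_div,
      one_mul, div_le_iff₀ hα]
    linarith

end OutputFeedbackLQR

end Descent

/-! ### Measurability of the algorithm and independence of fresh samples -/

theorem Function.Injective.measurable_extend_apply {ι κ α : Type*} [MeasurableSpace α] {g : ι → κ}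
    (hg : Function.Injective g) (c : κ → α) (k : κ) :
    Measurable fun v : ι → α => Function.extend g v c k := by
  by_cases h : ∃ i, g i = k
  · obtain ⟨i, rfl⟩ := h
    simp only [hg.extend_apply]
    exact measurable_pi_apply i
  · simp only [Function.extend_apply' _ _ _ h]
    exact measurable_const

/-- If each section of an event has probability at most `c` under the law of `Z`, then so does the
event itself, whatever the law of an independent `Y`. -/
theorem ProbabilityTheory.IndepFun.measureReal_le_of_forall {W α β : Type*} [MeasurableSpace W]
    [MeasurableSpace α] [MeasurableSpace β] {μ : Measure W} [IsProbabilityMeasure μ] {Y : W → α}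
    {Z : W → β} (h : IndepFun Y Z μ) (hY : Measurable Y) (hZ : Measurable Z) {s : Set (α × β)}
    (hs : MeasurableSet s) {c : ℝ} (hc : ∀ y, μ.real {w | (y, Z w) ∈ s} ≤ c) :
    μ.real {w | (Y w, Z w) ∈ s} ≤ c := by
  have hprob : IsProbabilityMeasure (μ.map Y) := Measure.isProbabilityMeasure_map hY.aemeasurable
  have hprob' : IsProbabilityMeasure (μ.map Z) := Measure.isProbabilityMeasure_map hZ.aemeasurable
  obtain ⟨w⟩ : Nonempty W := nonempty_of_isProbabilityMeasure μ
  have hc0 : 0 ≤ c := measureReal_nonneg.trans (hc (Y w))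
  have hlaw := (indepFun_iff_map_prod_eq_prod_map_map hY.aemeasurable hZ.aemeasurable).1 h
  have h1 : μ {w | (Y w, Z w) ∈ s} = ∫⁻ y, (μ.map Z) (Prod.mk y ⁻¹' s) ∂(μ.map Y) := by
    rw [← Measure.prod_apply hs, ← hlaw, Measure.map_apply (hY.prodMk hZ) hs]
    rfl
  have h2 : ∀ y, (μ.map Z) (Prod.mk y ⁻¹' s) ≤ ENNReal.ofReal c := by
    intro y
    rw [Measure.map_apply hZ (measurable_prodMk_left hs)]
    exact (ENNReal.le_ofReal_iff_toReal_le (measure_ne_top _ _) hc0).2 (hc y)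
  refine ENNReal.toReal_le_of_le_ofReal hc0 ?_
  rw [h1]
  exact (lintegral_mono h2).trans (by simp)

theorem measurable_gradient {F : Type*} [NormedAddCommGroup F] [InnerProductSpace ℝ F]
    [CompleteSpace F] [MeasurableSpace F] [BorelSpace F] (f : F → ℝ) :
    Measurable (gradient f) :=
  (InnerProductSpace.toDual ℝ F).symm.continuous.measurable.comp (measurable_fderiv ℝ f)

theorem measurable_projOnto {m p : ℕ} {Ω : Set (Gain m p)} (hne : Ω.Nonempty) (hcl : IsClosed Ω)
    (hcv : Convex ℝ Ω) : Measurable (projOnto Ω) := by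
  have : LipschitzWith 1 (projOnto Ω) := LipschitzWith.of_dist_le_mul fun y y' => by
    rw [NNReal.coe_one, one_mul, dist_eq_norm, dist_eq_norm]
    exact norm_projOnto_sub_le hne hcl hcv y y'
  exact this.continuous.measurable

namespace OutputFeedbackLQR

variable {n m p : ℕ} (𝒮 : OutputFeedbackLQR n m p)

theorem measurable_gradEstimate {W : Type*} [MeasurableSpace W] (r τ : ℝ) {N : ℕ}
    {U : ℕ → W → Gain m p} {X : ℕ → W → EuclideanSpace ℝ (Fin n)} {K : W → Gain m p}
    (hUX : ∀ i < N, Measurable (U i) ∧ Measurable (X i)) (hK : Measurable K) :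
    Measurable fun w => 𝒮.gradEstimate r τ N (fun i => U i w) (fun i => X i w) (K w) := by
  have hterm : ∀ i ∈ Finset.range N, Measurable fun w =>
      𝒮.truncatedCost (K w + r • U i w) τ (X i w) • U i w := by
    intro i hi
    obtain ⟨hU, hX⟩ := hUX i (Finset.mem_range.1 hi)
    have hKU : Measurable fun w => K w + r • U i w := hK.add (hU.const_smul r)
    exact ((𝒮.continuous_truncatedCost τ).measurable.comp (hKU.prodMk hX)).smul hU
  exact (Finset.measurable_fun_sum _ hterm).const_smul (1 / (r * (N : ℝ)))

theorem gradEstimate_congr (r τ : ℝ) {N : ℕ} {U U' : ℕ → Gain m p}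
    {X X' : ℕ → EuclideanSpace ℝ (Fin n)} (h : ∀ i < N, U i = U' i ∧ X i = X' i) (K : Gain m p) :
    𝒮.gradEstimate r τ N U X K = 𝒮.gradEstimate r τ N U' X' K := by
  have : ∀ i ∈ Finset.range N, 𝒮.truncatedCost (K + r • U i) τ (X i) • U i
      = 𝒮.truncatedCost (K + r • U' i) τ (X' i) • U' i := by
    intro i hi
    rw [(h i (Finset.mem_range.1 hi)).1, (h i (Finset.mem_range.1 hi)).2]
  rw [gradEstimate, gradEstimate, Finset.sum_congr rfl this]

theorem measurable_pgIterate {W : Type*} [MeasurableSpace W] {Ω : Set (Gain m p)}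
    (hne : Ω.Nonempty) (hcl : IsClosed Ω) (hcv : Convex ℝ Ω) (α r τ : ℝ) {N : ℕ}
    {U : ℕ → ℕ → W → Gain m p} {X : ℕ → ℕ → W → EuclideanSpace ℝ (Fin n)} (K₀ : Gain m p) {k : ℕ}
    (hUX : ∀ j < k, ∀ i < N, Measurable (U j i) ∧ Measurable (X j i)) :
    Measurable fun w =>
      pgIterate 𝒮 Ω α r τ N (fun j i => U j i w) (fun j i => X j i w) K₀ k := by
  induction k with
  | zero => exact measurable_const
  | succ k ih =>
    have hk := ih fun j hj => hUX j (hj.trans k.lt_succ_self)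
    exact (measurable_projOnto hne hcl hcv).comp
      (hk.sub ((𝒮.measurable_gradEstimate r τ (hUX k k.lt_succ_self) hk).const_smul α))

theorem pgIterate_congr (Ω : Set (Gain m p)) (α r τ : ℝ) {N : ℕ} {U U' : ℕ → ℕ → Gain m p}
    {X X' : ℕ → ℕ → EuclideanSpace ℝ (Fin n)} (K₀ : Gain m p) {k : ℕ}
    (h : ∀ j < k, ∀ i < N, U j i = U' j i ∧ X j i = X' j i) :
    pgIterate 𝒮 Ω α r τ N U X K₀ k = pgIterate 𝒮 Ω α r τ N U' X' K₀ k := by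
  induction k with
  | zero => rfl
  | succ k ih =>
    rw [pgIterate, pgIterate, ih fun j hj => h j (hj.trans k.lt_succ_self),
      𝒮.gradEstimate_congr r τ (h k k.lt_succ_self)]

/-- The iterate `K_k` is a function of the samples of the steps before `k`, hence independent of
the samples drawn at step `k`. -/
theorem indepFun_pgIterate {W : Type*} [MeasurableSpace W] {μ : Measure W} {Ω : Set (Gain m p)}
    (hne : Ω.Nonempty) (hcl : IsClosed Ω) (hcv : Convex ℝ Ω) (α r τ : ℝ) {T N : ℕ}
    {U : ℕ → ℕ → W → Gain m p} {X : ℕ → ℕ → W → EuclideanSpace ℝ (Fin n)} (K₀ : Gain m p)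
    (hUX : ∀ k < T, ∀ i < N, Measurable (U k i) ∧ Measurable (X k i))
    (hindep : iIndepFun (fun (s : Fin T × Fin N) (w : W) => (U s.1 s.2 w, X s.1 s.2 w)) μ)
    (k : Fin T) :
    IndepFun (fun w => pgIterate 𝒮 Ω α r τ N (fun j i => U j i w) (fun j i => X j i w) K₀ k)
      (fun w (i : Fin N) => (U k i w, X k i w)) μ := by
  set past : Finset (Fin T × Fin N) := Finset.univ.filter fun s => s.1 < k with hpast
  set now : Finset (Fin T × Fin N) := Finset.univ.filter fun s => s.1 = k with hnow
  have hdisj : Disjoint past now := by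
    rw [Finset.disjoint_left]
    intro s hs hs'
    rw [hpast, Finset.mem_filter] at hs
    rw [hnow, Finset.mem_filter] at hs'
    exact absurd hs'.2 hs.2.ne
  have hI := hindep.indepFun_finset past now hdisj
    fun s => (hUX s.1 s.1.2 s.2 s.2.2).1.prodMk (hUX s.1 s.1.2 s.2 s.2.2).2
  -- The samples of the past, extended by zero, determine the iterate.
  set ι : past → ℕ × ℕ := fun s => ((s.1.1 : ℕ), (s.1.2 : ℕ)) with hι
  have hinj : Function.Injective ι := by
    rintro ⟨⟨a, b⟩, h⟩ ⟨⟨a', b'⟩, h'⟩ hab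
    simp only [hι, Prod.mk.injEq, Fin.val_inj] at hab
    simp [hab.1, hab.2]
  set ψ : (past → Gain m p × EuclideanSpace ℝ (Fin n)) → Gain m p := fun v =>
    pgIterate 𝒮 Ω α r τ N (fun j i => (Function.extend ι v 0 (j, i)).1)
      (fun j i => (Function.extend ι v 0 (j, i)).2) K₀ k with hψ
  have hψm : Measurable ψ := 𝒮.measurable_pgIterate hne hcl hcv α r τ K₀ fun j _ i _ =>
    ⟨(hinj.measurable_extend_apply 0 (j, i)).fst, (hinj.measurable_extend_apply 0 (j, i)).snd⟩
  set φ : (now → Gain m p × EuclideanSpace ℝ (Fin n)) → Fin N → Gain m p × EuclideanSpace ℝ (Fin n)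
    := fun v i => v ⟨(k, i), by simp [hnow]⟩ with hφ
  have hφm : Measurable φ := measurable_pi_iff.2 fun i => measurable_pi_apply _
  have hcomp := hI.comp hψm hφm
  refine hcomp.congr (Filter.Eventually.of_forall fun w => ?_)
    (Filter.Eventually.of_forall fun w => rfl)
  refine 𝒮.pgIterate_congr Ω α r τ K₀ fun j hj i hi => ?_
  have hs : ((⟨j, hj.trans k.2⟩, ⟨i, hi⟩) : Fin T × Fin N) ∈ past := by
    rw [hpast, Finset.mem_filter]
    exact ⟨Finset.mem_univ _, hj⟩
  have := hinj.extend_apply (fun s : past => (U s.1.1 s.1.2 w, X s.1.1 s.1.2 w)) 0 ⟨_, hs⟩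
  simp only [hι] at this
  rw [this]
  exact ⟨rfl, rfl⟩

/-- If the estimate at a fixed gain of `S(f₀)` fails with probability at most `c`, then with
probability at least `1 - T c` the estimates at all iterates in `S(f₀)` are accurate. -/
theorem exists_event_accurate {W : Type*} [MeasurableSpace W] {μ : Measure W}
    [IsProbabilityMeasure μ] {Ω : Set (Gain m p)}
    (hne : Ω.Nonempty) (hcl : IsClosed Ω) (hcv : Convex ℝ Ω) (α r τ : ℝ) {T N : ℕ}
    {U : ℕ → ℕ → W → Gain m p} {X : ℕ → ℕ → W → EuclideanSpace ℝ (Fin n)} (K₀ : Gain m p)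
    (hUX : ∀ k < T, ∀ i < N, Measurable (U k i) ∧ Measurable (X k i))
    (hindep : iIndepFun (fun (s : Fin T × Fin N) (w : W) => (U s.1 s.2 w, X s.1 s.2 w)) μ)
    {f₀ e c : ℝ} (hclosed : IsClosed (𝒮.sublevel f₀)) (hc0 : 0 ≤ c)
    (hc : ∀ K ∈ 𝒮.sublevel f₀, ∀ k < T, μ.real {w | e < ‖𝒮.gradEstimate r τ N
      (fun i => U k i w) (fun i => X k i w) K - gradient 𝒮.cost K‖} ≤ c) :
    ∃ E : Set W, MeasurableSet E ∧ 1 - T * c ≤ μ.real E ∧ ∀ w ∈ E, ∀ K : ℕ → Gain m p,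
      K = pgIterate 𝒮 Ω α r τ N (fun k i => U k i w) (fun k i => X k i w) K₀ →
      ∀ k < T, K k ∈ 𝒮.sublevel f₀ → ‖𝒮.gradEstimate r τ N (fun i => U k i w)
        (fun i => X k i w) (K k) - gradient 𝒮.cost (K k)‖ ≤ e := by
  -- The samples of one step as functions on `ℕ`, extended by zero.
  set ι : Fin N → ℕ := fun i => i with hι
  have hinj : Function.Injective ι := Fin.val_injective
  set bad : Set (Gain m p × (Fin N → Gain m p × EuclideanSpace ℝ (Fin n))) :=
    {q | q.1 ∈ 𝒮.sublevel f₀ ∧ e < ‖𝒮.gradEstimate r τ N (fun i => (Function.extend ι q.2 0 i).1)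
      (fun i => (Function.extend ι q.2 0 i).2) q.1 - gradient 𝒮.cost q.1‖} with hbad
  have hbadm : MeasurableSet bad := by
    have h1 : Measurable fun q : Gain m p × (Fin N → Gain m p × EuclideanSpace ℝ (Fin n)) =>
        𝒮.gradEstimate r τ N (fun i => (Function.extend ι q.2 0 i).1)
          (fun i => (Function.extend ι q.2 0 i).2) q.1 :=
      𝒮.measurable_gradEstimate r τ (fun i _ =>
        ⟨((hinj.measurable_extend_apply 0 i).comp measurable_snd).fst,
          ((hinj.measurable_extend_apply 0 i).comp measurable_snd).snd⟩) measurable_fst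
    have h2 := (h1.sub ((measurable_gradient 𝒮.cost).comp measurable_fst)).norm
    exact (measurable_fst hclosed.measurableSet).inter
      (measurableSet_lt (measurable_const (a := e)) h2)
  have hext : ∀ (K : Gain m p) (k : ℕ) (w : W), 𝒮.gradEstimate r τ N
      (fun i => (Function.extend ι (fun i : Fin N => (U k i w, X k i w)) 0 i).1)
      (fun i => (Function.extend ι (fun i : Fin N => (U k i w, X k i w)) 0 i).2) K
      = 𝒮.gradEstimate r τ N (fun i => U k i w) (fun i => X k i w) K := by
    intro K k w
    refine 𝒮.gradEstimate_congr r τ (fun i hi => ?_) K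
    have := hinj.extend_apply (fun i : Fin N => (U k i w, X k i w)) 0 ⟨i, hi⟩
    simp only [hι] at this
    rw [this]
    exact ⟨rfl, rfl⟩
  set Y : Fin T → W → Gain m p := fun k w =>
    pgIterate 𝒮 Ω α r τ N (fun j i => U j i w) (fun j i => X j i w) K₀ k with hY
  set Z : Fin T → W → Fin N → Gain m p × EuclideanSpace ℝ (Fin n) := fun k w i =>
    (U k i w, X k i w) with hZ
  have hYm : ∀ k, Measurable (Y k) := fun k =>
    𝒮.measurable_pgIterate hne hcl hcv α r τ K₀ fun j hj => hUX j (hj.trans k.2)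
  have hZm : ∀ k, Measurable (Z k) := fun k => measurable_pi_iff.2 fun i =>
    (hUX k k.2 i i.2).1.prodMk (hUX k k.2 i i.2).2
  have hprob : ∀ k, μ.real {w | (Y k w, Z k w) ∈ bad} ≤ c := by
    intro k
    refine (𝒮.indepFun_pgIterate hne hcl hcv α r τ K₀ hUX hindep k).measureReal_le_of_forall
      (hYm k) (hZm k) hbadm fun K => ?_
    by_cases hK : K ∈ 𝒮.sublevel f₀
    · refine le_trans (le_of_eq ?_) (hc K hK k k.2)
      congr 1
      ext w
      simp only [hbad, Set.mem_ofPred_eq, hext, hK, true_and]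
    · have : {w | (K, fun i : Fin N => (U k i w, X k i w)) ∈ bad} = ∅ := by
        ext w
        simp [hbad, hK]
      rw [this]
      simpa using hc0
  have hm : ∀ k, MeasurableSet {w | (Y k w, Z k w) ∈ bad} := fun k =>
    ((hYm k).prodMk (hZm k)) hbadm
  refine ⟨(⋃ k, {w | (Y k w, Z k w) ∈ bad})ᶜ, (MeasurableSet.iUnion hm).compl, ?_, ?_⟩
  · rw [probReal_compl_eq_one_sub (MeasurableSet.iUnion hm)]
    have h1 := measureReal_iUnion_fintype_le (μ := μ) fun k => {w | (Y k w, Z k w) ∈ bad}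
    have h2 : ∑ k, μ.real {w | (Y k w, Z k w) ∈ bad} ≤ T * c := by
      refine (Finset.sum_le_sum fun k _ => hprob k).trans (le_of_eq ?_)
      simp
    linarith
  · rintro w hw K rfl k hk hmem
    by_contra hcon
    refine hw (Set.mem_iUnion.2 ⟨⟨k, hk⟩, hmem, ?_⟩)
    rw [hext]
    exact not_le.1 hcon

end OutputFeedbackLQR

/-! ### Convergence of the algorithm with high probability -/

theorem mainTheorem1 {n m p : ℕ} [NeZero m] [NeZero p] (𝒮 : OutputFeedbackLQR n m p)
    (hQ : 𝒮.Q.PosDef) (hR : 𝒮.R.PosDef) [IsProbabilityMeasure 𝒮.𝒟]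
    (hSigma : 𝒮.initialSecondMoment.PosDef)
    (P : ℝ) (hP : 0 < P) (hbdd : ∀ᵐ x ∂𝒮.𝒟, ‖x‖ ≤ P) (a : ℝ) :
    -- thresholds that depend only on the problem data and the level `a`
    ∃ c₂ > (0 : ℝ), ∀ c₁ : ℝ, 0 < c₁ → c₁ ≤ c₂ → ∃ cτ > (0 : ℝ), ∃ cN > (0 : ℝ),
      -- the constraint set, the initial gain and the smoothness constant on `S(f(K₀))`
      ∀ (Ω : Set (Gain m p)), IsClosed Ω → Convex ℝ Ω →
      ∀ K₀ ∈ Ω, K₀ ∈ 𝒮.sublevel a →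
      ∀ L > (0 : ℝ),
        (∀ K K' : Gain m p, segment ℝ K K' ⊆ 𝒮.sublevel (𝒮.cost K₀) →
          ‖gradient 𝒮.cost K - gradient 𝒮.cost K'‖ ≤ L * ‖K - K'‖) →
      ∀ lam ε δ α : ℝ, 0 < lam → lam < 1 → 0 < ε → 0 < δ →
        0 < α → α < 2 * (1 - lam) / L →
      -- the parameters of the algorithm, for the estimation accuracy `lam * ε`
      ∀ (T N : ℕ) (r τ : ℝ), 0 < T →
        c₁ * min 1 (lam * ε) ≤ r → r ≤ c₂ * min 1 (lam * ε) →
        cτ * (1 + Real.log (1 / min 1 (lam * ε))) ≤ τ →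
        cN * (1 + Real.log (1 / min 1 δ)) / (min 1 (lam * ε)) ^ 4 ≤ (N : ℝ) →
      -- the samples: independent pairs, each with law `uniform × 𝒟`
      ∀ {W : Type*} [MeasurableSpace W] (μ : Measure W) [IsProbabilityMeasure μ]
        (U : ℕ → ℕ → W → Gain m p) (X : ℕ → ℕ → W → EuclideanSpace ℝ (Fin n)),
        (∀ k < T, ∀ i < N, Measurable (U k i) ∧ Measurable (X k i) ∧
          μ.map (fun w => (U k i w, X k i w)) = (uniformSphere m p).prod 𝒮.𝒟) →
        iIndepFun (fun (s : Fin T × Fin N) (w : W) => (U s.1 s.2 w, X s.1 s.2 w)) μ →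
        ∃ E : Set W, MeasurableSet E ∧ 1 - (T : ℝ) * δ < μ.real E ∧
          ∀ w ∈ E, ∀ (K : ℕ → Gain m p) (T' : ℕ),
            K = pgIterate 𝒮 Ω α r τ N (fun k i => U k i w) (fun k i => X k i w) K₀ →
            T' = stopIndex T ε α K →
            (∀ i ≤ T', K i ∈ 𝒮.stabilizing) ∧
            (∀ i < T', 𝒮.cost (K (i + 1)) < 𝒮.cost (K i)) ∧
            (𝒮.cost K₀ / (ε ^ 2 * α ^ 2 * ((1 - lam) / α - L / 2)) < (T : ℝ) →
              IsEpsStationary 𝒮.cost Ω α ((1 + lam) * ε) (K T')) := by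
  obtain ⟨c₂, hc₂, h⟩ := 𝒮.exists_sample_complexity hQ hR hSigma hP hbdd a
  refine ⟨c₂, hc₂, fun c₁ hc₁ hc₁₂ => ?_⟩
  obtain ⟨cτ, hcτ, cN, hcN, h⟩ := h c₁ hc₁ hc₁₂
  refine ⟨cτ, hcτ, cN, hcN, ?_⟩
  intro Ω hΩ hΩc K₀ hK₀Ω hK₀ L hL0 hL lam ε δ α hlam hlam1 hε hδ hα hαL T N r τ hT hr hr' hτ hN
    W _ μ _ U X hUX hindep
  have he : 0 < min 1 (lam * ε) := lt_min one_pos (mul_pos hlam hε)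
  have hd : 0 < min 1 δ := lt_min one_pos hδ
  have hclosed := 𝒮.isClosed_sublevel hQ hR hSigma hbdd (𝒮.cost K₀)
  obtain ⟨E, hE, hμE, hacc⟩ := 𝒮.exists_event_accurate (μ := μ) ⟨K₀, hK₀Ω⟩ hΩ hΩc α r τ K₀
    (fun k hk i hi => ⟨(hUX k hk i hi).1, (hUX k hk i hi).2.1⟩) hindep
    (e := min 1 (lam * ε)) (c := min 1 δ / 2) hclosed (by positivity) (by
      intro K hK k hk
      refine h K ⟨hK.1, hK.2.trans hK₀.2⟩ _ _ r τ N he (min_le_left _ _) hd (min_le_left _ _)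
        hr hr' hτ hN μ (U k) (X k) (hUX k hk) ?_
      exact hindep.precomp (g := fun i : Fin N => ((⟨k, hk⟩ : Fin T), i))
        fun i j hij => (Prod.mk.inj hij).2)
  refine ⟨E, hE, ?_, ?_⟩
  · have hT' : (0 : ℝ) < T := by exact_mod_cast hT
    -- The factor `1 / 2` in the failure probability makes the inequality strict.
    have : (T : ℝ) * (min 1 δ / 2) < T * δ := by
      refine mul_lt_mul_of_pos_left ?_ hT'
      linarith [min_le_right 1 δ]
    linarith
  · rintro w hw K T' hK rfl
    refine 𝒮.projected_gradient_conclusion (g := fun k => 𝒮.gradEstimate r τ N (fun i => U k i w)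
      (fun i => X k i w) (K k)) (𝒮.cost_nonneg hQ hR) hΩ hΩc
      (𝒮.isOpen_stabilizing hQ hR hSigma hbdd) hclosed ?_ hL0 hL hlam hε hα ?_ hK₀Ω hK₀.1 ?_ ?_ ?_
    · exact fun K hK => (𝒮.hasGradientAt_cost hQ hR hSigma hbdd hK).differentiableAt.hasGradientAt
    · rw [lt_div_iff₀ hL0] at hαL
      rw [lt_div_iff₀ hα]
      linarith
    · rw [hK]
      rfl
    · intro k
      simp only [hK]
      rfl
    · exact fun k hk hmem => (hacc w hw K hK k hk hmem).trans (min_le_right _ _)
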